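/- **Setting.** A homogeneous CR geometry is described at its base point $o$ by a tuple $(\mathfrak g,\mathfrak h,D,J)$. Here $\mathfrak g$ is a finite-dimensional real Lie algebra of infinitesimal CR automorphisms, acting transitively and effectively. The subalgebra $\mathfrak h\subset\mathfrak g$ is the isotropy algebra, so that $T_oM=\mathfrak g/\mathfrak h$, and effectivity means that $\mathfrak h$ contains no nonzero ideal of $\mathfrak g$. The subspace $D\supset\mathfrak h$ is the preimage of the complex tangent space $T^{-1}_oM$. Finally, $J$ is an $\mathfrak h$-invariant complex structure on $T^{-1}_oM=D/\mathfrak h$ that satisfies, for $x,y\in D$, $$[Jx,Jy]-[x,y]\in D,\qquad [Jx,Jy]-[x,y]-J([Jx,y]+[x,Jy])\in\mathfrak h .$$ Put $F^{-1}=D$ and $F^{i-1}=F^i+[D,F^i]$ for $i\le -1$, and let $F^0=\{x\in D:[x,D]\subset D\}$ be the preimage of the Levi kernel. The geometry is *2-nondegenerate* if $F^i=\mathfrak g$ for some $i$ and the map $$\iota:F^0/\mathfrak h\to\mathfrak{gl}(D/F^0),\qquad \iota(x)(y)=[x,y]+J[x,Jy],$$ given by the complex antilinear part of the bracket, is injective.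 A *second-order Levi–Tanaka algebra* $(\mathfrak g_-,I,\mathfrak k)$ consists of a graded Lie algebra $\mathfrak g_-=\bigoplus_{i<0}\mathfrak g_i$ that is generated by $\mathfrak g_{-1}$ and has no nonzero ideal contained in $\mathfrak g_{-1}$, a complex structure $I$ on $\mathfrak g_{-1}$ with $[Ix,Iy]=[x,y]$, and a real subspace $\mathfrak k\subset\mathfrak{gl}(\mathfrak g_{-1})$ of $I$-antilinear maps that is stable under composition with $I$. The second-order Levi–Tanaka algebra of $(\mathfrak g,\mathfrak h,D,J)$ is the graded Lie algebra $\bigoplus_{i<0}F^i/F^{i+1}$ with the complex structure induced by $J$ on $D/F^0$ and with $\mathfrak k=\operatorname{im}\iota$ (up to isomorphism). A second-order Levi–Tanaka algebra is *regular* if every element of $\mathfrak k$ extends to a grading preserving derivation of $\mathfrak g_-$ and $[[\mathfrak k,\mathfrak k],\mathfrak k]\subset\mathfrak k$. **Proposition.** Let $(\mathfrak g,\mathfrak h,D,J)$ be a homogeneous 2-nondegenerate CR geometry with second-order Levi–Tanaka algebra $(\mathfrak g_-,I,\mathfrak k)$. Suppose that $\mathfrak g$ is semisimple and that $\dim\mathfrak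 g$ is maximal among all homogeneous 2-nondegenerate CR geometries with second-order Levi–Tanaka algebra $(\mathfrak g_-,I,\mathfrak k)$. Then $\mathfrak h$ is contained in a parabolic subalgebra $\mathfrak p$ of $\mathfrak g$. Moreover, there is a grading $\mathfrak g=\bigoplus_{i\in\mathbb Z}\mathfrak g_i$ with $\mathfrak p=\bigoplus_{i\ge0}\mathfrak g_i$, with $F^k=\bigoplus_{i\ge k}\mathfrak g_i$ for all $k\le 0$, and with $\mathfrak h=\mathfrak g_{0,I}\oplus\bigoplus_{i>0}\mathfrak g_i$, where $\mathfrak g_{0,I}=\mathfrak g_0\cap\mathfrak h$; and there is a bigrading $\mathfrak g\otimes\mathbb C=\bigoplus_{(a,b)\in\mathbb Z^2}\mathfrak g_{a,b}$, $[\mathfrak g_{a,b},\mathfrak g_{c,d}]\subset\mathfrak g_{a+c,b+d}$, such that 1. $(\mathfrak g_0,\mathfrak g_{0,I})$, with the complex structure induced by $J$ on $\mathfrak g_0/\mathfrak g_{0,I}\cong F^0/\mathfrak h$, is a (pseudo-)Hermitian symmetric pair: $\mathfrak g_{0,I}$ is the fixed point algebra of an involutive automorphism of $\mathfrak g_0$,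 and on its $(-1)$-eigenspace the complex structure is $\mathfrak g_{0,I}$-invariant and orthogonal for some $\mathfrak g_{0,I}$-invariant nondegenerate symmetric bilinear form (of any signature); 2. $\mathfrak g_a\otimes\mathbb C=\sum_b\mathfrak g_{a,b}$ for all $a$; 3. $\mathfrak g_{0,I}\otimes\mathbb C=\mathfrak g_{0,0}$; 4. $\mathfrak g_0\otimes\mathbb C=\mathfrak g_{0,-1}\oplus\mathfrak g_{0,0}\oplus\mathfrak g_{0,1}$; 5. $\mathfrak g_{-1}\otimes\mathbb C=\mathfrak g_{-1,-1}\oplus\mathfrak g_{-1,0}$; 6. $\mathfrak g_{-2}\otimes\mathbb C=\mathfrak g_{-2,-1}$. In particular, the second-order Levi–Tanaka algebra $(\mathfrak g_-,I,\mathfrak k)$ is regular. -/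

import Mathlib

open scoped TensorProduct DirectSum

universe u v

/-- `gr` is a grading of the Lie algebra `L`: `L = ⨁ i, gr i` and `⁅gr i, gr j⁆ ⊆ gr (i + j)`. -/
def IsLieGrading {R L ι : Type*} [CommRing R] [LieRing L] [LieAlgebra R L] [AddMonoid ι]
    [DecidableEq ι] (gr : ι → Submodule R L) : Prop :=
  DirectSum.IsInternal gr ∧ ∀ i j : ι, ∀ x ∈ gr i, ∀ y ∈ gr j, ⁅x, y⁆ ∈ gr (i + j)

/-- A second-order Levi–Tanaka algebra `(𝔤₋, I, 𝔨)`: a graded Lie algebra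
`𝔤₋ = ⨁_{k ≥ 1} 𝔤₋ₖ` generated by `𝔤₋₁`, nondegenerate, with a complex structure `I` on `𝔤₋₁`
such that `⁅I x, I y⁆ = ⁅x, y⁆`, together with a space `𝔨` of `I`-antilinear endomorphisms of `𝔤₋₁`
that is stable under composition with `I`. The component of degree `-k` is written `part k`. -/
structure SecondOrderLeviTanaka (n : Type v) [LieRing n] [LieAlgebra ℝ n] where
  part : ℕ → Submodule ℝ n
  grading : IsLieGrading part
  part_zero : part 0 = ⊥
  generated : ∀ k : ℕ, 1 ≤ k →
    part (k + 1) = Submodule.span ℝ {z | ∃ x ∈ part 1, ∃ y ∈ part k, z = ⁅x, y⁆}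
  nondegenerate : ∀ 𝔞 : LieIdeal ℝ n, 𝔞.toSubmodule ≤ part 1 → 𝔞 = ⊥
  I : Module.End ℝ (part 1)
  I_sq : ∀ v, I (I v) = -v
  levi : ∀ v w, ⁅(I v : n), (I w : n)⁆ = ⁅(v : n), (w : n)⁆
  k : Submodule ℝ (Module.End ℝ (part 1))
  k_antilinear : ∀ T ∈ k, ∀ v, T (I v) = -I (T v)
  k_complex : ∀ T ∈ k, I * T ∈ k

/-- Regularity of `(𝔤₋, I, 𝔨)`: every element of `𝔨` extends to a grading preserving derivation
of `𝔤₋`, and `⁅⁅𝔨, 𝔨⁆, 𝔨⁆ ⊆ 𝔨`. (As `𝔤₋₁` generates `𝔤₋`, a derivation is determined by its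
restriction to `𝔤₋₁`, so the bracket of the derivations is the commutator in `𝔤𝔩(𝔤₋₁)`.) -/
def SecondOrderLeviTanaka.IsRegular {n : Type v} [LieRing n] [LieAlgebra ℝ n]
    (S : SecondOrderLeviTanaka n) : Prop :=
  (∀ T ∈ S.k, ∃ δ : LieDerivation ℝ n n,
    (∀ i, ∀ x ∈ S.part i, δ x ∈ S.part i) ∧ ∀ v : S.part 1, δ (v : n) = (T v : n)) ∧
  ∀ A ∈ S.k, ∀ B ∈ S.k, ∀ C ∈ S.k, ⁅⁅A, B⁆, C⁆ ∈ S.k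

/-- A homogeneous CR geometry with transitive and effective symmetry algebra `g`, given by its
data at the base point `o`: the isotropy subalgebra `h`, so that `T_o M = g / h`, the preimage `D`
in `g` of the complex tangent space `T⁻¹_o M ⊆ g / h`, and the complex structure on
`T⁻¹_o M = D / h`. The latter is represented by a linear map `J` of `g` of which only the class of
`J x` modulo `h` for `x ∈ D` matters; all the conditions are independent of the representative. -/
structure HomogeneousCR (g : Type u) [LieRing g] [LieAlgebra ℝ g] where
  h : LieSubalgebra ℝ g
  D : Submodule ℝ g
  h_le : h.toSubmodule ≤ D
  J : g →ₗ[ℝ] g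
  J_mem : ∀ x ∈ D, J x ∈ D
  J_isotropy : ∀ x ∈ h, J x ∈ h
  J_sq : ∀ x ∈ D, J (J x) + x ∈ h
  -- the isotropy preserves `T⁻¹_o M` and its complex structure
  isotropy_lie_mem : ∀ x ∈ h, ∀ y ∈ D, ⁅x, y⁆ ∈ D
  isotropy_lie_J : ∀ x ∈ h, ∀ y ∈ D, ⁅x, J y⁆ - J ⁅x, y⁆ ∈ h
  -- compatibility of the complex structure with the Levi bracket, and (formal) integrability
  levi : ∀ x ∈ D, ∀ y ∈ D, ⁅J x, J y⁆ - ⁅x, y⁆ ∈ D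
  integrable : ∀ x ∈ D, ∀ y ∈ D, ⁅J x, J y⁆ - ⁅x, y⁆ - J (⁅J x, y⁆ + ⁅x, J y⁆) ∈ h
  -- the symmetry algebra acts effectively
  effective : ∀ 𝔞 : LieIdeal ℝ g, 𝔞.toSubmodule ≤ h.toSubmodule → 𝔞 = ⊥

namespace HomogeneousCR

variable {g : Type u} [LieRing g] [LieAlgebra ℝ g]

/-- The preimage in `g` of the Levi kernel `𝒦_o ⊆ T⁻¹_o M`. -/
def leviKernel (C : HomogeneousCR g) : Submodule ℝ g where
  carrier := {x | x ∈ C.D ∧ ∀ y ∈ C.D, ⁅x, y⁆ ∈ C.D}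
  add_mem' := fun ha hb => ⟨C.D.add_mem ha.1 hb.1, fun y hy => by
    rw [add_lie]; exact C.D.add_mem (ha.2 y hy) (hb.2 y hy)⟩
  zero_mem' := ⟨C.D.zero_mem, fun y _ => by rw [zero_lie]; exact C.D.zero_mem⟩
  smul_mem' := fun c x hx => ⟨C.D.smul_mem c hx.1, fun y hy => by
    rw [smul_lie]; exact C.D.smul_mem c (hx.2 y hy)⟩

/-- The filtration: `filt 0` is the preimage of the Levi kernel, `filt 1 = D`, and for `k ≥ 1`,
`filt k` is the preimage of `T⁻ᵏ_o M`, where `T⁻ᵏ⁻¹ M = T⁻ᵏ M + [T⁻¹ M, T⁻ᵏ M]`. -/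
def filt (C : HomogeneousCR g) : ℕ → Submodule ℝ g
  | 0 => C.leviKernel
  | 1 => C.D
  | (k + 2) => C.filt (k + 1) ⊔
      Submodule.span ℝ {z | ∃ x ∈ C.D, ∃ y ∈ C.filt (k + 1), z = ⁅x, y⁆}

/-- Twice the complex antilinear part of the bracket of `x ∈ leviKernel` and `y ∈ D`. -/
def antilinearBracket (C : HomogeneousCR g) (x y : g) : g := ⁅x, y⁆ + C.J ⁅x, C.J y⁆

/-- The geometry is 2-nondegenerate: `T⁻¹ M` generates `T M`, and the map
`ι : 𝒦_o → 𝔤𝔩(T⁻¹_o M / 𝒦_o)` given by the antilinear part of the bracket is injective. -/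
def IsTwoNondegenerate (C : HomogeneousCR g) : Prop :=
  (∃ k, C.filt k = ⊤) ∧
  ∀ x ∈ C.leviKernel, (∀ y ∈ C.D, C.antilinearBracket x y ∈ C.leviKernel) → x ∈ C.h

/-- `S` is the second-order Levi–Tanaka algebra of the geometry: there are linear maps
`π k`, of which only the restriction to `filt k` matters, that induce for `k ≥ 1` isomorphisms
`filt k / filt (k - 1) ≅ 𝔤₋ₖ`, that is `T⁻¹_o M / 𝒦_o ≅ 𝔤₋₁` and
`T⁻ᵏ_o M / T⁻ᵏ⁺¹_o M ≅ 𝔤₋ₖ` for `k ≥ 2`, and these isomorphisms identify the Lie bracket of the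
symbol, the complex structure, and the image of `ι` with those of `S`. -/
def HasSecondOrderLeviTanaka (C : HomogeneousCR g) {n : Type v} [LieRing n] [LieAlgebra ℝ n]
    (S : SecondOrderLeviTanaka n) : Prop :=
  ∃ π : ℕ → g →ₗ[ℝ] n,
    (∀ k, (C.filt (k + 1)).map (π (k + 1)) = S.part (k + 1)) ∧
    (∀ k, ∀ x ∈ C.filt (k + 1), π (k + 1) x = 0 ↔ x ∈ C.filt k) ∧
    (∀ i j, 1 ≤ i → 1 ≤ j → ∀ x ∈ C.filt i, ∀ y ∈ C.filt j,
      π (i + j) ⁅x, y⁆ = ⁅π i x, π j y⁆) ∧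
    (∀ y ∈ C.D, ∀ v : S.part 1, (v : n) = π 1 y → (S.I v : n) = π 1 (C.J y)) ∧
    (∀ T : Module.End ℝ (S.part 1), T ∈ S.k ↔
      ∃ x ∈ C.leviKernel, ∀ y ∈ C.D, ∀ v : S.part 1, (v : n) = π 1 y →
        (T v : n) = π 1 (C.antilinearBracket x y))

end HomogeneousCR

/-- A Borel subalgebra is a maximal solvable subalgebra. -/
def IsBorelSubalgebra {L : Type*} [LieRing L] [LieAlgebra ℂ L] (b : LieSubalgebra ℂ L) : Prop :=
  Maximal (fun c : LieSubalgebra ℂ L => LieAlgebra.IsSolvable c) b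

/-- A subalgebra of a real Lie algebra is parabolic if its complexification contains a Borel
subalgebra of the complexified Lie algebra. -/
def IsParabolicSubalgebra {g : Type u} [LieRing g] [LieAlgebra ℝ g] (p : LieSubalgebra ℝ g) :
    Prop :=
  ∃ b : LieSubalgebra ℂ (ℂ ⊗[ℝ] g), IsBorelSubalgebra b ∧
    b.toSubmodule ≤ p.toSubmodule.baseChange ℂ

/-- The data making `(L, H)` a (pseudo-)Hermitian symmetric pair: an involutive automorphism `σ` of
`L` with fixed point algebra `H` and, on its `-1`-eigenspace `𝔪`, an `H`-invariant complex
structure `J` and an `H`-invariant nondegenerate symmetric bilinear form `B`, of any signature,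
with `B (J x) (J y) = B x y`. -/
structure PseudoHermitianPair {L : Type u} [LieRing L] [LieAlgebra ℝ L]
    (H : LieSubalgebra ℝ L) where
  σ : L ≃ₗ⁅ℝ⁆ L
  σ_σ : ∀ x, σ (σ x) = x
  σ_fixed : ∀ x, σ x = x ↔ x ∈ H
  J : L →ₗ[ℝ] L
  J_mem : ∀ x, σ x = -x → σ (J x) = -J x
  J_sq : ∀ x, σ x = -x → J (J x) = -x
  J_inv : ∀ x ∈ H, ∀ y, σ y = -y → J ⁅x, y⁆ = ⁅x, J y⁆
  B : LinearMap.BilinForm ℝ L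
  B_symm : ∀ x y, σ x = -x → σ y = -y → B x y = B y x
  B_nondeg : ∀ x, σ x = -x → (∀ y, σ y = -y → B x y = 0) → x = 0
  B_inv : ∀ x ∈ H, ∀ y z, σ y = -y → σ z = -z → B ⁅x, y⁆ z + B y ⁅x, z⁆ = 0
  B_J : ∀ x y, σ x = -x → σ y = -y → B (J x) (J y) = B x y

/-!
# Semisimple 2-nondegenerate homogeneous CR geometries of maximal dimension

The filtration `F^i` of the Lie algebra extends to positive degrees, and the associated graded Lie
algebra carries a CR structure with the same second-order Levi–Tanaka algebra. Extending it by its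
grading derivation, one obtains an algebra of dimension `dim 𝔤 + 1`. It is again the symmetry
algebra of a homogeneous 2-nondegenerate geometry unless the extension fails to be effective, that
is unless the grading derivation is, to leading order, the action of an element of `𝔤`. By
maximality it must be: there is an `E` in `F^0` that acts by `-1` on `F^{-1} / F^0`
(`HomogeneousCR.IsTwoNondegenerate.exists_grading_element`). Such an `E` acts by `i` on
`F^i / F^{i+1}`, so `ad E` is diagonalizable, its eigenspaces form the grading of `𝔤`, they split
the filtration, and they split the isotropy
(`HomogeneousCR.IsGradingElement.fil_eq_iSup_gr`, `HomogeneousCR.IsGradingElement.h_eq`).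

The central point is to realize the complex structure in degree `-1` by an element of the algebra.
In the complexification, the `(0,1)`-part of the CR structure is a subalgebra `q`. It contains `E`
and all positive degrees, and by 2-nondegeneracy its part of degree `0` is the stabilizer of its
part of degree `-1` (`IsHalfStructure`). It follows that `q` and its conjugate `q'` are
self-normalizing and contain their orthogonal complements for the Killing form, so, as for two
parabolic subalgebras, they contain a common Cartan subalgebra
(`exists_isCartanSubalgebra_le_inf`). Every root of degree `-1` then belongs to exactly one of `q`
and `q'`. The function on these roots that is `0` on the roots of `q` and `-1` on those of `q'`
changes by a constant along the strings of each root of degree `0`. Such a function is linear: its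
least squares approximation by linear forms has a residual that is constant along the strings, and
a linear relation among roots whose coefficients agree unless the roots form an obtuse or right
angle, and which has only roots of degree `-1`, is trivial
(`RootPairing.exists_eq_sum_mul_pairingIn`).
So there is an `e` that acts by `0` on the part of `q` of degree `-1`, and by `-1` on that of `q'`
(`IsHalfStructure.exists_lie_eq`), and taking real parts one finds a real `j` of degree `0` that
acts as `J` in degree `-1` (`HomogeneousCR.IsGradingElement.exists_lie_eq_J`).

Everything else is read off from `E` and `j` (`HomogeneousCR.IsBigradingPair`), since elements of
degree `0` are determined by their action in degree `-1`, where `j` is a complex structure. In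
degree `0` the isotropy is the centralizer of `j`, the involution is `1 + (ad j)² / 2`, the complex
structure on its `(-1)`-eigenspace is `ad j / 2`, and it is orthogonal for the Killing form
(`HomogeneousCR.IsBigradingPair.pseudoHermitianPair`). The bigrading is given by the eigenspaces of
`ad E` and of `ad e`, with `e = E / 2 + i j / 2`; in positive degrees `ad e` is diagonalizable by
the duality of opposite degrees (`iSup_eigenspace_eq_top_of_nonpos`). A Borel subalgebra that
contains the positive degrees is orthogonal to them, so it lies in the nonnegative degrees, which
therefore form a parabolic subalgebra (`HomogeneousCR.IsBigradingPair.isParabolicSubalgebra`).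
Finally, `𝔨` consists of the actions of the elements of degree `0` that anticommute with `j`; these
are derivations and are stable under the triple bracket, which is regularity
(`HomogeneousCR.IsBigradingPair.isRegular`).
-/


/-! ### Solvable subalgebras and the Killing form -/

section SolvableTrace

open LieAlgebra LieModule Module

/-- For a solvable Lie algebra acting on `M`, an element `y` that is either a commutator or acts
nilpotently acts by strictly triangular matrices in the flag given by Lie's theorem. -/
theorem isNilpotent_toEnd_mul_of_isSolvable {K b : Type*} [Field K] [IsAlgClosed K] [CharZero K]
    [LieRing b] [LieAlgebra K b] [FiniteDimensional K b] [IsSolvable b] (x y : b) (d : ℕ) :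
    ∀ (M : Type*) [AddCommGroup M] [Module K M] [LieRingModule b M] [LieModule K b M]
      [FiniteDimensional K M], finrank K M = d →
      (IsNilpotent (toEnd K b M y) ∨ ∃ y₁ y₂ : b, y = ⁅y₁, y₂⁆) →
      IsNilpotent (toEnd K b M x * toEnd K b M y) := by
  induction d using Nat.strong_induction_on with
  | _ d ih =>
    intro M _ _ _ _ _ hd hy
    rcases subsingleton_or_nontrivial M with hM | hM
    · exact ⟨1, LinearMap.ext fun m => Subsingleton.elim _ _⟩
    obtain ⟨χ, hχ⟩ := LieModule.exists_nontrivial_weightSpace_of_isSolvable K b M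
    obtain ⟨⟨v, hv⟩, hv0⟩ := exists_ne (0 : weightSpace M χ)
    have hv0 : v ≠ 0 := by simpa using hv0
    rw [mem_weightSpace] at hv
    have hyv : ⁅y, v⁆ = 0 := by
      rcases hy with ⟨k, hk⟩ | ⟨y₁, y₂, rfl⟩
      · have hpow : ∀ k, ((toEnd K b M y) ^ k) v = (χ y) ^ k • v := by
          intro k
          induction k with
          | zero => simp
          | succ k ihk => rw [pow_succ', Module.End.mul_apply, ihk, map_smul, toEnd_apply_apply, hv,
              smul_smul, pow_succ]
        have h0 := hpow k
        rw [hk, LinearMap.zero_apply, eq_comm, smul_eq_zero] at h0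
        rw [hv, eq_zero_of_pow_eq_zero (h0.resolve_right hv0), zero_smul]
      · rw [lie_lie, hv y₂, lie_smul, hv y₁, lie_smul, hv y₂, smul_comm, sub_self]
    let N : LieSubmodule K b M :=
      { K ∙ v with
        lie_mem := by
          intro z m hm
          obtain ⟨c, rfl⟩ := Submodule.mem_span_singleton.1 hm
          exact Submodule.mem_span_singleton.2 ⟨c * χ z, by rw [lie_smul, hv, smul_smul]⟩ }
    have hNmem : ∀ m, m ∈ N ↔ ∃ c : K, c • v = m := fun m => Submodule.mem_span_singleton
    have hlt : finrank K (M ⧸ N) < d := by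
      rw [← hd]
      have h1 : finrank K (M ⧸ N.toSubmodule) + finrank K N.toSubmodule = finrank K M :=
        Submodule.finrank_quotient_add_finrank _
      have h2 : finrank K N.toSubmodule = 1 := finrank_span_singleton hv0
      change finrank K (M ⧸ N.toSubmodule) < _
      omega
    have hq : ∀ (z : b) (m : M), (LieSubmodule.Quotient.mk (N := N) ⁅z, m⁆ : M ⧸ N) =
        ⁅z, (LieSubmodule.Quotient.mk (N := N) m : M ⧸ N)⁆ := fun z m => rfl
    have hpowq : ∀ (f : Module.End K M) (g : Module.End K (M ⧸ N)),
        (∀ m, g (LieSubmodule.Quotient.mk (N := N) m) = LieSubmodule.Quotient.mk (N := N) (f m)) →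
        ∀ k m, (g ^ k) (LieSubmodule.Quotient.mk (N := N) m) =
          LieSubmodule.Quotient.mk (N := N) ((f ^ k) m) := by
      intro f g hfg k
      induction k with
      | zero => intro m; simp
      | succ k ihk => intro m; rw [pow_succ, Module.End.mul_apply, hfg, ihk, pow_succ,
          Module.End.mul_apply]
    have hyq : IsNilpotent (toEnd K b (M ⧸ N) y) ∨ ∃ y₁ y₂ : b, y = ⁅y₁, y₂⁆ := by
      refine hy.imp (fun ⟨k, hk⟩ => ⟨k, ?_⟩) id
      ext m
      obtain ⟨m, rfl⟩ := LieSubmodule.Quotient.surjective_mk' N m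
      rw [LieSubmodule.Quotient.mk'_apply, hpowq (toEnd K b M y) _ (fun m => rfl), hk]
      rfl
    obtain ⟨k, hk⟩ := ih _ hlt (M ⧸ N) rfl hyq
    refine ⟨k + 1, LinearMap.ext fun m => ?_⟩
    have h1 := LinearMap.congr_fun hk (LieSubmodule.Quotient.mk (N := N) m)
    rw [hpowq (toEnd K b M x * toEnd K b M y) _ (fun m => rfl)] at h1
    have h2 : ((toEnd K b M x * toEnd K b M y) ^ k) m ∈ N :=
      (LieSubmodule.Quotient.mk_eq_zero').1 h1
    obtain ⟨c, hc⟩ := (hNmem _).1 h2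
    rw [pow_succ', Module.End.mul_apply, ← hc, map_smul, Module.End.mul_apply, toEnd_apply_apply,
      toEnd_apply_apply, hyv]
    simp

variable {G : Type*} [LieRing G] [LieAlgebra ℂ G] [FiniteDimensional ℂ G]

/-- In the Killing form, a solvable subalgebra is orthogonal to its nilpotent elements and to its
commutators. -/
theorem killingForm_eq_zero_of_isSolvable (b : LieSubalgebra ℂ G) (hb : IsSolvable b)
    {x y : G} (hx : x ∈ b) (hy : y ∈ b)
    (h : IsNilpotent (ad ℂ G y) ∨ ∃ y₁ ∈ b, ∃ y₂ ∈ b, y = ⁅y₁, y₂⁆) :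
    killingForm ℂ G x y = 0 := by
  have h1 := isNilpotent_toEnd_mul_of_isSolvable (K := ℂ) (⟨x, hx⟩ : b) ⟨y, hy⟩ _ G rfl
    (h.imp (fun h => h) fun ⟨y₁, h₁, y₂, h₂, e⟩ => ⟨⟨y₁, h₁⟩, ⟨y₂, h₂⟩, Subtype.ext e⟩)
  exact (LinearMap.isNilpotent_trace_of_isNilpotent h1).eq_zero

/-- A common eigenvector in the quotient of two invariant subspaces. -/
theorem exists_lie_sub_smul_mem_of_isSolvable (b : LieSubalgebra ℂ G) (hb : IsSolvable b)
    (U W : Submodule ℂ G) (hUW : U < W) (hU : ∀ x ∈ b, ∀ u ∈ U, ⁅x, u⁆ ∈ U)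
    (hW : ∀ x ∈ b, ∀ w ∈ W, ⁅x, w⁆ ∈ W) :
    ∃ v ∈ W, v ∉ U ∧ ∃ χ : Module.Dual ℂ b, ∀ x : b, ⁅(x : G), v⁆ - χ x • v ∈ U := by
  let W' : LieSubmodule ℂ b G := { W with lie_mem := fun {x m} hm => hW x x.2 m hm }
  let U' : LieSubmodule ℂ b W' :=
    { U.comap W'.toSubmodule.subtype with lie_mem := fun {x m} hm => hU x x.2 m hm }
  obtain ⟨w, hwW, hwU⟩ := SetLike.exists_of_lt hUW
  have : Nontrivial (W' ⧸ U') := by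
    refine ⟨LieSubmodule.Quotient.mk (⟨w, hwW⟩ : W'), 0, fun h => hwU ?_⟩
    exact (LieSubmodule.Quotient.mk_eq_zero').1 h
  have : FiniteDimensional ℂ (W' ⧸ U') :=
    inferInstanceAs (FiniteDimensional ℂ (W' ⧸ U'.toSubmodule))
  obtain ⟨χ, hχ⟩ := LieModule.exists_nontrivial_weightSpace_of_isSolvable ℂ b (W' ⧸ U')
  obtain ⟨⟨v, hv⟩, hv0⟩ := exists_ne (0 : weightSpace (W' ⧸ U') χ)
  have hv0 : v ≠ 0 := by simpa using hv0
  rw [mem_weightSpace] at hv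
  obtain ⟨v, rfl⟩ := LieSubmodule.Quotient.surjective_mk' U' v
  refine ⟨v, v.2, fun h => hv0 ((LieSubmodule.Quotient.mk_eq_zero').2 h), χ, fun x => ?_⟩
  have h1 := hv x
  rw [← sub_eq_zero] at h1
  exact (LieSubmodule.Quotient.mk_eq_zero' (N := U') (m := ⁅x, v⁆ - χ x • v)).1 h1

/-- A Lie algebra whose first derived ideal is solvable is solvable. -/
theorem isSolvable_of_isSolvable_derivedSeries_one {L : Type*} [LieRing L] [LieAlgebra ℂ L]
    (h : IsSolvable (derivedSeries ℂ L 1)) : IsSolvable L := by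
  obtain ⟨k, hk⟩ := IsSolvable.solvable ℂ (derivedSeries ℂ L 1)
  rw [LieIdeal.derivedSeries_eq_bot_iff, derivedSeries_def, ← derivedSeriesOfIdeal_add,
    ← derivedSeries_def] at hk
  exact IsSolvable.mk hk

omit [FiniteDimensional ℂ G] in
theorem coe_mem_of_mem_derivedSeries_one (s : LieSubalgebra ℂ G) (P : Submodule ℂ G)
    (h : ∀ x ∈ s, ∀ y ∈ s, ⁅x, y⁆ ∈ P) {z : s} (hz : z ∈ derivedSeries ℂ s 1) : (z : G) ∈ P := by
  have h1 : z ∈ (derivedSeries ℂ s 1).toSubmodule := hz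
  rw [derivedSeries_def, derivedSeriesOfIdeal_succ, derivedSeriesOfIdeal_zero,
    LieSubmodule.lieIdeal_oper_eq_linear_span'] at h1
  refine Submodule.span_induction (p := fun (z : s) _ => (z : G) ∈ P) ?_ P.zero_mem
    (fun a b _ _ ha hb => P.add_mem ha hb) (fun c a _ ha => P.smul_mem c ha) h1
  rintro _ ⟨x, -, y, -, rfl⟩
  exact h x x.2 y y.2

omit [FiniteDimensional ℂ G] in
/-- A Lie algebra all whose brackets lie in a solvable subalgebra is solvable. -/
theorem isSolvable_of_lie_mem (s b : LieSubalgebra ℂ G) (hb : IsSolvable b)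
    (h : ∀ x ∈ s, ∀ y ∈ s, ⁅x, y⁆ ∈ b) : IsSolvable s := by
  apply isSolvable_of_isSolvable_derivedSeries_one
  let f : derivedSeries ℂ s 1 →ₗ⁅ℂ⁆ b :=
    { toFun := fun z => ⟨z, coe_mem_of_mem_derivedSeries_one s b.toSubmodule h z.2⟩
      map_add' := fun _ _ => rfl
      map_smul' := fun _ _ => rfl
      map_lie' := rfl }
  refine Function.Injective.lieAlgebra_isSolvable (f := f) fun x y hxy => ?_
  exact Subtype.ext (Subtype.ext (congrArg (fun z : b => (z : G)) hxy))

theorem isSolvable_of_killingForm_eq_zero (s : LieSubalgebra ℂ G)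
    (h : ∀ x ∈ s, ∀ y ∈ s, killingForm ℂ G x y = 0) : IsSolvable s := by
  apply isSolvable_of_isSolvable_derivedSeries_one
  have h0 : LieModule.traceForm ℂ s G = 0 := by
    ext x y
    exact h x x.2 y y.2
  have h1 := LieModule.isNilpotent_derivedSeries_of_traceForm_eq_zero h0
  have h2 : LieRing.IsNilpotent (derivedSeries ℂ s 1) := by
    rw [LieAlgebra.isNilpotent_iff_forall (R := ℂ)]
    intro x
    apply LieSubalgebra.isNilpotent_ad_of_isNilpotent_ad
      (derivedSeries ℂ s 1 : LieSubalgebra ℂ s) (x := x)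
    apply LieSubalgebra.isNilpotent_ad_of_isNilpotent_ad s
    exact (LieModule.isNilpotent_iff_forall' (R := ℂ)).1 h1 x
  infer_instance

/-- Cartan's criterion for a subalgebra, tested with the Killing form of the ambient algebra. -/
theorem isSolvable_of_killingForm_lie_eq_zero (s : LieSubalgebra ℂ G)
    (h : ∀ x ∈ s, ∀ y ∈ s, ∀ z ∈ s, killingForm ℂ G x ⁅y, z⁆ = 0) : IsSolvable s := by
  let P : Submodule ℂ G := Submodule.span ℂ {w | ∃ x ∈ s, ∃ y ∈ s, w = ⁅x, y⁆}
  have hPs : P ≤ s.toSubmodule := Submodule.span_le.2 (by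
    rintro _ ⟨x, hx, y, hy, rfl⟩; exact s.lie_mem hx hy)
  let t : LieSubalgebra ℂ G :=
    { P with lie_mem' := fun hx hy => Submodule.subset_span ⟨_, hPs hx, _, hPs hy, rfl⟩ }
  refine isSolvable_of_lie_mem s t (isSolvable_of_killingForm_eq_zero t fun x hx y hy => ?_)
    fun x hx y hy => Submodule.subset_span ⟨x, hx, y, hy, rfl⟩
  refine Submodule.span_induction (p := fun y _ => killingForm ℂ G x y = 0) ?_ (map_zero _)
    (fun a b _ _ ha hb => by rw [map_add, ha, hb, add_zero])
    (fun c a _ ha => by rw [map_smul, ha, smul_zero]) hy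
  rintro _ ⟨y, hy, z, hz, rfl⟩
  exact h x (hPs hx) y hy z hz

end SolvableTrace


/-! ### Replicas and the Jordan decomposition -/

section Replica

open LieAlgebra LieModule Module

variable {G : Type*} [LieRing G] [LieAlgebra ℂ G] [FiniteDimensional ℂ G]

omit [FiniteDimensional ℂ G] in
theorem lie_mem_maxGenEigenspace_ad (x : G) {a b : ℂ} {y z : G}
    (hy : y ∈ (ad ℂ G x).maxGenEigenspace a) (hz : z ∈ (ad ℂ G x).maxGenEigenspace b) :
    ⁅y, z⁆ ∈ (ad ℂ G x).maxGenEigenspace (a + b) :=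
  lie_mem_maxGenEigenspace_toEnd hy hz

theorem isInternal_maxGenEigenspace_ad (x : G) :
    DirectSum.IsInternal fun a : ℂ => (ad ℂ G x).maxGenEigenspace a :=
  DirectSum.isInternal_submodule_of_iSupIndep_of_iSup_eq_top
    (End.independent_maxGenEigenspace _) (End.iSup_maxGenEigenspace_eq_top _)

/-- The replicas of an element `x` of a semisimple Lie algebra: for every additive map `φ` of the
coefficients there is an element acting on each generalized eigenspace of `ad x` as the scalar that
`φ` assigns to the eigenvalue. For `φ = id` this is the semisimple part of `x`. -/
theorem exists_replica [IsKilling ℂ G] (x : G) (φ : ℂ →+ ℂ) :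
    ∃ x' : G, ∀ a, ∀ y ∈ (ad ℂ G x).maxGenEigenspace a, ⁅x', y⁆ = φ a • y := by
  let dec := (isInternal_maxGenEigenspace_ad x).chooseDecomposition
  let gr : GradedLieAlgebra fun a : ℂ => (ad ℂ G x).maxGenEigenspace a :=
    { dec with bracket_mem := fun _ _ _ _ hy hz => lie_mem_maxGenEigenspace_ad x hy hz }
  obtain ⟨x', hx'⟩ := LieDerivation.IsKilling.exists_eq_ad
    (LieDerivation.ofGrading (fun a : ℂ => (ad ℂ G x).maxGenEigenspace a) φ)
  refine ⟨x', fun a y hy => ?_⟩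
  rw [← LieDerivation.ofGrading_apply_apply _ φ hy, ← hx']
  simp

/-- Replicas preserve every invariant subspace. -/
theorem replica_lie_mem {x x' : G} {φ : ℂ →+ ℂ}
    (h : ∀ a, ∀ y ∈ (ad ℂ G x).maxGenEigenspace a, ⁅x', y⁆ = φ a • y) (W : Submodule ℂ G)
    (hW : ∀ w ∈ W, ⁅x, w⁆ ∈ W) : ∀ w ∈ W, ⁅x', w⁆ ∈ W := by
  intro w hw
  rw [Submodule.eq_iSup_inf_genEigenspace (f := ad ℂ G x) (p := W) ⊤ hW
    (End.iSup_maxGenEigenspace_eq_top _)] at hw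
  refine Submodule.iSup_induction _ (motive := fun w => ⁅x', w⁆ ∈ W) hw ?_ (by simp) ?_
  · intro a y hy
    rw [h a y hy.2]
    exact W.smul_mem _ hy.1
  · intro a b ha hb
    rw [lie_add]
    exact W.add_mem ha hb

/-- If `x` is orthogonal to the replica given by complex conjugation, then `x` is nilpotent, as
`killingForm x x'` is the sum of the squares of the absolute values of the eigenvalues. -/
theorem isNilpotent_ad_of_killingForm_replica {x x' : G}
    (h : ∀ a, ∀ y ∈ (ad ℂ G x).maxGenEigenspace a, ⁅x', y⁆ = (starRingEnd ℂ) a • y)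
    (h0 : killingForm ℂ G x x' = 0) : IsNilpotent (ad ℂ G x) := by
  classical
  set f := ad ℂ G x with hf
  have hfin : {a | f.maxGenEigenspace a ≠ ⊥}.Finite :=
    WellFoundedGT.finite_ne_bot_of_iSupIndep (End.independent_maxGenEigenspace f)
  have hmaps : ∀ a, Set.MapsTo f (f.maxGenEigenspace a) (f.maxGenEigenspace a) := fun a =>
    End.mapsTo_maxGenEigenspace_of_comm (Commute.refl f) a
  have hx' : ∀ a, Set.MapsTo (ad ℂ G x') (f.maxGenEigenspace a) (f.maxGenEigenspace a) := by
    intro a y hy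
    rw [ad_apply, h a y hy]
    exact Submodule.smul_mem _ _ hy
  have hcomp : ∀ a, Set.MapsTo (f ∘ₗ ad ℂ G x') (f.maxGenEigenspace a) (f.maxGenEigenspace a) :=
    fun a => (hmaps a).comp (hx' a)
  have htr : killingForm ℂ G x x' = ∑ a ∈ hfin.toFinset,
      (finrank ℂ (f.maxGenEigenspace a) : ℂ) * ((starRingEnd ℂ) a * a) := by
    rw [killingForm_apply_apply, LinearMap.trace_eq_sum_trace_restrict'
      (isInternal_maxGenEigenspace_ad x) hfin hcomp]
    refine Finset.sum_congr rfl fun a _ => ?_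
    have h1 : (f ∘ₗ ad ℂ G x').restrict (hcomp a) =
        (starRingEnd ℂ) a • f.restrict (hmaps a) := by
      refine LinearMap.ext fun y => Subtype.ext ?_
      change f ⁅x', (y : G)⁆ = (starRingEnd ℂ) a • f y
      rw [h a y y.2, map_smul]
    have h2 := End.isNilpotent_restrict_maxGenEigenspace_sub_algebraMap f a
    have h3 := (LinearMap.isNilpotent_trace_of_isNilpotent h2).eq_zero
    have h4 : f.restrict (hmaps a) = (f - algebraMap ℂ (End ℂ G) a).restrict
        (End.mapsTo_maxGenEigenspace_of_comm (Algebra.mul_sub_algebraMap_commutes f a) a) +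
          a • LinearMap.id := by
      refine LinearMap.ext fun y => Subtype.ext ?_
      change f (y : G) = (f - algebraMap ℂ (End ℂ G) a) y + a • (y : G)
      simp
    rw [h1, map_smul, h4, map_add, h3, map_smul, LinearMap.trace_id, zero_add, smul_eq_mul,
      smul_eq_mul]
    ring
  have hzero : ∀ a, a ≠ 0 → f.maxGenEigenspace a = ⊥ := by
    intro a ha
    by_contra hne
    rw [h0] at htr
    have h1 : (0 : ℝ) = ∑ a ∈ hfin.toFinset,
        (finrank ℂ (f.maxGenEigenspace a) : ℝ) * Complex.normSq a := by
      have := congrArg Complex.re htr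
      simp only [Complex.zero_re, Complex.re_sum] at this
      rw [this]
      refine Finset.sum_congr rfl fun a _ => ?_
      rw [mul_comm ((starRingEnd ℂ) a), Complex.mul_conj]
      norm_cast
    rw [eq_comm, Finset.sum_eq_zero_iff_of_nonneg
      (fun a _ => mul_nonneg (Nat.cast_nonneg _) (Complex.normSq_nonneg a))] at h1
    rcases mul_eq_zero.1 (h1 a (hfin.mem_toFinset.2 hne)) with h2 | h2
    · rw [Nat.cast_eq_zero, Submodule.finrank_eq_zero] at h2
      exact hne h2
    · exact ha (Complex.normSq_eq_zero.1 h2)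
  have htop : f.maxGenEigenspace 0 = ⊤ := by
    rw [eq_top_iff, ← End.iSup_maxGenEigenspace_eq_top f]
    refine iSup_le fun a => ?_
    by_cases ha : a = 0
    · rw [ha]
    · rw [hzero a ha]; exact bot_le
  refine ⟨finrank ℂ G, LinearMap.ext fun y => ?_⟩
  have hy : y ∈ f.maxGenEigenspace 0 := htop ▸ Submodule.mem_top
  rw [End.maxGenEigenspace_eq_genEigenspace_finrank, End.mem_genEigenspace_nat] at hy
  simpa using hy

/-- A self-normalizing subalgebra contains the replicas of its elements. -/
theorem replica_mem {x x' : G} {φ : ℂ →+ ℂ}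
    (h : ∀ a, ∀ y ∈ (ad ℂ G x).maxGenEigenspace a, ⁅x', y⁆ = φ a • y) (p : LieSubalgebra ℂ G)
    (hp : ∀ y, (∀ z ∈ p, ⁅y, z⁆ ∈ p) → y ∈ p) (hx : x ∈ p) : x' ∈ p :=
  hp x' (replica_lie_mem h p.toSubmodule fun _ hw => p.lie_mem hx hw)

/-- The radical of the Killing form on a self-normalizing subalgebra consists of nilpotent
elements. -/
theorem isNilpotent_ad_of_forall_killingForm_eq_zero [IsKilling ℂ G] (p : LieSubalgebra ℂ G)
    (hp : ∀ y, (∀ z ∈ p, ⁅y, z⁆ ∈ p) → y ∈ p) {x : G} (hx : x ∈ p)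
    (h : ∀ y ∈ p, killingForm ℂ G x y = 0) : IsNilpotent (ad ℂ G x) := by
  obtain ⟨x', hx'⟩ := exists_replica x (starRingEnd ℂ : ℂ →+ ℂ)
  exact isNilpotent_ad_of_killingForm_replica hx' (h x' (replica_mem hx' p hp hx))

theorem isSemisimple_of_iSup_eigenspace_eq_top (f : End ℂ G) (h : ⨆ a, f.eigenspace a = ⊤) :
    f.IsSemisimple := by
  classical
  have hfin : {a | f.eigenspace a ≠ ⊥}.Finite :=
    WellFoundedGT.finite_ne_bot_of_iSupIndep (End.eigenspaces_iSupIndep f)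
  let P : Polynomial ℂ := ∏ a ∈ hfin.toFinset, (Polynomial.X - Polynomial.C a)
  refine End.isSemisimple_of_squarefree_aeval_eq_zero (p := P) ?_ ?_
  · exact (Polynomial.separable_prod_X_sub_C_iff'.2 fun _ _ _ _ h => h).squarefree
  · ext y
    have hy : y ∈ ⨆ a, f.eigenspace a := h ▸ Submodule.mem_top
    refine Submodule.iSup_induction _ (motive := fun y => (Polynomial.aeval f P) y =
      (0 : End ℂ G) y) hy ?_ (by simp) (fun a b ha hb => by rw [map_add, ha, hb]; simp)
    intro a y hy
    by_cases ha : f.eigenspace a = ⊥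
    · rw [ha, Submodule.mem_bot] at hy
      simp [hy]
    · have h0 : P.eval a = 0 := by
        rw [Polynomial.eval_prod]
        exact Finset.prod_eq_zero (hfin.mem_toFinset.2 ha) (by simp)
      rw [End.aeval_apply_of_mem_apply_eq_smul (End.mem_eigenspace_iff.1 hy), h0]
      simp

/-- The semisimple part of an element, together with the properties needed below. -/
theorem exists_isSemisimple_replica [IsKilling ℂ G] (x : G) :
    ∃ s : G, (ad ℂ G s).IsSemisimple ∧ IsNilpotent (ad ℂ G (x - s)) ∧
      (∀ W : Submodule ℂ G, (∀ w ∈ W, ⁅x, w⁆ ∈ W) → ∀ w ∈ W, ⁅s, w⁆ ∈ W) ∧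
      ∀ t : G, ⁅x, t⁆ = 0 → ⁅s, t⁆ = 0 := by
  obtain ⟨s, hs⟩ := exists_replica x (AddMonoidHom.id ℂ)
  refine ⟨s, ?_, ?_, replica_lie_mem hs, fun t ht => ?_⟩
  · refine isSemisimple_of_iSup_eigenspace_eq_top _ (eq_top_iff.2 ?_)
    rw [← End.iSup_maxGenEigenspace_eq_top (ad ℂ G x)]
    exact iSup_mono fun a y hy => End.mem_eigenspace_iff.2 (hs a y hy)
  · refine ⟨finrank ℂ G, LinearMap.ext fun y => ?_⟩
    have hy : y ∈ ⨆ a, (ad ℂ G x).maxGenEigenspace a := by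
      rw [End.iSup_maxGenEigenspace_eq_top]; trivial
    refine Submodule.iSup_induction _ (motive := fun y => ((ad ℂ G (x - s)) ^ finrank ℂ G) y =
      (0 : End ℂ G) y) hy ?_ (by simp) (fun a b ha hb => by rw [map_add, ha, hb]; simp)
    intro a y hy
    have h1 : ∀ k, ((ad ℂ G (x - s)) ^ k) y = ((ad ℂ G x - a • 1) ^ k) y ∧
        ((ad ℂ G x - a • 1) ^ k) y ∈ (ad ℂ G x).maxGenEigenspace a := by
      intro k
      induction k with
      | zero => exact ⟨rfl, hy⟩
      | succ k ih =>
        rw [pow_succ', pow_succ', Module.End.mul_apply, Module.End.mul_apply, ih.1]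
        refine ⟨?_, ?_⟩
        · rw [ad_apply, sub_lie, hs a _ ih.2]
          simp
        · exact Submodule.sub_mem _ (End.mapsTo_maxGenEigenspace_of_comm (Commute.refl _) a ih.2)
            (Submodule.smul_mem _ _ ih.2)
    rw [(h1 _).1]
    rw [End.maxGenEigenspace_eq_genEigenspace_finrank, End.mem_genEigenspace_nat] at hy
    simpa using hy
  · have h1 : t ∈ (ad ℂ G x).maxGenEigenspace 0 :=
      (End.mem_maxGenEigenspace _ _ _).2 ⟨1, by simpa using ht⟩
    rw [hs 0 t h1]
    simp

end Replica


/-! ### Borel subalgebras -/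

section Cartan

open LieAlgebra LieModule Module

variable {G : Type*} [LieRing G] [LieAlgebra ℂ G]

theorem killingForm_comm (x y : G) : killingForm ℂ G x y = killingForm ℂ G y x :=
  LieModule.traceForm_comm ℂ G G x y

theorem killingForm_lie_left (x y z : G) : killingForm ℂ G ⁅x, y⁆ z = killingForm ℂ G x ⁅y, z⁆ :=
  LieModule.traceForm_apply_lie_apply ℂ G G x y z

theorem add_smul_lie_add_smul (x y v : G) (c d : ℂ) :
    ⁅x + c • v, y + d • v⁆ = ⁅x, y⁆ + d • ⁅x, v⁆ - c • ⁅y, v⁆ := by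
  rw [add_lie, lie_add, lie_add, smul_lie, lie_smul, smul_lie, lie_smul, lie_self, ← lie_skew v y]
  simp only [smul_zero, add_zero, smul_neg]
  abel

/-- The subalgebra spanned by a subalgebra and one further element. -/
def LieSubalgebra.adjoinElement (b : LieSubalgebra ℂ G) (v : G)
    (h : ∀ x ∈ b, ⁅x, v⁆ ∈ b.toSubmodule ⊔ ℂ ∙ v) : LieSubalgebra ℂ G where
  __ := b.toSubmodule ⊔ ℂ ∙ v
  lie_mem' := by
    intro x y hx hy
    obtain ⟨x₀, hx₀, _, hx₁, rfl⟩ := Submodule.mem_sup.1 hx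
    obtain ⟨y₀, hy₀, _, hy₁, rfl⟩ := Submodule.mem_sup.1 hy
    obtain ⟨c, rfl⟩ := Submodule.mem_span_singleton.1 hx₁
    obtain ⟨d, rfl⟩ := Submodule.mem_span_singleton.1 hy₁
    change _ ∈ b.toSubmodule ⊔ ℂ ∙ v
    rw [add_smul_lie_add_smul]
    exact Submodule.sub_mem _ (Submodule.add_mem _ (Submodule.mem_sup_left (b.lie_mem hx₀ hy₀))
      (Submodule.smul_mem _ _ (h _ hx₀))) (Submodule.smul_mem _ _ (h _ hy₀))

theorem LieSubalgebra.mem_adjoinElement {b : LieSubalgebra ℂ G} {v : G}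
    {h : ∀ x ∈ b, ⁅x, v⁆ ∈ b.toSubmodule ⊔ ℂ ∙ v} {x : G} :
    x ∈ b.adjoinElement v h ↔ ∃ x₀ ∈ b, ∃ c : ℂ, x = x₀ + c • v := by
  constructor
  · intro hx
    obtain ⟨x₀, hx₀, _, hx₁, rfl⟩ := Submodule.mem_sup.1 hx
    obtain ⟨c, rfl⟩ := Submodule.mem_span_singleton.1 hx₁
    exact ⟨x₀, hx₀, c, rfl⟩
  · rintro ⟨x₀, hx₀, c, rfl⟩
    exact Submodule.add_mem_sup hx₀ (Submodule.smul_mem _ _ (Submodule.mem_span_singleton_self v))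

variable [FiniteDimensional ℂ G]

theorem exists_isBorelSubalgebra_ge (s : LieSubalgebra ℂ G) (hs : IsSolvable s) :
    ∃ b : LieSubalgebra ℂ G, IsBorelSubalgebra b ∧ s ≤ b := by
  obtain ⟨b, ⟨hb, hsb⟩, hmax⟩ := (wellFounded_gt (α := LieSubalgebra ℂ G)).has_min
    {b | IsSolvable b ∧ s ≤ b} ⟨s, hs, le_rfl⟩
  refine ⟨b, ⟨hb, fun c hc hbc => ?_⟩, hsb⟩
  by_contra hcb
  exact hmax c ⟨hc, hsb.trans hbc⟩ (lt_of_le_not_ge hbc hcb)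

namespace IsBorelSubalgebra

variable {b : LieSubalgebra ℂ G} (hb : IsBorelSubalgebra b)
include hb

omit [FiniteDimensional ℂ G] in
/-- A Borel subalgebra is self-normalizing, as a normalizing element would extend it to a larger
solvable algebra. -/
theorem mem_of_normalizes {v : G} (h : ∀ x ∈ b, ⁅v, x⁆ ∈ b) : v ∈ b := by
  have h' : ∀ x ∈ b, ⁅x, v⁆ ∈ b := fun x hx => by
    rw [← lie_skew]; exact b.neg_mem_iff.2 (h x hx)
  let s := b.adjoinElement v fun x hx => Submodule.mem_sup_left (h' x hx)
  have hs : IsSolvable s := by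
    refine isSolvable_of_lie_mem s b hb.1 fun x hx y hy => ?_
    obtain ⟨x, hxb, c, rfl⟩ := LieSubalgebra.mem_adjoinElement.1 hx
    obtain ⟨y, hyb, d, rfl⟩ := LieSubalgebra.mem_adjoinElement.1 hy
    rw [add_smul_lie_add_smul]
    exact sub_mem (add_mem (b.lie_mem hxb hyb) (b.smul_mem _ (h' x hxb)))
      (b.smul_mem _ (h' y hyb))
  refine hb.2 hs (fun x hx => ?_) ?_
  · exact LieSubalgebra.mem_adjoinElement.2 ⟨x, hx, 0, by simp⟩
  · exact LieSubalgebra.mem_adjoinElement.2 ⟨0, b.zero_mem, 1, by simp⟩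

/-- A Borel subalgebra contains its orthogonal complement for the Killing form: otherwise, adding
to it an eigenvector in the quotient gives a larger algebra satisfying Cartan's criterion. -/
theorem mem_of_forall_killingForm_eq_zero {v : G} (hv : ∀ x ∈ b, killingForm ℂ G x v = 0) :
    v ∈ b := by
  by_contra hvb
  let W := (killingForm ℂ G).orthogonal b.toSubmodule
  have hWmem : ∀ w, w ∈ W ↔ ∀ x ∈ b, killingForm ℂ G x w = 0 := fun w => Iff.rfl
  have hW : ∀ x ∈ b, ∀ w ∈ W, ⁅x, w⁆ ∈ W := by
    intro x hx w hw y hy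
    change killingForm ℂ G y ⁅x, w⁆ = 0
    rw [← killingForm_lie_left]
    exact hw _ (b.lie_mem hy hx)
  have hlt : b.toSubmodule ⊓ W < W := lt_of_le_not_ge inf_le_right fun h => hvb (h hv).1
  obtain ⟨v, hvW, hvU, χ, hχ⟩ := exists_lie_sub_smul_mem_of_isSolvable b hb.1 _ W hlt
    (fun x hx u hu => ⟨b.lie_mem hx hu.1, hW x hx u hu.2⟩) hW
  have hvb : v ∉ b := fun h => hvU ⟨h, hvW⟩
  have hform : ∀ x ∈ b, ∃ c : ℂ, ∃ u ∈ b, u ∈ W ∧ ⁅x, v⁆ = c • v + u ∧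
      c * killingForm ℂ G v v = 0 := by
    intro x hx
    obtain ⟨h1, h2⟩ := hχ ⟨x, hx⟩
    refine ⟨χ ⟨x, hx⟩, _, h1, h2, by abel, ?_⟩
    have h3 : killingForm ℂ G ⁅x, v⁆ v = 0 := by
      rw [killingForm_lie_left, lie_self, map_zero]
    have h4 := hvW _ h1
    change killingForm ℂ G (⁅x, v⁆ - χ ⟨x, hx⟩ • v) v = 0 at h4
    rw [map_sub, LinearMap.sub_apply, h3, map_smul, LinearMap.smul_apply, smul_eq_mul, zero_sub,
      neg_eq_zero] at h4
    exact h4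
  let s := b.adjoinElement v fun x hx => by
    obtain ⟨c, u, hu, -, h, -⟩ := hform x hx
    rw [h, add_comm]
    exact Submodule.add_mem_sup hu (Submodule.smul_mem _ _ (Submodule.mem_span_singleton_self v))
  have hs : IsSolvable s := by
    refine isSolvable_of_killingForm_lie_eq_zero s fun x hx' y hy' z hz' => ?_
    obtain ⟨x, hx, e, rfl⟩ := LieSubalgebra.mem_adjoinElement.1 hx'
    obtain ⟨y, hy, c, rfl⟩ := LieSubalgebra.mem_adjoinElement.1 hy'
    obtain ⟨z, hz, d, rfl⟩ := LieSubalgebra.mem_adjoinElement.1 hz'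
    obtain ⟨c₁, u₁, hu₁, hu₁W, h₁, k₁⟩ := hform y hy
    obtain ⟨c₂, u₂, hu₂, hu₂W, h₂, k₂⟩ := hform z hz
    have a1 : killingForm ℂ G x ⁅y, z⁆ = 0 :=
      killingForm_eq_zero_of_isSolvable b hb.1 hx (b.lie_mem hy hz) (.inr ⟨y, hy, z, hz, rfl⟩)
    have a2 : killingForm ℂ G v ⁅y, z⁆ = 0 := by
      rw [killingForm_comm]; exact hvW _ (b.lie_mem hy hz)
    have a3 : killingForm ℂ G x v = 0 := hvW _ hx
    have a4 : killingForm ℂ G x u₁ = 0 := hu₁W _ hx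
    have a5 : killingForm ℂ G x u₂ = 0 := hu₂W _ hx
    have a6 : killingForm ℂ G v u₁ = 0 := by rw [killingForm_comm]; exact hvW _ hu₁
    have a7 : killingForm ℂ G v u₂ = 0 := by rw [killingForm_comm]; exact hvW _ hu₂
    rw [add_smul_lie_add_smul, h₁, h₂]
    simp only [map_add, map_sub, map_smul, LinearMap.add_apply, LinearMap.smul_apply, a1, a2, a3,
      a4, a5, a6, a7, smul_eq_mul]
    linear_combination e * d * k₁ - e * c * k₂
  exact hvb (hb.2 hs (fun x hx => LieSubalgebra.mem_adjoinElement.2 ⟨x, hx, 0, by simp⟩)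
    (LieSubalgebra.mem_adjoinElement.2 ⟨0, b.zero_mem, 1, by simp⟩))

end IsBorelSubalgebra

/-- Decomposition of a subspace under commuting semisimple operators into invariants and
coinvariants. -/
theorem le_centralizer_sup_span_lie (T W : Submodule ℂ G)
    (hss : ∀ t ∈ T, (ad ℂ G t).IsSemisimple) (hcomm : ∀ t ∈ T, ∀ s ∈ T, ⁅t, s⁆ = 0)
    (hW : ∀ t ∈ T, ∀ w ∈ W, ⁅t, w⁆ ∈ W) {w : G} (hw : w ∈ W) :
    ∃ w₀ ∈ W, (∀ t ∈ T, ⁅t, w₀⁆ = 0) ∧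
      w - w₀ ∈ Submodule.span ℂ {z | ∃ t ∈ T, ∃ y ∈ W, z = ⁅t, y⁆} := by
  set R := Submodule.span ℂ {z | ∃ t ∈ T, ∃ y ∈ W, z = ⁅t, y⁆}
  have key : ∀ S : Finset G, (∀ t ∈ S, t ∈ T) → ∀ w ∈ W,
      ∃ w₀ ∈ W, (∀ t ∈ S, ⁅t, w₀⁆ = 0) ∧ w - w₀ ∈ R := by
    classical
    intro S
    induction S using Finset.induction_on with
    | empty => exact fun _ w hw => ⟨w, hw, by simp, by simp⟩
    | insert t S _ ih =>
      intro hS w hw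
      have htT := hS t (Finset.mem_insert_self t S)
      obtain ⟨w₁, hw₁, h₁, hR₁⟩ := ih (fun s hs => hS s (Finset.mem_insert_of_mem hs)) w hw
      -- the operator `ad t` is semisimple on the common kernel of the previous operators
      let W₁ : Submodule ℂ G := W ⊓ ⨅ s ∈ S, LinearMap.ker (ad ℂ G s)
      have hW₁mem : ∀ y, y ∈ W₁ ↔ y ∈ W ∧ ∀ s ∈ S, ⁅s, y⁆ = 0 := by
        intro y; simp [W₁, Submodule.mem_iInf]
      have hinv : ∀ y ∈ W₁, ad ℂ G t y ∈ W₁ := by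
        intro y hy
        rw [hW₁mem] at hy ⊢
        refine ⟨hW t htT y hy.1, fun s hs => ?_⟩
        rw [ad_apply, leibniz_lie, hcomm s (hS s (Finset.mem_insert_of_mem hs)) t htT, hy.2 s hs]
        simp
      have h2 : w₁ ∈ W₁ := (hW₁mem _).2 ⟨hw₁, h₁⟩
      rw [Submodule.eq_iSup_inf_genEigenspace (f := ad ℂ G t) (p := W₁) 1 hinv
        (hss t htT).iSup_eigenspace_eq_top] at h2
      have h3 : ∃ w₀ ∈ W₁, ⁅t, w₀⁆ = 0 ∧ w₁ - w₀ ∈ R := by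
        refine Submodule.iSup_induction _
          (motive := fun w₁ => ∃ w₀ ∈ W₁, ⁅t, w₀⁆ = 0 ∧ w₁ - w₀ ∈ R) h2 ?_
          ⟨0, W₁.zero_mem, by simp, by simp⟩ ?_
        · intro a y hy
          have hy2 : ⁅t, y⁆ = a • y := End.mem_eigenspace_iff.1 hy.2
          by_cases ha : a = 0
          · exact ⟨y, hy.1, by rw [hy2, ha, zero_smul], by simp⟩
          · refine ⟨0, W₁.zero_mem, by simp, ?_⟩
            rw [sub_zero]
            refine Submodule.subset_span ⟨t, htT, a⁻¹ • y, W.smul_mem _ ((hW₁mem y).1 hy.1).1, ?_⟩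
            rw [lie_smul, hy2, smul_smul, inv_mul_cancel₀ ha, one_smul]
        · rintro a b ⟨a₀, ha, ha', ha''⟩ ⟨b₀, hb, hb', hb''⟩
          refine ⟨a₀ + b₀, W₁.add_mem ha hb, by rw [lie_add, ha', hb', add_zero], ?_⟩
          rw [add_sub_add_comm]
          exact R.add_mem ha'' hb''
      obtain ⟨w₀, hw₀, h₀, hR₀⟩ := h3
      refine ⟨w₀, ((hW₁mem _).1 hw₀).1, fun s hs => ?_, ?_⟩
      · rcases Finset.mem_insert.1 hs with rfl | hs
        · exact h₀
        · exact ((hW₁mem _).1 hw₀).2 s hs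
      · rw [← sub_add_sub_cancel w w₁ w₀]
        exact R.add_mem hR₁ hR₀
  obtain ⟨S, hS⟩ := IsNoetherian.noetherian T
  obtain ⟨w₀, hw₀, h₀, hR⟩ := key S (fun t ht => hS ▸ Submodule.subset_span ht) w hw
  refine ⟨w₀, hw₀, fun t ht => ?_, hR⟩
  rw [← hS] at ht
  refine Submodule.span_induction (p := fun t _ => ⁅t, w₀⁆ = 0) (fun t ht => h₀ t ht) (by simp)
    (fun a b _ _ ha hb => by rw [add_lie, ha, hb, add_zero])
    (fun c a _ ha => by rw [smul_lie, ha, smul_zero]) ht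

/-- An element centralizing `T` is orthogonal to a `T`-invariant subspace as soon as it is
orthogonal to the invariants in it. -/
theorem killingForm_eq_zero_of_centralizes (T W : Submodule ℂ G)
    (hss : ∀ t ∈ T, (ad ℂ G t).IsSemisimple) (hcomm : ∀ t ∈ T, ∀ s ∈ T, ⁅t, s⁆ = 0)
    (hW : ∀ t ∈ T, ∀ w ∈ W, ⁅t, w⁆ ∈ W) {v : G} (hv : ∀ t ∈ T, ⁅t, v⁆ = 0)
    (h : ∀ w ∈ W, (∀ t ∈ T, ⁅t, w⁆ = 0) → killingForm ℂ G v w = 0) {w : G} (hw : w ∈ W) :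
    killingForm ℂ G v w = 0 := by
  obtain ⟨w₀, hw₀, h₀, hR⟩ := le_centralizer_sup_span_lie T W hss hcomm hW hw
  have h1 : killingForm ℂ G v (w - w₀) = 0 := by
    refine Submodule.span_induction (p := fun z _ => killingForm ℂ G v z = 0) ?_ (map_zero _)
      (fun a b _ _ ha hb => by rw [map_add, ha, hb, add_zero])
      (fun c a _ ha => by rw [map_smul, ha, smul_zero]) hR
    rintro _ ⟨t, ht, y, -, rfl⟩
    rw [← killingForm_lie_left, ← lie_skew, hv t ht]
    simp
  rw [map_sub, h w₀ hw₀ h₀, sub_zero] at h1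
  exact h1

theorem mem_of_orthogonal_orthogonal [IsKilling ℂ G] (W : Submodule ℂ G) {x : G}
    (h : ∀ y, (∀ w ∈ W, killingForm ℂ G w y = 0) → killingForm ℂ G y x = 0) : x ∈ W := by
  rw [← LinearMap.BilinForm.orthogonal_orthogonal (IsKilling.killingForm_nondegenerate ℂ G)
    (LieModule.traceForm_isSymm ℂ G G).isRefl W]
  exact fun y hy => h y hy

omit [FiniteDimensional ℂ G] in
theorem commute_ad_of_lie_eq_zero {x y : G} (h : ⁅x, y⁆ = 0) :
    Commute (ad ℂ G x) (ad ℂ G y) := by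
  refine LinearMap.ext fun z => ?_
  change ⁅x, ⁅y, z⁆⁆ = ⁅y, ⁅x, z⁆⁆
  rw [leibniz_lie, h, zero_lie, zero_add]

/-- A toral subspace of a self-normalizing subalgebra `p` that contains its orthogonal complement
lies in a Borel subalgebra contained in `p`. -/
theorem exists_isBorelSubalgebra_le [IsKilling ℂ G] (p : LieSubalgebra ℂ G)
    (hp : ∀ y, (∀ z ∈ p, ⁅y, z⁆ ∈ p) → y ∈ p)
    (hN : ∀ x, (∀ y ∈ p, killingForm ℂ G y x = 0) → x ∈ p)
    (T : Submodule ℂ G) (hcomm : ∀ t ∈ T, ∀ s ∈ T, ⁅t, s⁆ = 0) (hTp : T ≤ p.toSubmodule) :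
    ∃ b : LieSubalgebra ℂ G, IsBorelSubalgebra b ∧ T ≤ b.toSubmodule ∧ b ≤ p := by
  let N := (killingForm ℂ G).orthogonal p.toSubmodule
  have hNp : N ≤ p.toSubmodule := fun x hx => hN x hx
  have hNlie : ∀ x ∈ p, ∀ y ∈ N, ⁅x, y⁆ ∈ N := by
    intro x hx y hy z hz
    change killingForm ℂ G z ⁅x, y⁆ = 0
    rw [← killingForm_lie_left]
    exact hy _ (p.lie_mem hz hx)
  have hlie : ∀ x ∈ T ⊔ N, ∀ y ∈ T ⊔ N, ⁅x, y⁆ ∈ N := by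
    intro x hx y hy
    obtain ⟨t, ht, n, hn, rfl⟩ := Submodule.mem_sup.1 hx
    obtain ⟨t', ht', n', hn', rfl⟩ := Submodule.mem_sup.1 hy
    rw [add_lie, lie_add, hcomm t ht t' ht', zero_add, lie_add]
    refine N.add_mem (hNlie t (hTp ht) n' hn') (N.add_mem ?_ (hNlie n (hNp hn) n' hn'))
    rw [← lie_skew]
    exact N.neg_mem (hNlie t' (hTp ht') n hn)
  let s : LieSubalgebra ℂ G :=
    { T ⊔ N with lie_mem' := fun hx hy => Submodule.mem_sup_right (hlie _ hx _ hy) }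
  have hsp : ∀ x ∈ s, x ∈ p := fun x hx => (sup_le hTp hNp : T ⊔ N ≤ p.toSubmodule) hx
  obtain ⟨b, hb, hsb⟩ := exists_isBorelSubalgebra_ge s
    (isSolvable_of_killingForm_lie_eq_zero s fun x hx y hy z hz => hlie y hy z hz x (hsp x hx))
  refine ⟨b, hb, fun t ht => hsb (Submodule.mem_sup_left ht : t ∈ T ⊔ N), fun x hx => ?_⟩
  refine mem_of_orthogonal_orthogonal p.toSubmodule fun y hy => ?_
  rw [killingForm_comm]
  refine killingForm_eq_zero_of_isSolvable b hb.1 hx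
    (hsb (Submodule.mem_sup_right (show y ∈ N from hy) : y ∈ T ⊔ N)) (.inl ?_)
  exact isNilpotent_ad_of_forall_killingForm_eq_zero p hp (hN y hy) fun z hz => by
    rw [killingForm_comm]; exact hy z hz

namespace IsBorelSubalgebra

variable {b : LieSubalgebra ℂ G} (hb : IsBorelSubalgebra b)
include hb

/-- The orthogonal complement of a Borel subalgebra consists of nilpotent elements: it plays the
role of the nilradical. -/
theorem isNilpotent_ad_of_mem_orthogonal [IsKilling ℂ G] {x : G}
    (hx : ∀ y ∈ b, killingForm ℂ G y x = 0) : IsNilpotent (ad ℂ G x) :=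
  isNilpotent_ad_of_forall_killingForm_eq_zero b (fun _ h => hb.mem_of_normalizes h)
    (hb.mem_of_forall_killingForm_eq_zero hx) fun y hy => by
      rw [killingForm_comm]; exact hx y hy

theorem disjoint_orthogonal [IsKilling ℂ G] (T : Submodule ℂ G)
    (hss : ∀ t ∈ T, (ad ℂ G t).IsSemisimple) :
    T ⊓ (killingForm ℂ G).orthogonal b.toSubmodule = ⊥ := by
  rw [eq_bot_iff]
  rintro t ⟨ht, hto⟩
  have h := End.eq_zero_of_isNilpotent_isSemisimple
    (hb.isNilpotent_ad_of_mem_orthogonal fun y hy => hto y hy) (hss t ht)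
  rw [Submodule.mem_bot, ← LieDerivation.IsKilling.ad_apply_eq_zero_iff (R := ℂ)]
  ext y
  have := LinearMap.congr_fun h y
  simpa using this

/-- A toral subspace of a Borel subalgebra is independent of the orthogonal complement. Equality
characterizes the maximal tori. -/
theorem finrank_add_finrank_orthogonal_le [IsKilling ℂ G] (T : Submodule ℂ G)
    (hss : ∀ t ∈ T, (ad ℂ G t).IsSemisimple) (hTb : T ≤ b.toSubmodule) :
    finrank ℂ T + finrank ℂ ((killingForm ℂ G).orthogonal b.toSubmodule) ≤
      finrank ℂ b.toSubmodule := by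
  have h1 := Submodule.finrank_sup_add_finrank_inf_eq T
    ((killingForm ℂ G).orthogonal b.toSubmodule)
  rw [hb.disjoint_orthogonal T hss, finrank_bot, add_zero] at h1
  rw [← h1]
  exact Submodule.finrank_mono
    (sup_le hTb fun x hx => hb.mem_of_forall_killingForm_eq_zero hx)

end IsBorelSubalgebra

end Cartan


/-! ### A Cartan subalgebra in the intersection of two parabolic subalgebras -/

section CartanExists

open LieAlgebra LieModule Module

variable {G : Type*} [LieRing G] [LieAlgebra ℂ G] [FiniteDimensional ℂ G]

/-- The centralizer of a subspace. -/
def centralizerSubalgebra (T : Submodule ℂ G) : LieSubalgebra ℂ G where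
  carrier := {x | ∀ t ∈ T, ⁅t, x⁆ = 0}
  add_mem' := fun ha hb t ht => by rw [lie_add, ha t ht, hb t ht, add_zero]
  zero_mem' := fun t _ => lie_zero t
  smul_mem' := fun c x hx t ht => by rw [lie_smul, hx t ht, smul_zero]
  lie_mem' := fun {x y} hx hy t ht => by
    rw [leibniz_lie, hx t ht, hy t ht, zero_lie, lie_zero, add_zero]

omit [FiniteDimensional ℂ G] in
theorem lie_eq_zero_of_lie_lie_eq_zero {t x : G} (ht : (ad ℂ G t).IsSemisimple)
    (h : ⁅t, ⁅t, x⁆⁆ = 0) : ⁅t, x⁆ = 0 := by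
  have h1 : x ∈ (ad ℂ G t).maxGenEigenspace 0 :=
    (End.mem_maxGenEigenspace _ _ _).2 ⟨2, by simpa [pow_two] using h⟩
  rw [ht.isFinitelySemisimple.maxGenEigenspace_eq_eigenspace, End.mem_eigenspace_iff] at h1
  simpa using h1

/-- A maximal torus of the intersection of two subalgebras, as a subspace. -/
theorem exists_maximal_toral (p p' : LieSubalgebra ℂ G) {E : G} (hE : (ad ℂ G E).IsSemisimple)
    (hEp : E ∈ p) (hEp' : E ∈ p') :
    ∃ T : Submodule ℂ G, E ∈ T ∧ T ≤ p.toSubmodule ∧ T ≤ p'.toSubmodule ∧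
      (∀ t ∈ T, (ad ℂ G t).IsSemisimple) ∧ (∀ t ∈ T, ∀ s ∈ T, ⁅t, s⁆ = 0) ∧
      ∀ s ∈ p, s ∈ p' → (ad ℂ G s).IsSemisimple → (∀ t ∈ T, ⁅s, t⁆ = 0) → s ∈ T := by
  obtain ⟨T, ⟨h1, h2, h3, h4, h5⟩, hmax⟩ := (wellFounded_gt (α := Submodule ℂ G)).has_min
    {T | E ∈ T ∧ T ≤ p.toSubmodule ∧ T ≤ p'.toSubmodule ∧
      (∀ t ∈ T, (ad ℂ G t).IsSemisimple) ∧ (∀ t ∈ T, ∀ s ∈ T, ⁅t, s⁆ = 0)}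
    ⟨ℂ ∙ E, Submodule.mem_span_singleton_self E,
      (Submodule.span_singleton_le_iff_mem _ _).2 hEp,
      (Submodule.span_singleton_le_iff_mem _ _).2 hEp', by
        intro t ht
        obtain ⟨c, rfl⟩ := Submodule.mem_span_singleton.1 ht
        rw [map_smul]
        exact End.IsSemisimple_smul c hE, by
        intro t ht s hs
        obtain ⟨c, rfl⟩ := Submodule.mem_span_singleton.1 ht
        obtain ⟨d, rfl⟩ := Submodule.mem_span_singleton.1 hs
        simp⟩
  refine ⟨T, h1, h2, h3, h4, h5, fun s hs hs' hss hsT => ?_⟩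
  by_contra hsn
  refine hmax (T ⊔ ℂ ∙ s) ⟨Submodule.mem_sup_left h1,
    sup_le h2 ((Submodule.span_singleton_le_iff_mem _ _).2 hs),
    sup_le h3 ((Submodule.span_singleton_le_iff_mem _ _).2 hs'), ?_, ?_⟩ ?_
  · intro x hx
    obtain ⟨t, ht, _, hc, rfl⟩ := Submodule.mem_sup.1 hx
    obtain ⟨c, rfl⟩ := Submodule.mem_span_singleton.1 hc
    rw [map_add]
    refine End.IsSemisimple.add_of_commute (commute_ad_of_lie_eq_zero ?_) (h4 t ht) ?_
    · rw [lie_smul, ← lie_skew, hsT t ht]; simp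
    · rw [map_smul]; exact End.IsSemisimple_smul c hss
  · intro x hx y hy
    obtain ⟨t, ht, _, hc, rfl⟩ := Submodule.mem_sup.1 hx
    obtain ⟨c, rfl⟩ := Submodule.mem_span_singleton.1 hc
    obtain ⟨t', ht', _, hd, rfl⟩ := Submodule.mem_sup.1 hy
    obtain ⟨d, rfl⟩ := Submodule.mem_span_singleton.1 hd
    have : ⁅t, s⁆ = 0 := by rw [← lie_skew, hsT t ht, neg_zero]
    simp [h5 t ht t' ht', hsT t' ht', this]
  · exact lt_of_le_of_ne le_sup_left fun h => hsn (by
      rw [h]; exact Submodule.mem_sup_right (Submodule.mem_span_singleton_self s))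

/-- If a Borel subalgebra is the sum of a toral subspace `T` and of its nilradical, then it
contains the centralizer of `T`. This is Engel's theorem for the action of the invariants of `T`
in `b` on the quotient of the centralizer by them. -/
theorem IsBorelSubalgebra.centralizer_le [IsKilling ℂ G] {b : LieSubalgebra ℂ G}
    (hb : IsBorelSubalgebra b) (T : Submodule ℂ G)
    (hss : ∀ t ∈ T, (ad ℂ G t).IsSemisimple) (hcomm : ∀ t ∈ T, ∀ s ∈ T, ⁅t, s⁆ = 0)
    (hTb : T ≤ b.toSubmodule)
    (hdec : T ⊔ (killingForm ℂ G).orthogonal b.toSubmodule = b.toSubmodule) :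
    centralizerSubalgebra T ≤ b := by
  set O := (killingForm ℂ G).orthogonal b.toSubmodule with hO
  set L := centralizerSubalgebra T with hL
  have hOb : ∀ x ∈ O, x ∈ b := fun x hx => hb.mem_of_forall_killingForm_eq_zero hx
  have hbO : ∀ x ∈ b, ∀ y ∈ O, ⁅x, y⁆ ∈ O := by
    intro x hx y hy z hz
    change killingForm ℂ G z ⁅x, y⁆ = 0
    rw [← killingForm_lie_left]
    exact hy _ (b.lie_mem hz hx)
  by_contra hLb
  have hsol : IsSolvable (b ⊓ L : LieSubalgebra ℂ G) :=
    isSolvable_of_lie_mem _ b hb.1 fun x hx y hy => b.lie_mem hx.1 hy.1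
  obtain ⟨v, hvL, hvU, χ, hχ⟩ := exists_lie_sub_smul_mem_of_isSolvable (b ⊓ L) hsol
    (b ⊓ L).toSubmodule L.toSubmodule
    (lt_of_le_not_ge (fun x hx => hx.2) fun h => hLb fun x hx => (h hx).1)
    (fun x hx y hy => (b ⊓ L).lie_mem hx hy) (fun x hx y hy => L.lie_mem hx.2 hy)
  have hχ0 : ∀ x : (b ⊓ L : LieSubalgebra ℂ G), χ x = 0 := by
    intro x
    have hxb : (x : G) ∈ T ⊔ O := hdec ▸ x.2.1
    obtain ⟨t, ht, ν, hν, hx⟩ := Submodule.mem_sup.1 hxb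
    have hνL : ∀ y ∈ L, ⁅ν, y⁆ = ⁅(x : G), y⁆ := by
      intro y hy
      rw [← hx, add_lie, hy t ht, zero_add]
    obtain ⟨k, hk⟩ := hb.isNilpotent_ad_of_mem_orthogonal hν
    have hpow : ∀ k, ((ad ℂ G ν) ^ k) v ∈ L ∧ ((ad ℂ G ν) ^ k) v - (χ x) ^ k • v ∈ b ⊓ L := by
      intro k
      induction k with
      | zero => exact ⟨hvL, by simp⟩
      | succ k ih =>
        rw [pow_succ', Module.End.mul_apply, ad_apply, hνL _ ih.1]
        refine ⟨L.lie_mem x.2.2 ih.1, ?_⟩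
        have h1 : ⁅(x : G), ((ad ℂ G ν) ^ k) v⁆ - (χ x) ^ (k + 1) • v =
            ⁅(x : G), ((ad ℂ G ν) ^ k) v - (χ x) ^ k • v⁆ +
              (χ x) ^ k • (⁅(x : G), v⁆ - χ x • v) := by
          rw [lie_sub, lie_smul, smul_sub, smul_smul, pow_succ]
          abel
        rw [h1]
        exact add_mem ((b ⊓ L).lie_mem x.2 ih.2) ((b ⊓ L).smul_mem _ (hχ x))
    have h2 := (hpow k).2
    rw [hk, LinearMap.zero_apply, zero_sub] at h2
    by_contra hne
    refine hvU ?_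
    have h3 : (χ x) ^ k • v ∈ b ⊓ L := by simpa using (b ⊓ L).neg_mem_iff.2 h2
    have h4 := (b ⊓ L).smul_mem ((χ x) ^ k)⁻¹ h3
    rwa [smul_smul, inv_mul_cancel₀ (pow_ne_zero k hne), one_smul] at h4
  have hlie : ∀ x ∈ b ⊓ L, ⁅x, v⁆ ∈ b ⊓ L := by
    intro x hx
    have := hχ ⟨x, hx⟩
    rw [hχ0, zero_smul, sub_zero] at this
    exact this
  let s := (b ⊓ L).adjoinElement v fun x hx => Submodule.mem_sup_left (hlie x hx)
  have hs : IsSolvable s := by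
    refine isSolvable_of_lie_mem s (b ⊓ L) hsol fun x hx y hy => ?_
    obtain ⟨x, hxb, c, rfl⟩ := LieSubalgebra.mem_adjoinElement.1 hx
    obtain ⟨y, hyb, d, rfl⟩ := LieSubalgebra.mem_adjoinElement.1 hy
    rw [add_smul_lie_add_smul]
    exact sub_mem (add_mem ((b ⊓ L).lie_mem hxb hyb) ((b ⊓ L).smul_mem _ (hlie x hxb)))
      ((b ⊓ L).smul_mem _ (hlie y hyb))
  refine hvU ⟨mem_of_orthogonal_orthogonal b.toSubmodule fun y hy => ?_, hvL⟩
  rw [killingForm_comm]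
  refine killingForm_eq_zero_of_centralizes T O hss hcomm (fun t ht y hy => hbO t (hTb ht) y hy)
    hvL (fun w hw hwT => ?_) hy
  exact killingForm_eq_zero_of_isSolvable s hs
    (LieSubalgebra.mem_adjoinElement.2 ⟨0, (b ⊓ L).zero_mem, 1, by simp⟩)
    (LieSubalgebra.mem_adjoinElement.2 ⟨w, ⟨hOb w hw, hwT⟩, 0, by simp⟩)
    (.inl (hb.isNilpotent_ad_of_mem_orthogonal hw))

/-- Two self-normalizing subalgebras that contain their orthogonal complements (that is, two
parabolic subalgebras) contain a common Cartan subalgebra of the ambient semisimple algebra. It can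
be chosen to contain a given semisimple element of the intersection. -/
theorem exists_isCartanSubalgebra_le_inf [IsKilling ℂ G] (p p' : LieSubalgebra ℂ G)
    (hp : ∀ y, (∀ z ∈ p, ⁅y, z⁆ ∈ p) → y ∈ p) (hp' : ∀ y, (∀ z ∈ p', ⁅y, z⁆ ∈ p') → y ∈ p')
    (hN : ∀ x, (∀ y ∈ p, killingForm ℂ G y x = 0) → x ∈ p)
    (hN' : ∀ x, (∀ y ∈ p', killingForm ℂ G y x = 0) → x ∈ p')
    {E : G} (hE : (ad ℂ G E).IsSemisimple) (hEp : E ∈ p) (hEp' : E ∈ p') :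
    ∃ H : LieSubalgebra ℂ G, H.IsCartanSubalgebra ∧ H ≤ p ∧ H ≤ p' ∧ E ∈ H := by
  obtain ⟨T, hET, hTp, hTp', hss, hcomm, hmax⟩ := exists_maximal_toral p p' hE hEp hEp'
  obtain ⟨b, hb, hTb, hbp⟩ := exists_isBorelSubalgebra_le p hp hN T hcomm hTp
  obtain ⟨b', hb', hTb', hbp'⟩ := exists_isBorelSubalgebra_le p' hp' hN' T hcomm hTp'
  set O := (killingForm ℂ G).orthogonal b.toSubmodule with hO
  set O' := (killingForm ℂ G).orthogonal b'.toSubmodule with hO'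
  -- Jordan decomposition in the centralizer of `T`
  have hjordan : ∀ x ∈ p, x ∈ p' → (∀ t ∈ T, ⁅t, x⁆ = 0) →
      ∃ t ∈ T, IsNilpotent (ad ℂ G (x - t)) := by
    intro x hx hx' hxT
    obtain ⟨s, h1, h2, h3, h4⟩ := exists_isSemisimple_replica x
    refine ⟨s, hmax s ?_ ?_ h1 fun t ht => h4 t ?_, h2⟩
    · exact hp s (h3 p.toSubmodule fun w hw => p.lie_mem hx hw)
    · exact hp' s (h3 p'.toSubmodule fun w hw => p'.lie_mem hx' hw)
    · rw [← lie_skew, hxT t ht, neg_zero]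
  have hinf : b.toSubmodule ⊓ b'.toSubmodule ≤
      T ⊔ (killingForm ℂ G).orthogonal (b.toSubmodule ⊔ b'.toSubmodule) := by
    have hOO : O ⊓ O' ≤ (killingForm ℂ G).orthogonal (b.toSubmodule ⊔ b'.toSubmodule) := by
      rintro x ⟨hx, hx'⟩ y hy
      obtain ⟨y₁, h₁, y₂, h₂, rfl⟩ := Submodule.mem_sup.1 hy
      change killingForm ℂ G (y₁ + y₂) x = 0
      have e₁ : killingForm ℂ G y₁ x = 0 := hx y₁ h₁
      have e₂ : killingForm ℂ G y₂ x = 0 := hx' y₂ h₂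
      rw [map_add, LinearMap.add_apply, e₁, e₂, add_zero]
    refine le_trans ?_ (sup_le_sup_left hOO T)
    intro w hw
    obtain ⟨w₀, hw₀, h₀, hR⟩ := le_centralizer_sup_span_lie T (b.toSubmodule ⊓ b'.toSubmodule)
      hss hcomm (fun t ht y hy => ⟨b.lie_mem (hTb ht) hy.1, b'.lie_mem (hTb' ht) hy.2⟩) hw
    obtain ⟨t, ht, hnil⟩ := hjordan w₀ (hbp hw₀.1) (hbp' hw₀.2) h₀
    have h1 : w₀ - t ∈ O ⊓ O' :=
      ⟨fun y hy => killingForm_eq_zero_of_isSolvable b hb.1 hy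
          (sub_mem hw₀.1 (hTb ht)) (.inl hnil),
        fun y hy => killingForm_eq_zero_of_isSolvable b' hb'.1 hy
          (sub_mem hw₀.2 (hTb' ht)) (.inl hnil)⟩
    have h2 : w - w₀ ∈ O ⊓ O' := by
      refine Submodule.span_le.2 ?_ hR
      rintro _ ⟨t, ht, y, hy, rfl⟩
      exact ⟨fun z hz => killingForm_eq_zero_of_isSolvable b hb.1 hz
          (b.lie_mem (hTb ht) hy.1) (.inr ⟨t, hTb ht, y, hy.1, rfl⟩),
        fun z hz => killingForm_eq_zero_of_isSolvable b' hb'.1 hz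
          (b'.lie_mem (hTb' ht) hy.2) (.inr ⟨t, hTb' ht, y, hy.2, rfl⟩)⟩
    have h3 : w = t + ((w₀ - t) + (w - w₀)) := by abel
    rw [h3]
    exact Submodule.add_mem_sup ht (Submodule.add_mem _ h1 h2)
  -- counting dimensions, `b` is the sum of `T` and of its orthogonal complement
  have hdec : T ⊔ O = b.toSubmodule := by
    have hnd := IsKilling.killingForm_nondegenerate ℂ G
    have e1 := LinearMap.BilinForm.finrank_orthogonal hnd b.toSubmodule
    have e2 := LinearMap.BilinForm.finrank_orthogonal hnd b'.toSubmodule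
    have e3 := LinearMap.BilinForm.finrank_orthogonal hnd (b.toSubmodule ⊔ b'.toSubmodule)
    have e4 := Submodule.finrank_sup_add_finrank_inf_eq b.toSubmodule b'.toSubmodule
    have e5 := hb.finrank_add_finrank_orthogonal_le T hss hTb
    have e6 := hb'.finrank_add_finrank_orthogonal_le T hss hTb'
    have e7 := Submodule.finrank_mono hinf
    have e8 := Submodule.finrank_add_le_finrank_add_finrank T
      ((killingForm ℂ G).orthogonal (b.toSubmodule ⊔ b'.toSubmodule))
    have e9 := Submodule.finrank_le b.toSubmodule
    have e10 := Submodule.finrank_le b'.toSubmodule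
    have e11 := Submodule.finrank_le (b.toSubmodule ⊔ b'.toSubmodule)
    have e12 := Submodule.finrank_sup_add_finrank_inf_eq T O
    rw [hb.disjoint_orthogonal T hss, finrank_bot] at e12
    rw [← hO] at e1 e5
    rw [← hO'] at e2 e6
    refine Submodule.eq_of_le_of_finrank_le
      (sup_le hTb fun x hx => hb.mem_of_forall_killingForm_eq_zero hx) ?_
    omega
  have hLb := hb.centralizer_le T hss hcomm hTb hdec
  have hTL : ∀ t ∈ T, t ∈ centralizerSubalgebra T := fun t ht s hs => hcomm s hs t ht
  have hLT : ∀ x ∈ centralizerSubalgebra T, x ∈ T := by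
    intro x hx
    have hxb : x ∈ T ⊔ O := hdec ▸ hLb hx
    obtain ⟨t, ht, ν, hν, rfl⟩ := Submodule.mem_sup.1 hxb
    have hνL : ν ∈ centralizerSubalgebra T := by
      have := sub_mem hx (hTL t ht)
      rwa [add_sub_cancel_left] at this
    have hν0 : ν = 0 := by
      refine (IsKilling.killingForm_nondegenerate ℂ G).1 ν fun w => ?_
      refine killingForm_eq_zero_of_centralizes T ⊤ hss hcomm (fun _ _ _ _ => trivial) hνL
        (fun w _ hw => ?_) (Submodule.mem_top (x := w))
      rw [killingForm_comm]
      exact hν w (hLb hw)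
    rw [hν0, add_zero]
    exact ht
  have hab : IsLieAbelian (centralizerSubalgebra T) :=
    ⟨fun x y => Subtype.ext (y.2 x (hLT x x.2))⟩
  refine ⟨centralizerSubalgebra T, ⟨inferInstance, ?_⟩, fun x hx => hTp (hLT x hx),
    fun x hx => hTp' (hLT x hx), hTL E hET⟩
  refine le_antisymm (fun x hx t ht => ?_) (LieSubalgebra.le_normalizer _)
  rw [LieSubalgebra.mem_normalizer_iff] at hx
  refine lie_eq_zero_of_lie_lie_eq_zero (hss t ht) ?_
  have h1 := hx t (hTL t ht)
  have h2 : ⁅t, ⁅x, t⁆⁆ = 0 := h1 t ht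
  rw [← lie_skew t x, lie_neg, h2, neg_zero]

end CartanExists


/-! ### Functions on the roots of degree -1 -/

section RootLeastSquares

/-- The normal equations of a least squares problem have a solution. -/
theorem exists_least_squares {ι κ : Type*} [Fintype ι] [Fintype κ] (A : ι → κ → ℝ) (f : ι → ℝ) :
    ∃ a : κ → ℝ, ∀ k, ∑ i, (f i - ∑ l, a l * A i l) * A i k = 0 := by
  let w : κ → EuclideanSpace ℝ ι := fun k => WithLp.toLp 2 fun i => A i k
  let F : EuclideanSpace ℝ ι := WithLp.toLp 2 f
  let K := Submodule.span ℝ (Set.range w)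
  obtain ⟨a, ha⟩ := (Submodule.mem_span_range_iff_exists_fun ℝ).1
    (K.starProjection_apply_mem F)
  refine ⟨a, fun k => ?_⟩
  have h := (K.mem_orthogonal _).1 (K.sub_starProjection_mem_orthogonal F) (w k)
    (Submodule.subset_span ⟨k, rfl⟩)
  rw [← ha] at h
  simpa [PiLp.inner_apply, F, w] using h

variable {ι M N : Type*} [AddCommGroup M] [Module ℂ M] [AddCommGroup N] [Module ℂ N]
  (P : RootPairing ι ℂ M N) [Fintype ι] [P.IsCrystallographic]

namespace RootPairing

omit [Fintype ι] in
theorem pairingIn_add_of_root_eq_add {i j k : ι} (h : P.root k = P.root i + P.root j) (a : ι) :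
    P.pairingIn ℤ k a = P.pairingIn ℤ i a + P.pairingIn ℤ j a := by
  apply FaithfulSMul.algebraMap_injective ℤ ℂ
  rw [map_add, algebraMap_pairingIn, algebraMap_pairingIn, algebraMap_pairingIn,
    ← root_coroot_eq_pairing, h, map_add, LinearMap.add_apply, root_coroot_eq_pairing,
    root_coroot_eq_pairing]

omit [Fintype ι] in
theorem pairingIn_reflectionPerm_self (b i : ι) :
    P.pairingIn ℤ (P.reflectionPerm b i) b = -P.pairingIn ℤ i b := by
  apply FaithfulSMul.algebraMap_injective ℤ ℂ
  rw [map_neg, algebraMap_pairingIn, algebraMap_pairingIn, ← root_coroot_eq_pairing,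
    root_reflectionPerm, reflection_apply_root, map_sub, LinearMap.sub_apply, map_smul,
    LinearMap.smul_apply, root_coroot_eq_pairing, root_coroot_eq_pairing, pairing_same, smul_eq_mul]
  ring

theorem pairingIn_pos_of_sum_pos {i j : ι}
    (h : 0 < ∑ a, P.pairingIn ℤ i a * P.pairingIn ℤ j a) : 0 < P.pairingIn ℤ i j := by
  rw [← (P.posRootForm ℤ).zero_lt_apply_root_root_iff i j]
  refine lt_of_lt_of_eq h ?_
  apply FaithfulSMul.algebraMap_injective ℤ ℂ
  rw [algebraMap_posRootForm_posForm, rootForm_apply_apply]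
  simp [← P.algebraMap_pairingIn ℤ]

omit [Fintype ι] [P.IsCrystallographic] in
theorem eq_zero_of_forall_coroot [P.IsRootSystem] {v : M}
    (h : ∀ i, P.toLinearMap v (P.coroot i) = 0) : v = 0 := by
  have h1 : P.toLinearMap v = 0 := by
    refine LinearMap.ext_on_range (v := P.coroot) IsRootSystem.span_coroot_eq_top fun i => ?_
    simpa using h i
  have : P.toPerfPair v = P.toPerfPair 0 := by
    rw [map_zero]; exact h1
  exact P.toPerfPair.injective this

variable {P} (d : M →ₗ[ℂ] ℂ)

omit [Fintype ι] [P.IsCrystallographic] in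
theorem apply_root_reflectionPerm {b : ι} (hb : d (P.root b) = 0) (i : ι) :
    d (P.root (P.reflectionPerm b i)) = d (P.root i) := by
  rw [root_reflectionPerm, reflection_apply_root, map_sub, map_smul, hb, smul_zero, sub_zero]

/-- Along the strings of a root `b` of degree `0`, a function which grows by the constant `g` at
each step is transformed in the expected way by the reflection at `b`. -/
theorem apply_reflectionPerm_eq_sub (c : ι → ℝ) {b : ι} (hb : d (P.root b) = 0) {e : ℂ}
    (he : e ≠ 0) (g : ℝ) (hc : ∀ i j, d (P.root i) = e → P.root j = P.root i + P.root b →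
      c j = c i + g) {i : ι} (hi : d (P.root i) = e) :
    c (P.reflectionPerm b i) = c i - P.pairingIn ℤ i b * g := by
  have key : ∀ n : ℕ, ∀ i, d (P.root i) = e → P.pairingIn ℤ i b = n →
      c (P.reflectionPerm b i) = c i - P.pairingIn ℤ i b * g := by
    intro n
    induction n using Nat.strong_induction_on with
    | _ n ih =>
      intro i hi hn
      rcases Nat.eq_zero_or_pos n with rfl | hpos
      · have : P.reflectionPerm b i = i := P.root.injective (by
          rw [root_reflectionPerm, reflection_apply_root, ← P.algebraMap_pairingIn ℤ, hn]; simp)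
        rw [this, hn]; simp
      obtain ⟨j, hj⟩ := P.root_sub_root_mem_of_pairingIn_pos (i := i) (j := b) (by omega)
        (by rintro rfl; exact he (hi ▸ hb))
      have hij : P.root i = P.root j + P.root b := by rw [hj]; abel
      have hdj : d (P.root j) = e := by rw [hj, map_sub, hi, hb, sub_zero]
      have hpj := P.pairingIn_add_of_root_eq_add hij b
      rw [P.pairingIn_same] at hpj
      have h1 := hc j i hdj hij
      have hr : P.root (P.reflectionPerm b j) =
          P.root (P.reflectionPerm b i) + P.root b := by
        rw [root_reflectionPerm, root_reflectionPerm, hij, map_add, reflection_apply_self]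
        abel
      have h2 := hc _ _ ((apply_root_reflectionPerm d hb i).trans hi) hr
      rcases Nat.lt_or_ge 1 n with h3 | h3
      · have h4 := ih (n - 2) (by omega) j hdj (by omega)
        rw [hpj]
        push_cast
        linarith
      · -- the string has two elements
        have hn1 : P.pairingIn ℤ i b = 1 := by omega
        have : P.reflectionPerm b i = j := P.root.injective (by
          rw [root_reflectionPerm, reflection_apply_root, ← P.algebraMap_pairingIn ℤ, hn1, hj]
          simp)
        rw [this, hn1]
        push_cast
        linarith
  rcases le_total 0 (P.pairingIn ℤ i b) with h | h
  · obtain ⟨n, hn⟩ := Int.eq_ofNat_of_zero_le h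
    exact key n i hi hn
  · have h1 := P.pairingIn_reflectionPerm_self b i
    obtain ⟨n, hn⟩ := Int.eq_ofNat_of_zero_le
      (by omega : 0 ≤ P.pairingIn ℤ (P.reflectionPerm b i) b)
    have h2 := key n _ ((apply_root_reflectionPerm d hb i).trans hi) hn
    rw [reflectionPerm_self, h1] at h2
    push_cast at h2
    linarith

/-- If moreover the function is orthogonal to the coroot of `b`, then it is constant along the
strings of `b`. -/
theorem eq_zero_of_sum_mul_pairingIn_eq_zero [DecidablePred fun i => d (P.root i) = -1]
    (c : ι → ℝ) {b : ι} (hb : d (P.root b) = 0) (g : ℝ)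
    (hc : ∀ i j, d (P.root i) = -1 → P.root j = P.root i + P.root b → c j = c i + g)
    (hsum : ∑ i with d (P.root i) = -1, c i * P.pairingIn ℤ i b = 0) {i j : ι}
    (hi : d (P.root i) = -1) (hij : P.root j = P.root i + P.root b) : g = 0 := by
  have h1 : ∑ i with d (P.root i) = -1, c i * P.pairingIn ℤ i b =
      ∑ i with d (P.root i) = -1, c (P.reflectionPerm b i) *
        P.pairingIn ℤ (P.reflectionPerm b i) b := by
    refine (Finset.sum_equiv (P.reflectionPerm b) (fun i => ?_) fun i _ => rfl).symm
    simp only [Finset.mem_filter, Finset.mem_univ, true_and, apply_root_reflectionPerm d hb]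
  have h2 : ∑ i with d (P.root i) = -1, c (P.reflectionPerm b i) *
        P.pairingIn ℤ (P.reflectionPerm b i) b =
      - ∑ i with d (P.root i) = -1, c i * P.pairingIn ℤ i b +
        g * ∑ i with d (P.root i) = -1, (P.pairingIn ℤ i b : ℝ) ^ 2 := by
    rw [Finset.mul_sum, ← Finset.sum_neg_distrib, ← Finset.sum_add_distrib]
    refine Finset.sum_congr rfl fun i hi => ?_
    rw [apply_reflectionPerm_eq_sub d c hb (by norm_num) g hc (Finset.mem_filter.1 hi).2,
      pairingIn_reflectionPerm_self]
    push_cast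
    ring
  rw [← h1, hsum, neg_zero, zero_add] at h2
  rcases mul_eq_zero.1 h2.symm with h3 | h3
  · exact h3
  have h4 := (Finset.sum_eq_zero_iff_of_nonneg fun i _ => sq_nonneg _).1 h3
  have h5 : (P.pairingIn ℤ i b : ℝ) = 0 := by
    simpa using h4 i (by simpa using hi)
  have h6 : (P.pairingIn ℤ j b : ℝ) = 0 := by
    simpa using h4 j (by simp [hij, hi, hb])
  have h7 := P.pairingIn_add_of_root_eq_add hij b
  rw [P.pairingIn_same] at h7
  have h8 : P.pairingIn ℤ i b = 0 := by exact_mod_cast h5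
  have h9 : P.pairingIn ℤ j b = 0 := by exact_mod_cast h6
  omega

/-- A linear relation among the roots of degree `-1` in which roots with different coefficients
form obtuse angles has no positive coefficient. -/
theorem nonpos_of_sum_mul_pairingIn_eq_zero [P.IsRootSystem]
    [DecidablePred fun i => d (P.root i) = -1] (c : ι → ℝ)
    (hsum : ∀ a, ∑ i with d (P.root i) = -1, c i * P.pairingIn ℤ i a = 0)
    (hc : ∀ i j, d (P.root i) = -1 → d (P.root j) = -1 → 0 < P.pairingIn ℤ i j → c i = c j)
    {i : ι} (hi : d (P.root i) = -1) : c i ≤ 0 := by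
  classical
  by_contra! hpos
  let s := Finset.univ.filter fun i => d (P.root i) = -1
  -- the part `n` of the relation with positive coefficients equals the negative of the other part,
  -- and their inner product is nonnegative
  let n : ι → ℝ := fun a => ∑ i ∈ s with 0 < c i, c i * P.pairingIn ℤ i a
  have hn : ∀ a, n a = - ∑ i ∈ s with ¬ 0 < c i, c i * P.pairingIn ℤ i a := by
    intro a
    have := hsum a
    rw [← Finset.sum_filter_add_sum_filter_not _ fun i => 0 < c i] at this
    exact eq_neg_of_add_eq_zero_left this
  have hsq : ∑ a, n a ^ 2 ≤ 0 := by
    have h1 : ∑ a, n a ^ 2 = - ∑ i ∈ s with 0 < c i, ∑ j ∈ s with ¬ 0 < c j,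
        c i * c j * (∑ a, P.pairingIn ℤ i a * P.pairingIn ℤ j a : ℤ) := by
      have : ∀ a, n a ^ 2 = - ∑ i ∈ s with 0 < c i, ∑ j ∈ s with ¬ 0 < c j,
          c i * c j * (P.pairingIn ℤ i a * P.pairingIn ℤ j a : ℤ) := by
        intro a
        rw [pow_two]
        nth_rewrite 2 [hn a]
        rw [mul_neg, Finset.sum_mul_sum]
        congr 1
        refine Finset.sum_congr rfl fun i _ => Finset.sum_congr rfl fun j _ => ?_
        push_cast
        ring
      simp_rw [this]
      rw [Finset.sum_neg_distrib, Finset.sum_comm]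
      congr 1
      refine Finset.sum_congr rfl fun i _ => ?_
      rw [Finset.sum_comm]
      refine Finset.sum_congr rfl fun j _ => ?_
      push_cast
      rw [Finset.mul_sum]
    rw [h1, neg_nonpos]
    refine Finset.sum_nonneg fun i hi => Finset.sum_nonneg fun j hj => ?_
    simp only [s, Finset.mem_filter, Finset.mem_univ, true_and] at hi hj
    refine mul_nonneg_of_nonpos_of_nonpos
      (mul_nonpos_of_nonneg_of_nonpos hi.2.le (not_lt.1 hj.2)) ?_
    by_contra! h
    have := hc i j hi.1 hj.1 (pairingIn_pos_of_sum_pos P (by exact_mod_cast h))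
    exact hj.2 (this ▸ hi.2)
  have hn0 : ∀ a, n a = 0 := by
    intro a
    have h1 := (Finset.sum_eq_zero_iff_of_nonneg fun i _ => sq_nonneg (n i)).1
      (le_antisymm hsq (Finset.sum_nonneg fun i _ => sq_nonneg _))
    simpa using h1 a (Finset.mem_univ a)
  have hv : ∑ i ∈ s with 0 < c i, (c i : ℂ) • P.root i = 0 := by
    refine P.eq_zero_of_forall_coroot fun a => ?_
    have h1 : ((n a : ℝ) : ℂ) = 0 := by rw [hn0]; simp
    rw [← h1, map_sum, LinearMap.sum_apply]
    simp only [n]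
    rw [Complex.ofReal_sum]
    refine Finset.sum_congr rfl fun i _ => ?_
    rw [map_smul, LinearMap.smul_apply, root_coroot_eq_pairing, ← P.algebraMap_pairingIn ℤ]
    simp
  have h1 : ∑ i ∈ s with 0 < c i, c i = 0 := by
    have h2 := congrArg d hv
    rw [map_zero, map_sum, Finset.sum_congr rfl (g := fun i => -((c i : ℝ) : ℂ)),
      Finset.sum_neg_distrib, neg_eq_zero] at h2
    · exact_mod_cast h2
    · intro i hi
      simp only [s, Finset.mem_filter, Finset.mem_univ, true_and] at hi
      rw [map_smul, hi.1]
      simp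
  refine h1.not_gt (Finset.sum_pos (fun i hi => (Finset.mem_filter.1 hi).2) ⟨i, ?_⟩)
  simp [s, hi, hpos]

/-- Let a root system be graded by `d`. A function on the roots of degree `-1` which grows by a
constant along the strings of each root of degree `0` is the restriction of a linear form. -/
theorem exists_eq_sum_mul_pairingIn [P.IsRootSystem] (f : ι → ℝ)
    (hf : ∀ b, d (P.root b) = 0 → ∃ g : ℝ, ∀ i j, d (P.root i) = -1 →
      P.root j = P.root i + P.root b → f j = f i + g) :
    ∃ a : ι → ℝ, ∀ i, d (P.root i) = -1 → f i = ∑ k, a k * P.pairingIn ℤ i k := by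
  classical
  obtain ⟨a, ha⟩ := exists_least_squares
    (fun i k => if d (P.root i) = -1 then (P.pairingIn ℤ i k : ℝ) else 0) f
  refine ⟨a, ?_⟩
  -- the residual of the best approximation of `f` by a linear form; it is shown to vanish
  let c : ι → ℝ := fun i => f i - ∑ k, a k * P.pairingIn ℤ i k
  have hsum : ∀ k, ∑ i with d (P.root i) = -1, c i * P.pairingIn ℤ i k = 0 := by
    intro k
    rw [← ha k, Finset.sum_filter]
    refine Finset.sum_congr rfl fun i _ => ?_
    split_ifs with h
    · rfl
    · simp
  have hstep : ∀ b, d (P.root b) = 0 → ∀ i j, d (P.root i) = -1 →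
      P.root j = P.root i + P.root b → c j = c i := by
    intro b hb i j hi hij
    obtain ⟨g, hg⟩ := hf b hb
    have h1 : ∀ i j, d (P.root i) = -1 → P.root j = P.root i + P.root b →
        c j = c i + (g - ∑ k, a k * P.pairingIn ℤ b k) := by
      intro i j hi hij
      simp only [c]
      rw [hg i j hi hij]
      simp_rw [P.pairingIn_add_of_root_eq_add hij]
      push_cast
      simp_rw [mul_add]
      rw [Finset.sum_add_distrib]
      ring
    rw [h1 i j hi hij, eq_zero_of_sum_mul_pairingIn_eq_zero d c hb _ h1 (hsum b) hi hij, add_zero]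
  have hcc : ∀ i j, d (P.root i) = -1 → d (P.root j) = -1 → 0 < P.pairingIn ℤ i j →
      c i = c j := by
    intro i j hi hj hij
    by_cases h : i = j
    · rw [h]
    obtain ⟨b, hb⟩ := P.root_sub_root_mem_of_pairingIn_pos hij h
    exact hstep b (by rw [hb, map_sub, hi, hj, sub_self]) j i hj (by rw [hb]; abel)
  intro i hi
  have h1 := nonpos_of_sum_mul_pairingIn_eq_zero d c hsum hcc hi
  have h2 := nonpos_of_sum_mul_pairingIn_eq_zero d (fun i => -c i)
    (fun k => by simp_rw [neg_mul]; rw [Finset.sum_neg_distrib, hsum, neg_zero])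
    (fun i j hi hj hij => by rw [hcc i j hi hj hij]) hi
  have h3 : c i = 0 := by linarith
  exact sub_eq_zero.1 h3

end RootPairing

end RootLeastSquares

section RootSpaces

open LieAlgebra LieModule Module

/-- Brackets of nonzero root vectors do not vanish if the sum of the roots is a root. -/
theorem LieAlgebra.IsKilling.lie_ne_zero_of_rootSpace_add_ne_bot {K L : Type*} [Field K]
    [CharZero K] [LieRing L] [LieAlgebra K L] [IsKilling K L] [FiniteDimensional K L]
    {H : LieSubalgebra K L} [H.IsCartanSubalgebra] [IsTriangularizable K H L]
    {α β : Weight K H L} (hα : α.IsNonZero) (hβ : β.IsNonZero)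
    (hαβ : rootSpace H (α + β : H → K) ≠ ⊥) {x y : L} (hx : x ∈ rootSpace H α)
    (hy : y ∈ rootSpace H β) (hx0 : x ≠ 0) (hy0 : y ≠ 0) : ⁅x, y⁆ ≠ 0 := by
  have hk : 1 ≤ chainTopCoeff α β := by
    have := (rootSpace_zsmul_add_ne_bot_iff α β hα 1).1 (by simpa using hαβ)
    exact_mod_cast this.1
  obtain ⟨z, hz, hz0⟩ := (chainTop α β).exists_ne_zero
  obtain ⟨h, e, f, isSl2, he, hf⟩ := exists_isSl2Triple_of_weight_isNonZero hα
  obtain rfl := isSl2.h_eq_coroot hα he hf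
  have prim : isSl2.HasPrimitiveVectorWith z (chainLength α β : K) :=
    have := lie_mem_genWeightSpace_of_mem_genWeightSpace he hz
    ⟨hz0, (chainLength_smul _ _ hz).symm, by rwa [genWeightSpace_add_chainTop _ _ hα] at this⟩
  have hlen := chainBotCoeff_add_chainTopCoeff α β
  obtain ⟨k, hk'⟩ : ∃ k, chainTopCoeff α β = k + 1 := ⟨chainTopCoeff α β - 1, by omega⟩
  have hw := toEnd_pow_apply_mem hf hz (k + 1)
  have hw0 := prim.pow_toEnd_f_ne_zero_of_eq_nat rfl (i := k + 1) (by omega)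
  have hwe := prim.lie_e_pow_succ_toEnd_f k
  have hk0 := prim.pow_toEnd_f_ne_zero_of_eq_nat rfl (i := k) (by omega)
  have hwβ : ((toEnd K L L f) ^ (k + 1)) z ∈ rootSpace H β := by
    convert hw using 2
    rw [coe_chainTop', hk', smul_neg, neg_add_cancel_left]
  have h1 := finrank_rootSpace_eq_one α hα
  have h2 := finrank_rootSpace_eq_one β hβ
  obtain ⟨r, hr⟩ := (finrank_eq_one_iff_of_nonzero' (⟨e, he⟩ : rootSpace H α)
    (by simpa using isSl2.e_ne_zero)).1 h1 ⟨x, hx⟩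
  obtain ⟨s, hs⟩ := (finrank_eq_one_iff_of_nonzero' (⟨_, hwβ⟩ : rootSpace H β)
    (by simpa using hw0)).1 h2 ⟨y, hy⟩
  have hr' : r • e = x := congrArg Subtype.val hr
  have hs' : s • ((toEnd K L L f) ^ (k + 1)) z = y := congrArg Subtype.val hs
  have hr0 : r ≠ 0 := by rintro rfl; exact hx0 (by rw [← hr', zero_smul])
  have hs0 : s ≠ 0 := by rintro rfl; exact hy0 (by rw [← hs', zero_smul])
  rw [← hr', ← hs', smul_lie, lie_smul, hwe]
  refine smul_ne_zero hr0 (smul_ne_zero hs0 (smul_ne_zero (mul_ne_zero ?_ ?_) hk0))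
  · exact_mod_cast Nat.succ_ne_zero k
  · rw [sub_ne_zero]
    exact_mod_cast (by omega : chainLength α β ≠ k)

end RootSpaces


/-! ### Half structures -/

section HalfStructure

open LieAlgebra LieModule Module

/-- A stable subspace of an operator which is diagonalizable with integral eigenvalues is the sum of
its intersections with the eigenspaces. -/
theorem Submodule.eq_iSup_inf_eigenspace_intCast {K V : Type*} [Field K] [CharZero K]
    [AddCommGroup V] [Module K V] [FiniteDimensional K V] {f : End K V}
    (hf : ⨆ k : ℤ, f.eigenspace (k : K) = ⊤) (W : Submodule K V) (hW : ∀ x ∈ W, f x ∈ W) :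
    W = ⨆ k : ℤ, W ⊓ f.eigenspace (k : K) := by
  have htop : ⨆ μ, f.genEigenspace μ 1 = ⊤ :=
    eq_top_iff.2 (hf ▸ iSup_le fun k => le_iSup (fun μ => f.genEigenspace μ 1) (k : K))
  refine le_antisymm ?_ (iSup_le fun k => inf_le_left)
  conv_lhs => rw [Submodule.eq_iSup_inf_genEigenspace 1 hW htop]
  refine iSup_le fun μ => ?_
  by_cases hμ : ∃ k : ℤ, (k : K) = μ
  · obtain ⟨k, rfl⟩ := hμ
    exact le_iSup (fun k : ℤ => W ⊓ f.eigenspace (k : K)) k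
  · have h1 : f.eigenspace μ = ⊥ := by
      have h2 := f.eigenspaces_iSupIndep μ
      have h3 : (⨆ ν, ⨆ _ : ν ≠ μ, f.eigenspace ν) = ⊤ :=
        eq_top_iff.2 (hf ▸ iSup_le fun k =>
          le_iSup₂_of_le (k : K) (fun h => hμ ⟨k, h⟩) le_rfl)
      rw [h3] at h2
      exact disjoint_top.1 h2
    refine le_trans inf_le_right ?_
    change f.eigenspace μ ≤ _
    rw [h1]
    exact bot_le

variable {G : Type*} [LieRing G] [LieAlgebra ℂ G] [FiniteDimensional ℂ G]

/-- The properties of the subalgebra `q = 𝔤_{-1,0} ⊕ 𝔤_{0,0} ⊕ 𝔤_{0,1} ⊕ ⨁_{k > 0} 𝔤_k` that the CR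
structure determines in the complexification: it contains the grading element `E` and all elements
of positive degree, and its elements of degree `0` are those that preserve its part of degree
`-1`. -/
structure IsHalfStructure (E : G) (q : LieSubalgebra ℂ G) : Prop where
  mem : E ∈ q
  pos : ∀ k : ℤ, 0 < k → ∀ x, ⁅E, x⁆ = (k : ℂ) • x → x ∈ q
  stab : ∀ x, ⁅E, x⁆ = 0 → (∀ z ∈ q, ⁅E, z⁆ = -z → ⁅x, z⁆ ∈ q) → x ∈ q

omit [FiniteDimensional ℂ G] in
theorem killingForm_eq_zero_of_eigenvector {E x y : G} {a b : ℂ} (hx : ⁅E, x⁆ = a • x)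
    (hy : ⁅E, y⁆ = b • y) (hab : a + b ≠ 0) : killingForm ℂ G x y = 0 := by
  have h := killingForm_lie_left x E y
  rw [← lie_skew, hx, hy, map_neg, map_smul, map_smul, LinearMap.neg_apply, LinearMap.smul_apply,
    smul_eq_mul, smul_eq_mul] at h
  refine (mul_eq_zero.1 (?_ : (a + b) * killingForm ℂ G x y = 0)).resolve_left hab
  linear_combination -h

variable {E : G} {q : LieSubalgebra ℂ G}

namespace IsHalfStructure

/-- A half structure is self-normalizing. Together with `IsHalfStructure.mem_of_orthogonal` this is
all that is used of the fact that `q` is parabolic. -/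
theorem mem_of_normalizes (hq : IsHalfStructure E q)
    (hE : ⨆ k : ℤ, (ad ℂ G E).eigenspace (k : ℂ) = ⊤) {y : G} (hy : ∀ z ∈ q, ⁅y, z⁆ ∈ q) :
    y ∈ q := by
  have hEy : ⁅E, y⁆ ∈ q := by
    rw [← lie_skew]
    exact q.neg_mem_iff.2 (hy E hq.mem)
  have h := Submodule.eq_iSup_inf_eigenspace_intCast hE (q.toSubmodule ⊔ ℂ ∙ y) (fun x hx => by
    obtain ⟨z, hz, _, hc, rfl⟩ := Submodule.mem_sup.1 hx
    obtain ⟨c, rfl⟩ := Submodule.mem_span_singleton.1 hc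
    rw [map_add, map_smul]
    exact Submodule.mem_sup_left (add_mem (q.lie_mem hq.mem hz) (q.smul_mem c hEy)))
  have h1 : q.toSubmodule ⊔ ℂ ∙ y ≤ q.toSubmodule := by
    rw [h]
    refine iSup_le fun k => ?_
    rintro x ⟨hx, hxk⟩
    rw [SetLike.mem_coe, End.mem_eigenspace_iff] at hxk
    obtain ⟨z, hz, _, hc, rfl⟩ := Submodule.mem_sup.1 hx
    obtain ⟨c, rfl⟩ := Submodule.mem_span_singleton.1 hc
    rw [ad_apply] at hxk
    by_cases hk : k = 0
    · refine hq.stab _ (by rw [hxk, hk]; simp) fun w hw _ => ?_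
      rw [add_lie, smul_lie]
      exact add_mem (q.lie_mem hz hw) (q.smul_mem c (hy w hw))
    · have h2 : (k : ℂ) • (z + c • y) ∈ q := by
        rw [← hxk, lie_add, lie_smul]
        exact add_mem (q.lie_mem hq.mem hz) (q.smul_mem c hEy)
      have h3 := q.smul_mem (k : ℂ)⁻¹ h2
      rwa [smul_smul, inv_mul_cancel₀ (by exact_mod_cast hk), one_smul] at h3
  exact h1 (Submodule.mem_sup_right (Submodule.mem_span_singleton_self y))

omit [FiniteDimensional ℂ G] in
theorem lie_mem_orthogonal {x z : G} (hx : ∀ y ∈ q, killingForm ℂ G y x = 0) (hz : z ∈ q) :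
    ∀ y ∈ q, killingForm ℂ G y ⁅x, z⁆ = 0 := by
  intro y hy
  rw [← lie_skew, map_neg, ← killingForm_lie_left, hx _ (q.lie_mem hy hz), neg_zero]

variable [IsKilling ℂ G]

omit [FiniteDimensional ℂ G] in
theorem eq_zero_of_orthogonal (hq : IsHalfStructure E q)
    (hE : ⨆ k : ℤ, (ad ℂ G E).eigenspace (k : ℂ) = ⊤) {k : ℤ} (hk : k < 0) {x : G}
    (hx : ∀ y ∈ q, killingForm ℂ G y x = 0) (hxk : ⁅E, x⁆ = (k : ℂ) • x) : x = 0 := by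
  refine (IsKilling.killingForm_nondegenerate ℂ G).1 x fun y => ?_
  have hy : y ∈ ⨆ k : ℤ, (ad ℂ G E).eigenspace (k : ℂ) := hE ▸ Submodule.mem_top
  induction hy using Submodule.iSup_induction' with
  | mem j y hy =>
    rw [End.mem_eigenspace_iff, ad_apply] at hy
    by_cases hj : k + j = 0
    · rw [killingForm_comm]
      exact hx y (hq.pos j (by omega) y hy)
    · exact killingForm_eq_zero_of_eigenvector hxk hy (by exact_mod_cast hj)
  | zero => simp
  | add y z _ _ h1 h2 => rw [map_add, h1, h2, add_zero]

omit [FiniteDimensional ℂ G] in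
theorem lie_eq_zero_of_orthogonal (hq : IsHalfStructure E q)
    (hE : ⨆ k : ℤ, (ad ℂ G E).eigenspace (k : ℂ) = ⊤) {x z : G}
    (hx : ∀ y ∈ q, killingForm ℂ G y x = 0) (hx0 : ⁅E, x⁆ = 0) (hz : z ∈ q) (hz1 : ⁅E, z⁆ = -z) :
    ⁅x, z⁆ = 0 := by
  refine hq.eq_zero_of_orthogonal hE (k := -1) (by norm_num) (lie_mem_orthogonal hx hz) ?_
  rw [leibniz_lie, hx0, hz1]
  simp

/-- A half structure contains its orthogonal complement for the Killing form: in negative degrees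
the complement vanishes, so in degree `0` it kills the part of `q` of degree `-1`. -/
theorem mem_of_orthogonal (hq : IsHalfStructure E q)
    (hE : ⨆ k : ℤ, (ad ℂ G E).eigenspace (k : ℂ) = ⊤) {x : G}
    (hx : ∀ y ∈ q, killingForm ℂ G y x = 0) : x ∈ q := by
  have h := Submodule.eq_iSup_inf_eigenspace_intCast hE
    ((killingForm ℂ G).orthogonal q.toSubmodule) (fun x hx y hy => by
      have h1 := lie_mem_orthogonal hx hq.mem y hy
      rw [← lie_skew, map_neg, neg_eq_zero] at h1
      exact h1)
  have h1 : (killingForm ℂ G).orthogonal q.toSubmodule ≤ q.toSubmodule := by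
    rw [h]
    refine iSup_le fun k => ?_
    rintro x ⟨hx, hxk⟩
    rw [SetLike.mem_coe, End.mem_eigenspace_iff, ad_apply] at hxk
    rcases lt_trichotomy k 0 with hk | hk | hk
    · rw [hq.eq_zero_of_orthogonal hE hk hx hxk]
      exact q.zero_mem
    · have hx0 : ⁅E, x⁆ = 0 := by rw [hxk, hk]; simp
      refine hq.stab x hx0 fun z hz hz1 => ?_
      rw [hq.lie_eq_zero_of_orthogonal hE hx hx0 hz hz1]
      exact q.zero_mem
    · exact hq.pos k hk x hxk
  exact h1 hx

variable {H : LieSubalgebra ℂ G} [H.IsCartanSubalgebra]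

theorem mem_of_rootSpace {α : H.root} {x y : G} (hx : x ∈ rootSpace H α.1) (hx0 : x ≠ 0)
    (hxq : x ∈ q) (hy : y ∈ rootSpace H α.1) : y ∈ q := by
  obtain ⟨r, hr⟩ := (finrank_eq_one_iff_of_nonzero' (⟨x, hx⟩ : rootSpace H α.1)
    (by simpa using hx0)).1
    (IsKilling.finrank_rootSpace_eq_one α.1 (Finset.mem_filter.1 α.2).2) ⟨y, hy⟩
  have : r • x = y := congrArg Subtype.val hr
  rw [← this]
  exact q.smul_mem r hxq

theorem rootSpace_add_le {α β γ : H.root}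
    (hγ : (IsKilling.rootSystem H).root γ = (IsKilling.rootSystem H).root α +
      (IsKilling.rootSystem H).root β)
    {x y : G} (hx : x ∈ rootSpace H α.1) (hy : y ∈ rootSpace H β.1) :
    ⁅x, y⁆ ∈ rootSpace H γ.1 := by
  have : ((γ.1 : Weight ℂ H G) : H → ℂ) = α.1 + β.1 := by
    ext t
    simpa using LinearMap.congr_fun hγ t
  rw [this]
  exact lie_mem_genWeightSpace_of_mem_genWeightSpace hx hy

theorem lie_ne_zero {α β γ : H.root}
    (hγ : (IsKilling.rootSystem H).root γ = (IsKilling.rootSystem H).root α +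
      (IsKilling.rootSystem H).root β)
    {x y : G} (hx : x ∈ rootSpace H α.1) (hy : y ∈ rootSpace H β.1) (hx0 : x ≠ 0) (hy0 : y ≠ 0) :
    ⁅x, y⁆ ≠ 0 := by
  have : ((γ.1 : Weight ℂ H G) : H → ℂ) = α.1 + β.1 := by
    ext t
    simpa using LinearMap.congr_fun hγ t
  refine IsKilling.lie_ne_zero_of_rootSpace_add_ne_bot (Finset.mem_filter.1 α.2).2
    (Finset.mem_filter.1 β.2).2 ?_ hx hy hx0 hy0
  rw [← this]
  exact γ.1.genWeightSpace_ne_bot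

theorem exists_neg (α : H.root) : ∃ β : H.root,
    (IsKilling.rootSystem H).root β = -(IsKilling.rootSystem H).root α :=
  ⟨(IsKilling.rootSystem H).reflectionPerm α α, by
    rw [RootPairing.root_reflectionPerm, RootPairing.reflection_apply_self]⟩

/-- A root space which is not contained in `q` is opposite to one that is orthogonal to `q`. -/
theorem orthogonal_of_neg (hH : H ≤ q) {α β : H.root}
    (hαβ : (IsKilling.rootSystem H).root β = -(IsKilling.rootSystem H).root α)
    (hα : ¬ ∀ x ∈ rootSpace H α.1, x ∈ q) {y : G} (hy : y ∈ rootSpace H β.1) :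
    ∀ z ∈ q, killingForm ℂ G z y = 0 := by
  let Q : LieSubmodule ℂ H G :=
    { q.toSubmodule with lie_mem := fun {x m} hm => q.lie_mem (hH x.2) hm }
  intro z hz
  have hzQ : z ∈ Q := hz
  rw [LieModule.eq_iSup_inf_genWeightSpace ℂ H G Q] at hzQ
  clear hz
  induction hzQ using LieSubmodule.iSup_induction' with
  | mem χ w hw =>
    obtain ⟨hwq, hwχ⟩ := hw
    by_cases h : (χ : H → ℂ) + β.1 = 0
    · have hχ : χ = α.1 := by
        ext t
        have h1 := congrFun h t
        have h2 := LinearMap.congr_fun hαβ t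
        simp only [IsKilling.rootSystem_root_apply, Pi.add_apply, Pi.zero_apply,
          LinearMap.neg_apply, Weight.toLinear_apply] at h1 h2
        rw [h2] at h1
        exact add_neg_eq_zero.1 h1
      by_cases hw0 : w = 0
      · simp [hw0]
      · exact absurd (fun x hx => mem_of_rootSpace (hχ ▸ hwχ) hw0 hwq hx) hα
    · exact killingForm_apply_eq_zero_of_mem_rootSpace_of_add_ne_zero ℂ G H hwχ hy h
  | zero => simp
  | add z w _ _ h1 h2 => rw [map_add, LinearMap.add_apply, h1, h2, add_zero]

variable (hEH : E ∈ H)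

/-- The evaluation of linear forms on `H` at `t`. For `t = E` it gives the degree of a root. -/
noncomputable def evalAt (t : H) : Dual ℂ H →ₗ[ℂ] ℂ := Dual.eval ℂ H t

theorem lie_of_mem_rootSpace {α : H.root} {x : G} (hx : x ∈ rootSpace H α.1) (t : H) :
    ⁅(t : G), x⁆ = evalAt t ((IsKilling.rootSystem H).root α) • x := by
  have := IsKilling.lie_eq_smul_of_mem_rootSpace hx t
  simpa [evalAt] using this

include hEH in
/-- The part of `q` of degree `-1` is spanned by the root spaces contained in it. -/
theorem mem_of_forall_rootSpace (hH : H ≤ q) (N : Submodule ℂ G)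
    (hN : ∀ γ : H.root, evalAt ⟨E, hEH⟩ ((IsKilling.rootSystem H).root γ) = -1 →
      (∀ x ∈ rootSpace H γ.1, x ∈ q) → ∀ x ∈ rootSpace H γ.1, x ∈ N)
    {z : G} (hz : z ∈ q) (hz1 : ⁅E, z⁆ = -z) : z ∈ N := by
  have hEt : ∀ t ∈ H, ⁅E, t⁆ = 0 := fun t ht => congrArg Subtype.val
    (LieModule.IsTrivial.trivial (⟨E, hEH⟩ : H) (⟨t, ht⟩ : H))
  let Q : LieSubmodule ℂ H G :=
    { q.toSubmodule ⊓ (ad ℂ G E).eigenspace (-1) with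
      lie_mem := fun {x m} hm => by
        refine ⟨q.lie_mem (hH x.2) hm.1, ?_⟩
        have h1 : ⁅E, m⁆ = (-1 : ℂ) • m := End.mem_eigenspace_iff.1 hm.2
        refine End.mem_eigenspace_iff.2 ?_
        rw [ad_apply, LieSubalgebra.coe_bracket_of_module, leibniz_lie, hEt _ x.2, h1, zero_lie,
          zero_add, lie_smul] }
  have hzQ : z ∈ Q := ⟨hz, End.mem_eigenspace_iff.2 (by simpa using hz1)⟩
  rw [LieModule.eq_iSup_inf_genWeightSpace ℂ H G Q] at hzQ
  clear hz hz1
  induction hzQ using LieSubmodule.iSup_induction' with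
  | mem χ w hw =>
    obtain ⟨⟨hwq, hwE⟩, hwχ⟩ := hw
    by_cases hw0 : w = 0
    · rw [hw0]; exact N.zero_mem
    have h1 : ⁅E, w⁆ = (-1 : ℂ) • w := End.mem_eigenspace_iff.1 hwE
    have h2 : ⁅E, w⁆ = χ ⟨E, hEH⟩ • w := IsKilling.lie_eq_smul_of_mem_rootSpace hwχ ⟨E, hEH⟩
    have h3 : χ ⟨E, hEH⟩ = -1 := by
      rw [h1, ← sub_eq_zero, ← sub_smul] at h2
      exact (sub_eq_zero.1 ((smul_eq_zero.1 h2).resolve_right hw0)).symm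
    have h4 : χ ∈ H.root := by
      simp only [LieSubalgebra.root, Finset.mem_filter, Finset.mem_univ, true_and]
      intro h5
      have h6 : χ ⟨E, hEH⟩ = 0 := congrFun h5 _
      rw [h6] at h3
      norm_num at h3
    let γ : H.root := ⟨χ, h4⟩
    have h6 : evalAt ⟨E, hEH⟩ ((IsKilling.rootSystem H).root γ) = -1 := h3
    have hwγ : w ∈ rootSpace H γ.1 := hwχ
    exact hN γ h6 (fun x hx => mem_of_rootSpace (α := γ) hwγ hw0 hwq hx) w hwγ
  | zero => exact N.zero_mem
  | add z w _ _ h1 h2 => exact N.add_mem h1 h2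

end IsHalfStructure

end HalfStructure


/-! ### The bigrading element -/

section BigradingElement

open LieAlgebra LieModule Module

variable {G : Type*} [LieRing G] [LieAlgebra ℂ G] [FiniteDimensional ℂ G] [IsKilling ℂ G]
  {E : G} {q q' : LieSubalgebra ℂ G} {H : LieSubalgebra ℂ G} [H.IsCartanSubalgebra]

/-- The root space of `α` is contained in `q`. -/
def RootSpaceLE (q : LieSubalgebra ℂ G) (α : H.root) : Prop := ∀ x ∈ rootSpace H α.1, x ∈ q

namespace IsHalfStructure

local notation "ρ" => RootPairing.root (IsKilling.rootSystem H)

theorem rootSpaceLE_of_mem {α : H.root} {x : G} (hx : x ∈ rootSpace H α.1) (hx0 : x ≠ 0)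
    (hxq : x ∈ q) : RootSpaceLE q α := fun _ hy => mem_of_rootSpace hx hx0 hxq hy

theorem rootSpaceLE_add {α β γ : H.root} (hγ : ρ γ = ρ α + ρ β) (hα : RootSpaceLE q α)
    (hβ : RootSpaceLE q β) : RootSpaceLE q γ := by
  obtain ⟨x, hx, hx0⟩ := α.1.exists_ne_zero
  obtain ⟨y, hy, hy0⟩ := β.1.exists_ne_zero
  exact rootSpaceLE_of_mem (rootSpace_add_le hγ hx hy) (lie_ne_zero hγ hx hy hx0 hy0)
    (q.lie_mem (hα x hx) (hβ y hy))

/-- If the root space of `β`, of degree `0`, is not contained in `q`, then the opposite root space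
lies in `q` and kills the part of `q` of degree `-1`. -/
theorem not_root_sub (hq : IsHalfStructure E q)
    (hE : ⨆ k : ℤ, (ad ℂ G E).eigenspace (k : ℂ) = ⊤) (hH : H ≤ q) (hEH : E ∈ H)
    {β γ δ : H.root} (hβ0 : evalAt ⟨E, hEH⟩ (ρ β) = 0) (hβ : ¬ RootSpaceLE q β)
    (hγ1 : evalAt ⟨E, hEH⟩ (ρ γ) = -1) (hγ : RootSpaceLE q γ) : ρ γ ≠ ρ δ + ρ β := by
  intro hδ
  obtain ⟨β', hβ'⟩ := exists_neg β
  obtain ⟨x, hx, hx0⟩ := β'.1.exists_ne_zero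
  obtain ⟨y, hy, hy0⟩ := γ.1.exists_ne_zero
  have h0 := lie_of_mem_rootSpace hx ⟨E, hEH⟩
  rw [hβ', map_neg, hβ0, neg_zero, zero_smul] at h0
  have h1 := lie_of_mem_rootSpace hy ⟨E, hEH⟩
  rw [hγ1, neg_one_smul] at h1
  exact lie_ne_zero (γ := δ) (by rw [hβ', hδ]; abel) hx hy hx0 hy0
    (hq.lie_eq_zero_of_orthogonal hE (orthogonal_of_neg hH hβ' hβ hx) h0 (hγ y hy) h1)

/-- If a root `β` of degree `0` does not belong to `q`, then adding it moves some root of degree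
`-1` out of `q`. This is the condition `stab` on the level of roots. -/
theorem exists_root_add (hq : IsHalfStructure E q) (hH : H ≤ q) (hEH : E ∈ H)
    {β : H.root} (hβ0 : evalAt ⟨E, hEH⟩ (ρ β) = 0) (hβ : ¬ RootSpaceLE q β) :
    ∃ γ δ : H.root, evalAt ⟨E, hEH⟩ (ρ γ) = -1 ∧ RootSpaceLE q γ ∧ ρ δ = ρ γ + ρ β ∧
      ¬ RootSpaceLE q δ := by
  by_contra! hcon
  refine hβ fun x hx => hq.stab x ?_ fun z hz hz1 => ?_
  · have h0 := lie_of_mem_rootSpace hx ⟨E, hEH⟩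
    rwa [hβ0, zero_smul] at h0
  refine mem_of_forall_rootSpace hEH hH (q.toSubmodule.comap (ad ℂ G x)) ?_ hz hz1
  intro γ hγ1 hγ y hy
  change ⁅x, y⁆ ∈ q
  by_cases hxy : ⁅x, y⁆ = 0
  · rw [hxy]; exact q.zero_mem
  have hmem : ⁅x, y⁆ ∈ rootSpace H ((β.1 : H → ℂ) + γ.1) :=
    lie_mem_genWeightSpace_of_mem_genWeightSpace hx hy
  let χ : Weight ℂ H G := ⟨(β.1 : H → ℂ) + γ.1, fun h => by
    have h' : rootSpace H ((β.1 : H → ℂ) + γ.1) = ⊥ := h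
    rw [h'] at hmem
    exact hxy ((LieSubmodule.mem_bot _).1 hmem)⟩
  have hχ : χ ∈ H.root := by
    simp only [LieSubalgebra.root, Finset.mem_filter, Finset.mem_univ, true_and]
    intro h5
    have h6 : (β.1 : H → ℂ) ⟨E, hEH⟩ + γ.1 ⟨E, hEH⟩ = 0 := congrFun h5 _
    have h7 : β.1 ⟨E, hEH⟩ = 0 := hβ0
    have h8 : γ.1 ⟨E, hEH⟩ = -1 := hγ1
    rw [h7, h8] at h6
    norm_num at h6
  let δ : H.root := ⟨χ, hχ⟩
  have hδ : ρ δ = ρ γ + ρ β := by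
    rw [add_comm]
    ext t
    rfl
  exact hcon γ δ hγ1 hγ hδ _ hmem

/-- If a root space is contained in `q + q'`, then it is contained in `q` or in `q'`: otherwise the
opposite root space would be orthogonal to both. -/
theorem rootSpaceLE_or (hH : H ≤ q) (hH' : H ≤ q') {α : H.root}
    (hα : ∀ x ∈ rootSpace H α.1, ∃ a ∈ q, ∃ b ∈ q', x = a + b) :
    RootSpaceLE q α ∨ RootSpaceLE q' α := by
  by_contra! h
  obtain ⟨x, hx, hx0⟩ := α.1.exists_ne_zero
  obtain ⟨a, ha, b, hb, hab⟩ := hα x hx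
  obtain ⟨α', hα'⟩ := exists_neg α
  refine hx0 ((IsKilling.killingForm_nondegenerate ℂ G).1 x fun y => ?_)
  have hy : y ∈ ⨆ χ : Weight ℂ H G, rootSpace H χ := by
    rw [iSup_genWeightSpace_eq_top' ℂ H G]; exact LieSubmodule.mem_top y
  induction hy using LieSubmodule.iSup_induction' with
  | mem χ y hy =>
    by_cases hχ : (α.1 : H → ℂ) + χ = 0
    · have hχ' : (χ : H → ℂ) = α'.1 := by
        ext t
        have h1 := congrFun hχ t
        have h2 : α'.1 t = - α.1 t := LinearMap.congr_fun hα' t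
        rw [h2]
        exact eq_neg_of_add_eq_zero_right h1
      rw [hχ'] at hy
      rw [hab, map_add, LinearMap.add_apply, orthogonal_of_neg hH hα' h.1 hy a ha,
        orthogonal_of_neg hH' hα' h.2 hy b hb, add_zero]
    · exact killingForm_apply_eq_zero_of_mem_rootSpace_of_add_ne_zero ℂ G H hx hy hχ
  | zero => simp
  | add z w _ _ h1 h2 => rw [map_add, h1, h2, add_zero]

/-- If the root `β` of degree `0` belongs to `q` but not to `q'`, then its strings in degree `-1`
have two elements, of which the first belongs to `q'` and the second to `q`. -/
theorem string_of_not_rootSpaceLE (hq : IsHalfStructure E q) (hq' : IsHalfStructure E q')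
    (hE : ⨆ k : ℤ, (ad ℂ G E).eigenspace (k : ℂ) = ⊤) (hH : H ≤ q) (hH' : H ≤ q')
    (hEH : E ∈ H)
    (hor : ∀ γ : H.root, evalAt ⟨E, hEH⟩ (ρ γ) = -1 → RootSpaceLE q γ ∨ RootSpaceLE q' γ)
    (hand : ∀ γ : H.root, evalAt ⟨E, hEH⟩ (ρ γ) = -1 → RootSpaceLE q γ → ¬ RootSpaceLE q' γ)
    {β γ γ' : H.root} (hβ0 : evalAt ⟨E, hEH⟩ (ρ β) = 0)
    (hβ' : ¬ RootSpaceLE q' β) (hγ1 : evalAt ⟨E, hEH⟩ (ρ γ) = -1) (hγ' : ρ γ' = ρ γ + ρ β) :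
    ¬ RootSpaceLE q γ ∧ RootSpaceLE q γ' := by
  have hγ'1 : evalAt ⟨E, hEH⟩ (ρ γ') = -1 := by rw [hγ', map_add, hγ1, hβ0, add_zero]
  constructor
  · intro hγ
    obtain ⟨β₁, hβ₁⟩ := exists_neg β
    by_cases hβ₁q : RootSpaceLE q β₁
    · obtain ⟨γ₁, δ₁, h1, h2, h3, h4⟩ := hq'.exists_root_add hH' hEH hβ0 hβ'
      have hδ1 : evalAt ⟨E, hEH⟩ (ρ δ₁) = -1 := by rw [h3, map_add, h1, hβ0, add_zero]
      have hδq := (hor δ₁ hδ1).resolve_right h4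
      have h5 : ρ γ₁ = ρ δ₁ + ρ β₁ := by rw [h3, hβ₁]; abel
      exact hand γ₁ h1 (rootSpaceLE_add h5 hδq hβ₁q) h2
    · exact hq.not_root_sub hE hH hEH (δ := γ') (by rw [hβ₁, map_neg, hβ0, neg_zero]) hβ₁q hγ1 hγ
        (by rw [hγ', hβ₁]; abel)
  · refine (hor γ' hγ'1).resolve_right fun h => ?_
    exact hq'.not_root_sub hE hH' hEH hβ0 hβ' hγ'1 h hγ'

/-- Two complementary half structures with the same grading element are the eigenspaces in degree
`-1` of an element of the algebra. -/
theorem exists_lie_eq (hq : IsHalfStructure E q) (hq' : IsHalfStructure E q')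
    (hE : ⨆ k : ℤ, (ad ℂ G E).eigenspace (k : ℂ) = ⊤)
    (hsup0 : ∀ x, ⁅E, x⁆ = 0 → ∃ a ∈ q, ∃ b ∈ q', x = a + b)
    (hsup1 : ∀ x, ⁅E, x⁆ = -x → ∃ a ∈ q, ∃ b ∈ q', x = a + b)
    (hinf : ∀ x ∈ q, x ∈ q' → ⁅E, x⁆ = -x → x = 0) :
    ∃ e : G, (∀ x ∈ q, ⁅E, x⁆ = -x → ⁅e, x⁆ = 0) ∧ ∀ x ∈ q', ⁅E, x⁆ = -x → ⁅e, x⁆ = -x := by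
  classical
  have hss : (ad ℂ G E).IsSemisimple := isSemisimple_of_iSup_eigenspace_eq_top _
    (eq_top_iff.2 (hE.ge.trans
      (iSup_le fun k => le_iSup (fun μ => (ad ℂ G E).eigenspace μ) (k : ℂ))))
  obtain ⟨H, hHC, hH, hH', hEH⟩ := exists_isCartanSubalgebra_le_inf q q'
    (fun y hy => hq.mem_of_normalizes hE hy) (fun y hy => hq'.mem_of_normalizes hE hy)
    (fun y hy => hq.mem_of_orthogonal hE hy) (fun y hy => hq'.mem_of_orthogonal hE hy)
    hss hq.mem hq'.mem
  let r := (IsKilling.rootSystem H).root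
  have hor0 : ∀ γ : H.root, evalAt ⟨E, hEH⟩ (r γ) = 0 →
      RootSpaceLE q γ ∨ RootSpaceLE q' γ := fun γ h => rootSpaceLE_or hH hH' fun x hx =>
    hsup0 x (by have := lie_of_mem_rootSpace hx ⟨E, hEH⟩; rwa [h, zero_smul] at this)
  have hor : ∀ γ : H.root, evalAt ⟨E, hEH⟩ (r γ) = -1 →
      RootSpaceLE q γ ∨ RootSpaceLE q' γ := fun γ h => rootSpaceLE_or hH hH' fun x hx =>
    hsup1 x (by have := lie_of_mem_rootSpace hx ⟨E, hEH⟩; rwa [h, neg_one_smul] at this)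
  have hand : ∀ γ : H.root, evalAt ⟨E, hEH⟩ (r γ) = -1 → RootSpaceLE q γ →
      ¬ RootSpaceLE q' γ := by
    intro γ h h1 h2
    obtain ⟨x, hx, hx0⟩ := γ.1.exists_ne_zero
    have := lie_of_mem_rootSpace hx ⟨E, hEH⟩
    rw [h, neg_one_smul] at this
    exact hx0 (hinf x (h1 x hx) (h2 x hx) this)
  -- the eigenvalue to be realized on the root spaces of degree `-1`: along the strings of a root of
  -- degree `0` it changes by a constant, so it is given by an element `t` of `H`
  let f : H.root → ℝ := fun γ => if RootSpaceLE q γ then 0 else -1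
  obtain ⟨a, ha⟩ := (IsKilling.rootSystem H).exists_eq_sum_mul_pairingIn (evalAt ⟨E, hEH⟩) f (by
    intro β hβ0
    by_cases hβ : RootSpaceLE q β
    · by_cases hβ' : RootSpaceLE q' β
      · refine ⟨0, fun γ γ' h1 h2 => ?_⟩
        have h3 : evalAt ⟨E, hEH⟩ (r γ') = -1 := by rw [h2, map_add, h1, hβ0, add_zero]
        have : RootSpaceLE q γ' ↔ RootSpaceLE q γ := by
          refine ⟨fun h => by_contra fun hn => ?_, fun h => rootSpaceLE_add h2 h hβ⟩
          exact hand γ' h3 h (rootSpaceLE_add h2 ((hor γ h1).resolve_left hn) hβ')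
        simp only [f, this, add_zero]
      · refine ⟨1, fun γ γ' h1 h2 => ?_⟩
        obtain ⟨h3, h4⟩ := string_of_not_rootSpaceLE hq hq' hE hH hH' hEH hor hand hβ0 hβ' h1 h2
        simp [f, h3, h4]
    · refine ⟨-1, fun γ γ' h1 h2 => ?_⟩
      obtain ⟨h3, h4⟩ := string_of_not_rootSpaceLE hq' hq hE hH' hH hEH
        (fun γ h => (hor γ h).symm) (fun γ h h' h'' => hand γ h h'' h') hβ0 hβ h1 h2
      have h5 := (hor γ h1).resolve_right h3
      have h6 : ¬ RootSpaceLE q γ' := fun h => hand γ'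
        (by rw [h2, map_add, h1, hβ0, add_zero]) h h4
      simp [f, h5, h6])
  let t : H := ∑ k, (a k : ℂ) • (IsKilling.rootSystem H).coroot k
  have ht : ∀ γ : H.root, evalAt ⟨E, hEH⟩ (r γ) = -1 → ∀ x ∈ rootSpace H γ.1,
      ⁅(t : G), x⁆ = (f γ : ℂ) • x := by
    intro γ h x hx
    rw [lie_of_mem_rootSpace hx t]
    congr 1
    rw [ha γ h]
    change (IsKilling.rootSystem H).toLinearMap (r γ) t = _
    simp only [t]
    rw [map_sum, Complex.ofReal_sum]
    refine Finset.sum_congr rfl fun k _ => ?_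
    rw [map_smul, RootPairing.root_coroot_eq_pairing,
      ← (IsKilling.rootSystem H).algebraMap_pairingIn ℤ]
    simp
  refine ⟨t, fun x hx hx1 => ?_, fun x hx hx1 => ?_⟩
  · refine mem_of_forall_rootSpace hEH hH (LinearMap.ker (ad ℂ G t)) (fun γ h hγ y hy => ?_) hx hx1
    change ⁅(t : G), y⁆ = 0
    have hf : f γ = 0 := if_pos hγ
    rw [ht γ h y hy, hf]
    simp
  · have : x ∈ (ad ℂ G t).eigenspace (-1) := by
      refine mem_of_forall_rootSpace hEH hH' _ (fun γ h hγ y hy => ?_) hx hx1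
      have hf : f γ = -1 := if_neg fun h' => hand γ h h' hγ
      rw [End.mem_eigenspace_iff, ad_apply, ht γ h y hy, hf]
      simp
    simpa using End.mem_eigenspace_iff.1 this

end IsHalfStructure

end BigradingElement


/-! ### The filtration of a homogeneous CR geometry -/

section Filtration

/-- The filtration of a Lie algebra in degrees `i : ℤ`, together with a splitting: `pr i` projects
to a complement of `F (i + 1)` in `F i`. -/
structure SplitFiltration (g : Type*) [LieRing g] [LieAlgebra ℝ g] where
  F : ℤ → Submodule ℝ g
  antitone : Antitone F
  lie_mem : ∀ {i j : ℤ} {x y : g}, x ∈ F i → y ∈ F j → ⁅x, y⁆ ∈ F (i + j)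
  pr : ℤ → g →ₗ[ℝ] g
  range : Finset ℤ
  sum_pr : ∀ x, ∑ i ∈ range, pr i x = x
  pr_mem : ∀ i x, pr i x ∈ F i
  pr_pr : ∀ i j x, pr i (pr j x) = if i = j then pr j x else 0
  pr_eq_zero : ∀ {i k : ℤ} {x : g}, x ∈ F k → i < k → pr i x = 0

/-- A finite filtration of a vector space splits. -/
theorem exists_splitting {V : Type*} [AddCommGroup V] [Module ℝ V]
    (F : ℤ → Submodule ℝ V) (hF : Antitone F) (m n : ℕ) (hm : F (-m) = ⊤) (hn : F n = ⊥) :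
    ∃ (pr : ℤ → V →ₗ[ℝ] V) (r : Finset ℤ), (∀ x, ∑ i ∈ r, pr i x = x) ∧
      (∀ i x, pr i x ∈ F i) ∧ (∀ i j x, pr i (pr j x) = if i = j then pr j x else 0) ∧
      ∀ i k x, x ∈ F k → i < k → pr i x = 0 := by
  have hproj : ∀ i, ∃ P : V →ₗ[ℝ] V, (∀ x, P x ∈ F i) ∧ ∀ x ∈ F i, P x = x := by
    intro i
    obtain ⟨W, hW⟩ := (F i).exists_isCompl
    refine ⟨(F i).subtype ∘ₗ (F i).projectionOnto W hW, fun x => Subtype.coe_prop _, ?_⟩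
    intro x hx
    exact congrArg Subtype.val (Submodule.projectionOnto_apply_left hW ⟨x, hx⟩)
  choose P hP1 hP2 using hproj
  -- a decreasing sequence of commuting projections to the spaces of the filtration
  let q : ℕ → V →ₗ[ℝ] V := Nat.rec LinearMap.id fun k q => P (k + 1 - m) ∘ₗ q
  have hq0 : q 0 = LinearMap.id := rfl
  have hqs : ∀ k x, q (k + 1) x = P (k + 1 - m) (q k x) := fun _ _ => rfl
  have hq1 : ∀ (k : ℕ) x, q k x ∈ F (k - m) := by
    intro k x
    cases k with
    | zero => simp [hm]
    | succ k =>
      rw [hqs]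
      have := hP1 (k + 1 - m) (q k x)
      simpa using this
  have hq2 : ∀ k : ℕ, ∀ x ∈ F (k - m), q k x = x := by
    intro k
    induction k with
    | zero => intro x _; rfl
    | succ k ih =>
      intro x hx
      push_cast at hx
      rw [hqs, ih x (hF (by linarith) hx), hP2 _ x hx]
  have hq3 : ∀ j k, j ≤ k → ∀ x, q k (q j x) = q k x := by
    intro j k hjk
    induction hjk with
    | refl => intro x; exact hq2 j _ (hq1 j x)
    | step _ ih => intro x; rw [hqs, ih, hqs]
  have hq4 : ∀ j k, j ≤ k → ∀ x, q j (q k x) = q k x := fun j k hjk x =>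
    hq2 j _ (hF (by omega) (hq1 k x))
  let Q : ℤ → V →ₗ[ℝ] V := fun i => q (i + m).toNat
  have hQ1 : ∀ i x, Q i x ∈ F i := by
    intro i x
    rcases le_total (-(m : ℤ)) i with h | h
    · have := hq1 (i + m).toNat x
      rwa [show ((i + m).toNat : ℤ) - m = i by omega] at this
    · have h1 : F i = ⊤ := eq_top_iff.2 (hm ▸ hF h)
      rw [h1]
      exact Submodule.mem_top
  have hQ2 : ∀ i k, i ≤ k → ∀ x ∈ F k, Q i x = x := by
    intro i k hik x hx
    rcases le_total (-(m : ℤ)) i with h | h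
    · exact hq2 _ x (hF (by omega) hx)
    · have : (i + m).toNat = 0 := by omega
      simp only [Q, this, hq0, LinearMap.id_apply]
  have hQ3 : ∀ i j x, Q i (Q j x) = Q (max i j) x := by
    intro i j x
    rcases le_total i j with h | h
    · rw [max_eq_right h]; exact hq4 _ _ (by omega) x
    · rw [max_eq_left h]; exact hq3 _ _ (by omega) x
  refine ⟨fun i => Q i - Q (i + 1), Finset.Ico (-m : ℤ) n, ?_, ?_, ?_, ?_⟩
  · intro x
    have h1 : ∀ k : ℕ, ∑ i ∈ Finset.Ico (-m : ℤ) (-m + k), (Q i - Q (i + 1)) x =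
        x - Q (-m + k) x := by
      intro k
      induction k with
      | zero =>
        simp [hQ2 (-m) (-m) le_rfl x (hm ▸ Submodule.mem_top)]
      | succ k ih =>
        have h2 : Finset.Ico (-m : ℤ) (-m + (k + 1 : ℕ)) =
            insert (-m + k : ℤ) (Finset.Ico (-m : ℤ) (-m + k)) := by
          ext a
          simp only [Finset.mem_Ico, Finset.mem_insert]
          omega
        rw [h2, Finset.sum_insert (by simp), ih, LinearMap.sub_apply]
        push_cast
        rw [← add_assoc]
        abel
    have h2 := h1 (m + n)
    rw [show (-m + (m + n : ℕ) : ℤ) = n by omega] at h2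
    rw [h2, (Submodule.eq_bot_iff _).1 hn _ (hQ1 n x), sub_zero]
  · intro i x
    exact sub_mem (hQ1 i x) (hF (by omega) (hQ1 (i + 1) x))
  · intro i j x
    simp only [LinearMap.sub_apply, map_sub, hQ3]
    rcases lt_trichotomy i j with h | h | h
    · rw [if_neg h.ne, max_eq_right (by omega), max_eq_right (by omega), max_eq_right (by omega),
        max_eq_right (by omega)]
      abel
    · subst h
      rw [if_pos rfl, max_self, max_self, max_eq_right (show i ≤ i + 1 by omega),
        max_eq_left (show i ≤ i + 1 by omega)]
      abel
    · rw [if_neg h.ne', max_eq_left (by omega), max_eq_left (by omega), max_eq_left (by omega),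
        max_eq_left (by omega)]
      abel
  · intro i k x hx hik
    rw [LinearMap.sub_apply, hQ2 i k hik.le x hx, hQ2 (i + 1) k (by omega) x hx, sub_self]

namespace HomogeneousCR

variable {g : Type*} [LieRing g] [LieAlgebra ℝ g] (C : HomogeneousCR g)

theorem h_le_leviKernel : C.h.toSubmodule ≤ C.leviKernel :=
  fun x hx => ⟨C.h_le hx, fun y hy => C.isotropy_lie_mem x hx y hy⟩

theorem exists_J_add {y : g} (hy : y ∈ C.D) : ∃ z ∈ C.D, ∃ u ∈ C.h, y = C.J z + u :=
  ⟨-C.J y, C.D.neg_mem (C.J_mem y hy), C.J (C.J y) + y, C.J_sq y hy, by rw [map_neg]; abel⟩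

/-- By the compatibility of `J` with the Levi bracket, the Levi kernel is a complex subspace. -/
theorem J_mem_leviKernel {x : g} (hx : x ∈ C.leviKernel) : C.J x ∈ C.leviKernel := by
  refine ⟨C.J_mem x hx.1, fun y hy => ?_⟩
  obtain ⟨z, hz, u, hu, rfl⟩ := C.exists_J_add hy
  rw [lie_add]
  refine C.D.add_mem ?_ ?_
  · have := C.D.add_mem (C.levi x hx.1 z hz) (hx.2 z hz)
    rwa [sub_add_cancel] at this
  · rw [← lie_skew]
    exact C.D.neg_mem (C.isotropy_lie_mem u hu _ (C.J_mem x hx.1))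

theorem leviKernel_lie_mem {x y : g} (hx : x ∈ C.leviKernel) (hy : y ∈ C.leviKernel) :
    ⁅x, y⁆ ∈ C.leviKernel := by
  refine ⟨hx.2 y hy.1, fun d hd => ?_⟩
  rw [lie_lie]
  exact C.D.sub_mem (hx.2 _ (hy.2 d hd)) (hy.2 _ (hx.2 d hd))

/-- The prolongation of the filtration to nonnegative degrees. -/
def posFilt (C : HomogeneousCR g) : ℕ → Submodule ℝ g
  | 0 => C.leviKernel
  | (k + 1) =>
    { carrier := {x | x ∈ C.posFilt k ∧ ∀ y ∈ C.D, ⁅x, y⁆ ∈ C.posFilt k}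
      add_mem' := fun ha hb => ⟨add_mem ha.1 hb.1, fun y hy => by
        rw [add_lie]; exact add_mem (ha.2 y hy) (hb.2 y hy)⟩
      zero_mem' := ⟨zero_mem _, fun y _ => by rw [zero_lie]; exact zero_mem _⟩
      smul_mem' := fun c x hx => ⟨Submodule.smul_mem _ c hx.1, fun y hy => by
        rw [smul_lie]; exact Submodule.smul_mem _ c (hx.2 y hy)⟩ }

/-- The filtration `F^i`, `i : ℤ`, that extends `F^{-k} = filt k`. -/
def fil : ℤ → Submodule ℝ g
  | Int.ofNat k => C.posFilt k
  | Int.negSucc k => C.filt (k + 1)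

theorem fil_neg (k : ℕ) : C.fil (-k) = C.filt k := by
  cases k with
  | zero => rfl
  | succ k => rfl

theorem fil_zero : C.fil 0 = C.leviKernel := rfl

theorem fil_neg_one : C.fil (-1) = C.D := rfl

theorem mem_fil_succ {i : ℤ} (hi : -1 ≤ i) {x : g} :
    x ∈ C.fil (i + 1) ↔ x ∈ C.fil i ∧ ∀ y ∈ C.D, ⁅x, y⁆ ∈ C.fil i := by
  obtain rfl | h := eq_or_lt_of_le hi
  · exact Iff.rfl
  · obtain ⟨k, rfl⟩ := Int.eq_ofNat_of_zero_le (by omega : 0 ≤ i)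
    exact Iff.rfl

theorem fil_antitone : Antitone C.fil := by
  refine antitone_int_of_succ_le fun i => ?_
  rcases le_or_gt (-1) i with h | h
  · exact fun x hx => ((C.mem_fil_succ h).1 hx).1
  · obtain ⟨k, rfl⟩ : ∃ k : ℕ, i = -((k + 2 : ℕ) : ℤ) := ⟨(-i).toNat - 2, by omega⟩
    rw [show -((k + 2 : ℕ) : ℤ) + 1 = -((k + 1 : ℕ) : ℤ) by push_cast; ring, fil_neg, fil_neg]
    exact le_sup_left

theorem lie_D_mem_fil (i : ℤ) {x y : g} (hx : x ∈ C.fil i) (hy : y ∈ C.D) :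
    ⁅x, y⁆ ∈ C.fil (i - 1) := by
  rcases le_or_gt 0 i with h | h
  · exact ((C.mem_fil_succ (i := i - 1) (by omega)).1 (by simpa using hx)).2 y hy
  · obtain ⟨k, rfl⟩ : ∃ k : ℕ, i = -((k + 1 : ℕ) : ℤ) := ⟨(-i).toNat - 1, by omega⟩
    rw [show -((k + 1 : ℕ) : ℤ) - 1 = -((k + 2 : ℕ) : ℤ) by push_cast; ring, fil_neg]
    rw [fil_neg] at hx
    refine Submodule.mem_sup_right ?_
    rw [← lie_skew]
    exact Submodule.neg_mem _ (Submodule.subset_span ⟨y, hy, x, hx, rfl⟩)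

theorem lie_filt_mem_fil (k : ℕ) : ∀ (i : ℤ) {x y : g}, x ∈ C.fil i → y ∈ C.filt (k + 1) →
    ⁅x, y⁆ ∈ C.fil (i - (k + 1)) := by
  induction k with
  | zero => intro i x y hx hy; simpa using C.lie_D_mem_fil i hx hy
  | succ k ih =>
    intro i x y hx hy
    push_cast
    obtain ⟨a, ha, b, hb, rfl⟩ := Submodule.mem_sup.1 hy
    rw [lie_add]
    refine add_mem (C.fil_antitone (by omega) (ih i hx ha)) ?_
    clear hy
    induction hb using Submodule.span_induction with
    | mem z hz =>
      obtain ⟨d, hd, w, hw, rfl⟩ := hz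
      rw [leibniz_lie]
      refine add_mem ?_ ?_
      · have := ih (i - 1) (C.lie_D_mem_fil i hx hd) hw
        rwa [show i - 1 - (k + 1 : ℤ) = i - (k + 1 + 1) by ring] at this
      · rw [← lie_skew]
        have := C.lie_D_mem_fil _ (ih i hx hw) hd
        rw [show i - (k + 1 : ℤ) - 1 = i - (k + 1 + 1) by ring] at this
        exact neg_mem this
    | zero => rw [lie_zero]; exact zero_mem _
    | add _ _ _ _ h1 h2 => rw [lie_add]; exact add_mem h1 h2
    | smul c _ _ h1 => rw [lie_smul]; exact Submodule.smul_mem _ c h1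

theorem lie_mem_fil_of_nonneg (n : ℕ) : ∀ {i j : ℤ} {x y : g}, 0 ≤ i → 0 ≤ j → i + j = n →
    x ∈ C.fil i → y ∈ C.fil j → ⁅x, y⁆ ∈ C.fil (i + j) := by
  induction n with
  | zero =>
    intro i j x y hi hj hn hx hy
    obtain rfl : i = 0 := by omega
    obtain rfl : j = 0 := by omega
    exact C.leviKernel_lie_mem hx hy
  | succ n ih =>
    have key : ∀ {i j : ℤ} {x y : g}, 0 ≤ i → 0 ≤ j → i + j = n + 1 →
        x ∈ C.fil i → y ∈ C.fil j → ∀ d ∈ C.D, ⁅x, ⁅y, d⁆⁆ ∈ C.fil n := by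
      intro i j x y hi hj hn hx hy d hd
      have h1 := C.lie_D_mem_fil j hy hd
      rcases eq_or_lt_of_le hj with rfl | h
      · have := C.lie_D_mem_fil i hx h1
        rwa [show i - 1 = (n : ℤ) by omega] at this
      · have := ih hi (by omega) (by omega) hx h1
        rwa [show i + (j - 1) = (n : ℤ) by omega] at this
    have key2 : ∀ {i j : ℤ} {x y : g}, 0 < i → 0 ≤ j → i + j = n + 1 →
        x ∈ C.fil i → y ∈ C.fil j → ⁅x, y⁆ ∈ C.fil n := by
      intro i j x y hi hj hn hx hy
      have := ih (i := i - 1) (by omega) hj (by omega) (C.fil_antitone (by omega) hx) hy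
      rwa [show i - 1 + j = (n : ℤ) by omega] at this
    intro i j x y hi hj hn hx hy
    push_cast at hn
    rw [hn, C.mem_fil_succ (by omega)]
    refine ⟨?_, fun d hd => ?_⟩
    · rcases eq_or_lt_of_le hi with h | h
      · rw [← lie_skew]
        exact neg_mem (key2 (by omega) hi (by omega) hy hx)
      · exact key2 h hj hn hx hy
    · rw [lie_lie]
      exact sub_mem (key hi hj hn hx hy d hd) (key hj hi (by omega) hy hx d hd)

theorem lie_mem_fil {i j : ℤ} {x y : g} (hx : x ∈ C.fil i) (hy : y ∈ C.fil j) :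
    ⁅x, y⁆ ∈ C.fil (i + j) := by
  have key : ∀ {i j : ℤ} {x y : g}, j < 0 → x ∈ C.fil i → y ∈ C.fil j →
      ⁅x, y⁆ ∈ C.fil (i + j) := by
    intro i j x y hj hx hy
    obtain ⟨k, rfl⟩ : ∃ k : ℕ, j = -((k + 1 : ℕ) : ℤ) := ⟨(-j).toNat - 1, by omega⟩
    rw [fil_neg] at hy
    exact C.lie_filt_mem_fil k i hx hy
  rcases lt_or_ge j 0 with h | h
  · exact key h hx hy
  rcases lt_or_ge i 0 with h' | h'
  · rw [← lie_skew, add_comm]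
    exact neg_mem (key h' hy hx)
  · exact C.lie_mem_fil_of_nonneg (i + j).toNat h' h (by omega) hx hy

variable {C} (hC : C.IsTwoNondegenerate)

include hC in
/-- An element of `F^1` maps `D` to the Levi kernel, so its antilinear bracket vanishes, and by
2-nondegeneracy it belongs to the isotropy. -/
theorem IsTwoNondegenerate.fil_one_le : C.fil 1 ≤ C.h.toSubmodule := by
  intro x hx
  have h := (C.mem_fil_succ (i := 0) (by omega)).1 hx
  refine hC.2 x h.1 fun y hy => ?_
  exact add_mem (h.2 y hy) (C.J_mem_leviKernel (h.2 _ (C.J_mem y hy)))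

/-- A subspace of `h` which is stable under `ad D` is an ideal, because `D` generates `g`. -/
theorem IsTwoNondegenerate.eq_bot_of_lie_D_mem (hC : C.IsTwoNondegenerate) {W : Submodule ℝ g}
    (hW : W ≤ C.h.toSubmodule) (h : ∀ x ∈ W, ∀ y ∈ C.D, ⁅x, y⁆ ∈ W) : W = ⊥ := by
  have key : ∀ k : ℕ, ∀ y ∈ C.filt (k + 1), ∀ x ∈ W, ⁅x, y⁆ ∈ W := by
    intro k
    induction k with
    | zero => intro y hy x hx; exact h x hx y hy
    | succ k ih =>
      intro y hy x hx
      obtain ⟨a, ha, b, hb, rfl⟩ := Submodule.mem_sup.1 hy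
      rw [lie_add]
      refine add_mem (ih a ha x hx) ?_
      clear hy
      induction hb using Submodule.span_induction with
      | mem z hz =>
        obtain ⟨d, hd, w, hw, rfl⟩ := hz
        rw [leibniz_lie]
        refine add_mem (ih w hw _ (h x hx d hd)) ?_
        rw [← lie_skew]
        exact neg_mem (h _ (ih w hw x hx) d hd)
      | zero => rw [lie_zero]; exact zero_mem _
      | add _ _ _ _ h1 h2 => rw [lie_add]; exact add_mem h1 h2
      | smul c _ _ h1 => rw [lie_smul]; exact Submodule.smul_mem _ c h1
  obtain ⟨k, hk⟩ := hC.1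
  have hk' : C.filt (k + 1) = ⊤ := by
    refine eq_top_iff.2 (hk ▸ ?_)
    have := C.fil_antitone (show -((k + 1 : ℕ) : ℤ) ≤ -(k : ℤ) by omega)
    rwa [fil_neg, fil_neg] at this
  let I : LieIdeal ℝ g :=
    { W with
      lie_mem := fun {x m} hm => by
        rw [← lie_skew]
        exact W.neg_mem (key k x (hk' ▸ Submodule.mem_top) m hm) }
  have hI : I = ⊥ := C.effective I hW
  have : I.toSubmodule = ⊥ := by rw [hI]; rfl
  exact this

/-- The filtration ends, because its stable term is an ideal contained in the isotropy. -/
theorem IsTwoNondegenerate.exists_fil_eq_bot [FiniteDimensional ℝ g]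
    (hC : C.IsTwoNondegenerate) : ∃ n : ℕ, C.fil n = ⊥ := by
  obtain ⟨n, hn⟩ := IsArtinian.monotone_stabilizes (R := ℝ) (M := g)
    ⟨fun n : ℕ => OrderDual.toDual (C.fil (n + 1)), fun a b hab =>
      C.fil_antitone (by omega)⟩
  refine ⟨n + 1, hC.eq_bot_of_lie_D_mem ?_ fun x hx y hy => ?_⟩
  · exact (C.fil_antitone (by omega)).trans hC.fil_one_le
  · have h1 := hn (n + 1) (by omega)
    have h2 : C.fil (n + 1 : ℤ) = C.fil (n + 1 + 1 : ℤ) := h1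
    push_cast at hx ⊢
    rw [h2] at hx
    exact ((C.mem_fil_succ (by omega)).1 hx).2 y hy

theorem IsTwoNondegenerate.exists_splitFiltration [FiniteDimensional ℝ g]
    (hC : C.IsTwoNondegenerate) : ∃ s : SplitFiltration g, s.F = C.fil := by
  obtain ⟨m, hm⟩ := hC.1
  obtain ⟨n, hn⟩ := hC.exists_fil_eq_bot
  obtain ⟨pr, r, h1, h2, h3, h4⟩ := exists_splitting C.fil C.fil_antitone m n
    (by rw [fil_neg, hm]) hn
  exact ⟨⟨C.fil, C.fil_antitone, C.lie_mem_fil, pr, r, h1, h2, h3, h4 _ _ _⟩, rfl⟩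

end HomogeneousCR

end Filtration


/-! ### The associated graded Lie algebra and its extension by the grading derivation -/

namespace SplitFiltration

variable {g : Type*} [LieRing g] [LieAlgebra ℝ g] (s : SplitFiltration g)

theorem pr_eq_zero_of_notMem {i : ℤ} (hi : i ∉ s.range) (x : g) : s.pr i x = 0 := by
  conv_lhs => rw [← s.sum_pr x]
  rw [map_sum]
  refine Finset.sum_eq_zero fun j hj => ?_
  rw [s.pr_pr, if_neg (by rintro rfl; exact hi hj)]

theorem mem_F_of_forall {k : ℤ} {x : g} (h : ∀ i < k, s.pr i x = 0) : x ∈ s.F k := by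
  rw [← s.sum_pr x]
  refine sum_mem fun i _ => ?_
  rcases lt_or_ge i k with hi | hi
  · rw [h i hi]; exact zero_mem _
  · exact s.antitone hi (s.pr_mem i x)

theorem sub_pr_mem {k : ℤ} {x : g} (hx : x ∈ s.F k) : x - s.pr k x ∈ s.F (k + 1) := by
  refine s.mem_F_of_forall fun i hi => ?_
  rw [map_sub, s.pr_pr]
  split_ifs with h
  · rw [h, sub_self]
  · rw [s.pr_eq_zero hx (by omega), sub_zero]

theorem pr_eq_of_sub_mem {k : ℤ} {x y : g} (h : x - y ∈ s.F (k + 1)) : s.pr k x = s.pr k y := by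
  rw [← sub_eq_zero, ← map_sub]
  exact s.pr_eq_zero h (by omega)

/-- The bracket of the associated graded Lie algebra, transported to the Lie algebra itself. -/
def grBracket : g →ₗ[ℝ] g →ₗ[ℝ] g :=
  ∑ i ∈ s.range, ∑ j ∈ s.range,
    ((LieModule.toEnd ℝ g g : g →ₗ[ℝ] Module.End ℝ g).compl₁₂ (s.pr i) (s.pr j)).compr₂
      (s.pr (i + j))

theorem grBracket_apply (x y : g) : s.grBracket x y =
    ∑ i ∈ s.range, ∑ j ∈ s.range, s.pr (i + j) ⁅s.pr i x, s.pr j y⁆ := by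
  simp [grBracket, LinearMap.sum_apply]

theorem grBracket_pr_pr (i j : ℤ) (x y : g) :
    s.grBracket (s.pr i x) (s.pr j y) = s.pr (i + j) ⁅s.pr i x, s.pr j y⁆ := by
  rw [grBracket_apply]
  simp only [s.pr_pr]
  rw [Finset.sum_eq_single i, Finset.sum_eq_single j]
  · simp
  · intro b _ hb
    rw [if_neg hb, lie_zero, map_zero]
  · intro hj
    simp [s.pr_eq_zero_of_notMem hj]
  · intro b _ hb
    simp [if_neg hb]
  · intro hi
    simp [s.pr_eq_zero_of_notMem hi]

/-- The graded bracket agrees with the bracket to leading order. -/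
theorem grBracket_sub_lie_mem {i j : ℤ} {x y : g} (hx : x ∈ s.F i) (hy : y ∈ s.F j) :
    s.grBracket x y - ⁅x, y⁆ ∈ s.F (i + j + 1) := by
  have h : ⁅x, y⁆ = ∑ a ∈ s.range, ∑ b ∈ s.range, ⁅s.pr a x, s.pr b y⁆ := by
    conv_lhs => rw [← s.sum_pr x, ← s.sum_pr y]
    simp_rw [sum_lie, lie_sum]
  rw [h, grBracket_apply, ← Finset.sum_sub_distrib]
  refine sum_mem fun a _ => ?_
  rw [← Finset.sum_sub_distrib]
  refine sum_mem fun b _ => ?_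
  rcases lt_or_ge a i with ha | ha
  · rw [s.pr_eq_zero hx ha]; simp
  rcases lt_or_ge b j with hb | hb
  · rw [s.pr_eq_zero hy hb]; simp
  rw [← neg_sub]
  exact neg_mem (s.antitone (by omega)
    (s.sub_pr_mem (s.lie_mem (s.pr_mem a x) (s.pr_mem b y))))

theorem grBracket_mem {i j : ℤ} {x y : g} (hx : x ∈ s.F i) (hy : y ∈ s.F j) :
    s.grBracket x y ∈ s.F (i + j) := by
  have := add_mem (s.antitone (by omega) (s.grBracket_sub_lie_mem hx hy)) (s.lie_mem hx hy)
  rwa [sub_add_cancel] at this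

theorem grBracket_self (x : g) : s.grBracket x x = 0 := by
  have h : s.grBracket x x = - s.grBracket x x := by
    conv_lhs => rw [grBracket_apply, Finset.sum_comm]
    rw [grBracket_apply, ← Finset.sum_neg_distrib]
    refine Finset.sum_congr rfl fun i _ => ?_
    rw [← Finset.sum_neg_distrib]
    refine Finset.sum_congr rfl fun j _ => ?_
    rw [← lie_skew, map_neg, add_comm]
  rw [eq_neg_iff_add_eq_zero, ← two_smul ℝ] at h
  exact (smul_eq_zero.1 h).resolve_left two_ne_zero

theorem grBracket_skew (x y : g) : s.grBracket x y = - s.grBracket y x := by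
  have h := s.grBracket_self (x + y)
  simp only [map_add, LinearMap.add_apply, grBracket_self, zero_add, add_zero] at h
  exact eq_neg_of_add_eq_zero_right h

/-- An iterated graded bracket is the leading part of an iterated bracket, so that the Jacobi
identity is inherited. -/
theorem grBracket_grBracket_pr (i j k : ℤ) (x y z : g) :
    s.grBracket (s.pr i x) (s.grBracket (s.pr j y) (s.pr k z)) =
      s.pr (i + j + k) ⁅s.pr i x, ⁅s.pr j y, s.pr k z⁆⁆ := by
  rw [grBracket_pr_pr, grBracket_pr_pr, add_assoc]
  refine s.pr_eq_of_sub_mem ?_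
  rw [← lie_sub, ← neg_sub, lie_neg]
  have := s.lie_mem (s.pr_mem i x)
    (s.sub_pr_mem (s.lie_mem (s.pr_mem j y) (s.pr_mem k z)))
  rw [← add_assoc] at this
  exact neg_mem this

theorem grBracket_leibniz (x y z : g) : s.grBracket x (s.grBracket y z) =
    s.grBracket (s.grBracket x y) z + s.grBracket y (s.grBracket x z) := by
  have h1 : ∀ i j k x y z, s.grBracket (s.pr i x) (s.grBracket (s.pr j y) (s.pr k z)) =
      s.grBracket (s.grBracket (s.pr i x) (s.pr j y)) (s.pr k z) +
        s.grBracket (s.pr j y) (s.grBracket (s.pr i x) (s.pr k z)) := by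
    intro i j k x y z
    rw [s.grBracket_skew (s.grBracket (s.pr i x) (s.pr j y)), grBracket_grBracket_pr,
      grBracket_grBracket_pr, grBracket_grBracket_pr, leibniz_lie, map_add, add_comm j i,
      show k + i + j = i + j + k by ring, ← map_neg, lie_skew]
  have h2 : ∀ i j x y z, s.grBracket (s.pr i x) (s.grBracket (s.pr j y) z) =
      s.grBracket (s.grBracket (s.pr i x) (s.pr j y)) z +
        s.grBracket (s.pr j y) (s.grBracket (s.pr i x) z) := by
    intro i j x y z
    rw [← s.sum_pr z]
    simp only [map_sum, ← Finset.sum_add_distrib]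
    exact Finset.sum_congr rfl fun k _ => h1 i j k x y z
  have h3 : ∀ i x y z, s.grBracket (s.pr i x) (s.grBracket y z) =
      s.grBracket (s.grBracket (s.pr i x) y) z + s.grBracket y (s.grBracket (s.pr i x) z) := by
    intro i x y z
    rw [← s.sum_pr y]
    simp only [map_sum, LinearMap.sum_apply, ← Finset.sum_add_distrib]
    exact Finset.sum_congr rfl fun j _ => h2 i j x y z
  rw [← s.sum_pr x]
  simp only [map_sum, LinearMap.sum_apply, ← Finset.sum_add_distrib]
  exact Finset.sum_congr rfl fun i _ => h3 i x y z

/-- The grading derivation: multiplication by `i` in degree `i`. -/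
def euler : g →ₗ[ℝ] g := ∑ i ∈ s.range, (i : ℝ) • s.pr i

theorem euler_pr (i : ℤ) (x : g) : s.euler (s.pr i x) = (i : ℝ) • s.pr i x := by
  simp only [euler, LinearMap.sum_apply, LinearMap.smul_apply, s.pr_pr]
  rw [Finset.sum_eq_single i]
  · simp
  · intro b _ hb
    simp [if_neg hb]
  · intro hi
    simp [s.pr_eq_zero_of_notMem hi]

theorem euler_sub_mem {k : ℤ} {x : g} (hx : x ∈ s.F k) :
    s.euler x - (k : ℝ) • x ∈ s.F (k + 1) := by
  have h : s.euler x - (k : ℝ) • x =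
      ∑ i ∈ s.range, (s.euler (s.pr i x) - (k : ℝ) • s.pr i x) := by
    rw [Finset.sum_sub_distrib, ← map_sum, ← Finset.smul_sum, s.sum_pr]
  rw [h]
  refine sum_mem fun i _ => ?_
  rw [euler_pr]
  rcases lt_trichotomy i k with h | h | h
  · rw [s.pr_eq_zero hx h]; simp
  · rw [h, sub_self]; exact zero_mem _
  · have := s.antitone (show k + 1 ≤ i by omega) (s.pr_mem i x)
    exact sub_mem (Submodule.smul_mem _ _ this) (Submodule.smul_mem _ _ this)

theorem euler_mem {k : ℤ} {x : g} (hx : x ∈ s.F k) : s.euler x ∈ s.F k := by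
  have := add_mem (s.antitone (by omega) (s.euler_sub_mem hx)) (Submodule.smul_mem _ (k : ℝ) hx)
  rwa [sub_add_cancel] at this

theorem euler_grBracket (x y : g) :
    s.euler (s.grBracket x y) = s.grBracket (s.euler x) y + s.grBracket x (s.euler y) := by
  rw [← s.sum_pr x, ← s.sum_pr y]
  simp only [map_sum, LinearMap.sum_apply, ← Finset.sum_add_distrib]
  refine Finset.sum_congr rfl fun i _ => Finset.sum_congr rfl fun j _ => ?_
  rw [euler_pr, euler_pr, grBracket_pr_pr, euler_pr, map_smul, map_smul, LinearMap.smul_apply,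
    grBracket_pr_pr, ← add_smul]
  push_cast
  rfl

/-- The associated graded Lie algebra, extended by its grading element `(0, 1)`. -/
@[nolint unusedArguments]
def Extension (_ : SplitFiltration g) := g × ℝ

namespace Extension

instance : AddCommGroup s.Extension := inferInstanceAs (AddCommGroup (g × ℝ))

instance : Module ℝ s.Extension := inferInstanceAs (Module ℝ (g × ℝ))

instance [FiniteDimensional ℝ g] : FiniteDimensional ℝ s.Extension :=
  inferInstanceAs (FiniteDimensional ℝ (g × ℝ))

instance : LieRing s.Extension where
  bracket X Y := (s.grBracket X.1 Y.1 + X.2 • s.euler Y.1 - Y.2 • s.euler X.1, 0)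
  add_lie X Y Z := by
    refine Prod.ext ?_ (add_zero _).symm
    change s.grBracket (X.1 + Y.1) Z.1 + (X.2 + Y.2) • s.euler Z.1 - Z.2 • s.euler (X.1 + Y.1) =
      (s.grBracket X.1 Z.1 + X.2 • s.euler Z.1 - Z.2 • s.euler X.1) +
      (s.grBracket Y.1 Z.1 + Y.2 • s.euler Z.1 - Z.2 • s.euler Y.1)
    rw [map_add, LinearMap.add_apply, map_add, add_smul, smul_add]
    abel
  lie_add X Y Z := by
    refine Prod.ext ?_ (add_zero _).symm
    change s.grBracket X.1 (Y.1 + Z.1) + X.2 • s.euler (Y.1 + Z.1) - (Y.2 + Z.2) • s.euler X.1 =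
      (s.grBracket X.1 Y.1 + X.2 • s.euler Y.1 - Y.2 • s.euler X.1) +
      (s.grBracket X.1 Z.1 + X.2 • s.euler Z.1 - Z.2 • s.euler X.1)
    rw [map_add, map_add, add_smul, smul_add]
    abel
  lie_self X := by
    refine Prod.ext ?_ rfl
    change s.grBracket X.1 X.1 + X.2 • s.euler X.1 - X.2 • s.euler X.1 = 0
    rw [grBracket_self]
    abel
  leibniz_lie X Y Z := by
    refine Prod.ext ?_ (add_zero _).symm
    change s.grBracket X.1 (s.grBracket Y.1 Z.1 + Y.2 • s.euler Z.1 - Z.2 • s.euler Y.1) +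
        X.2 • s.euler (s.grBracket Y.1 Z.1 + Y.2 • s.euler Z.1 - Z.2 • s.euler Y.1) -
        (0 : ℝ) • s.euler X.1 =
      (s.grBracket (s.grBracket X.1 Y.1 + X.2 • s.euler Y.1 - Y.2 • s.euler X.1) Z.1 +
        (0 : ℝ) • s.euler Z.1 -
        Z.2 • s.euler (s.grBracket X.1 Y.1 + X.2 • s.euler Y.1 - Y.2 • s.euler X.1)) +
      (s.grBracket Y.1 (s.grBracket X.1 Z.1 + X.2 • s.euler Z.1 - Z.2 • s.euler X.1) +
        Y.2 • s.euler (s.grBracket X.1 Z.1 + X.2 • s.euler Z.1 - Z.2 • s.euler X.1) -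
        (0 : ℝ) • s.euler Y.1)
    simp only [map_add, map_sub, map_smul, LinearMap.add_apply, LinearMap.sub_apply,
      LinearMap.smul_apply, euler_grBracket, s.grBracket_leibniz X.1 Y.1 Z.1]
    rw [s.grBracket_skew Y.1 (s.euler X.1)]
    module

theorem lie_fst (X Y : s.Extension) : ⁅X, Y⁆.1 =
    s.grBracket X.1 Y.1 + X.2 • s.euler Y.1 - Y.2 • s.euler X.1 := rfl

instance : LieAlgebra ℝ s.Extension where
  lie_smul c X Y := by
    refine Prod.ext ?_ (mul_zero c).symm
    change s.grBracket X.1 (c • Y.1) + X.2 • s.euler (c • Y.1) - (c • Y.2) • s.euler X.1 =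
      c • (s.grBracket X.1 Y.1 + X.2 • s.euler Y.1 - Y.2 • s.euler X.1)
    rw [map_smul, map_smul]
    module

/-- The element with given components. -/
def mk (x : g) (t : ℝ) : s.Extension := (x, t)

/-- The projection to the graded Lie algebra. -/
def fst : s.Extension →ₗ[ℝ] g := LinearMap.fst ℝ g ℝ

theorem finrank [FiniteDimensional ℝ g] :
    Module.finrank ℝ s.Extension = Module.finrank ℝ g + 1 := by
  change Module.finrank ℝ (g × ℝ) = _
  rw [Module.finrank_prod, Module.finrank_self]

end Extension

end SplitFiltration


/-! ### The associated graded CR structure -/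

theorem mem_of_eq_of_mem {V S : Type*} [SetLike S V] {W : S} {x y : V} (h : x = y) (hy : y ∈ W) :
    x ∈ W := h ▸ hy

namespace HomogeneousCR

variable {g : Type*} [LieRing g] [LieAlgebra ℝ g] (C : HomogeneousCR g) (s : SplitFiltration g)

/-- The associated graded of the complex structure. -/
def grJ : g →ₗ[ℝ] g :=
  s.pr (-1) ∘ₗ C.J ∘ₗ s.pr (-1) + s.pr 0 ∘ₗ C.J ∘ₗ s.pr 0

theorem grJ_apply (x : g) : C.grJ s x =
    s.pr (-1) (C.J (s.pr (-1) x)) + s.pr 0 (C.J (s.pr 0 x)) := rfl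

/-- The terms without the grading element in the integrability condition of the graded geometry. -/
def grNijenhuis (x y : g) : g :=
  s.grBracket (C.grJ s x) (C.grJ s y) - s.grBracket x y -
    C.grJ s (s.grBracket (C.grJ s x) y + s.grBracket x (C.grJ s y))

theorem grNijenhuis_add_left (x x' y : g) : C.grNijenhuis s (x + x') y =
    C.grNijenhuis s x y + C.grNijenhuis s x' y := by
  simp only [grNijenhuis, map_add, LinearMap.add_apply]
  abel

theorem grNijenhuis_skew (x y : g) : C.grNijenhuis s x y = - C.grNijenhuis s y x := by
  simp only [grNijenhuis]
  rw [s.grBracket_skew (C.grJ s x) (C.grJ s y), s.grBracket_skew x y,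
    s.grBracket_skew (C.grJ s x) y, s.grBracket_skew x (C.grJ s y), map_add, map_add, map_neg,
    map_neg]
  abel

theorem pr_grJ (i : ℤ) (x : g) : s.pr i (C.grJ s x) = C.grJ s (s.pr i x) := by
  rw [grJ_apply, grJ_apply, map_add, s.pr_pr, s.pr_pr, s.pr_pr, s.pr_pr]
  by_cases h1 : i = -1
  · subst h1
    simp
  by_cases h2 : i = 0
  · subst h2
    simp
  · simp [h1, h2, Ne.symm h1, Ne.symm h2]

/-- The hypothesis that the filtration is that of a 2-nondegenerate CR geometry. -/
structure SplitBy (C : HomogeneousCR g) (s : SplitFiltration g) : Prop where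
  F_eq : s.F = C.fil
  F_one_le : s.F 1 ≤ C.h.toSubmodule

namespace SplitBy

variable {C s} (hs : SplitBy C s)

include hs

theorem mem_D {x : g} : x ∈ C.D ↔ x ∈ s.F (-1) := by rw [hs.F_eq]; rfl

theorem mem_K {x : g} : x ∈ C.leviKernel ↔ x ∈ s.F 0 := by rw [hs.F_eq]; rfl

theorem F_zero_le {x : g} (hx : x ∈ s.F 0) : x ∈ s.F (-1) := s.antitone (by omega) hx

theorem h_le {x : g} (hx : x ∈ C.h) : x ∈ s.F 0 := hs.mem_K.1 (C.h_le_leviKernel hx)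

theorem J_D {x : g} (hx : x ∈ s.F (-1)) : C.J x ∈ s.F (-1) :=
  hs.mem_D.1 (C.J_mem x (hs.mem_D.2 hx))

theorem J_K {x : g} (hx : x ∈ s.F 0) : C.J x ∈ s.F 0 :=
  hs.mem_K.1 (C.J_mem_leviKernel (hs.mem_K.2 hx))

theorem lie_K_D {x y : g} (hx : x ∈ s.F 0) (hy : y ∈ s.F (-1)) : ⁅x, y⁆ ∈ s.F (-1) := by
  simpa using s.lie_mem hx hy

theorem lie_D_K {x y : g} (hx : x ∈ s.F (-1)) (hy : y ∈ s.F 0) : ⁅x, y⁆ ∈ s.F (-1) := by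
  simpa using s.lie_mem hx hy

theorem lie_K_K {x y : g} (hx : x ∈ s.F 0) (hy : y ∈ s.F 0) : ⁅x, y⁆ ∈ s.F 0 := by
  simpa using s.lie_mem hx hy

theorem lie_one_D {x y : g} (hx : x ∈ s.F 1) (hy : y ∈ s.F (-1)) : ⁅x, y⁆ ∈ s.F 0 := by
  simpa using s.lie_mem hx hy

theorem lie_one_K {x y : g} (hx : x ∈ s.F 1) (hy : y ∈ s.F 0) : ⁅x, y⁆ ∈ s.F 1 := by
  simpa using s.lie_mem hx hy

theorem lie_K_one {x y : g} (hx : x ∈ s.F 0) (hy : y ∈ s.F 1) : ⁅x, y⁆ ∈ s.F 1 := by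
  simpa using s.lie_mem hx hy

theorem lie_D_one {x y : g} (hx : x ∈ s.F (-1)) (hy : y ∈ s.F 1) : ⁅x, y⁆ ∈ s.F 0 := by
  simpa using s.lie_mem hx hy

theorem grBracket_K_D {x y : g} (hx : x ∈ s.F 0) (hy : y ∈ s.F (-1)) :
    s.grBracket x y - ⁅x, y⁆ ∈ s.F 0 := by
  simpa using s.grBracket_sub_lie_mem hx hy

theorem grBracket_D_K {x y : g} (hx : x ∈ s.F (-1)) (hy : y ∈ s.F 0) :
    s.grBracket x y - ⁅x, y⁆ ∈ s.F 0 := by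
  simpa using s.grBracket_sub_lie_mem hx hy

theorem grBracket_K_K {x y : g} (hx : x ∈ s.F 0) (hy : y ∈ s.F 0) :
    s.grBracket x y - ⁅x, y⁆ ∈ s.F 1 := by
  simpa using s.grBracket_sub_lie_mem hx hy

theorem grBracket_one_D {x y : g} (hx : x ∈ s.F 1) (hy : y ∈ s.F (-1)) :
    s.grBracket x y - ⁅x, y⁆ ∈ s.F 1 := by
  simpa using s.grBracket_sub_lie_mem hx hy

theorem grBracket_D_D {x y : g} (hx : x ∈ s.F (-1)) (hy : y ∈ s.F (-1)) :
    s.grBracket x y - ⁅x, y⁆ ∈ s.F (-1) := by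
  simpa using s.grBracket_sub_lie_mem hx hy

omit hs in
theorem grJ_eq_zero {x : g} (hx : x ∈ s.F 1) : C.grJ s x = 0 := by
  rw [grJ_apply, s.pr_eq_zero hx (by omega), s.pr_eq_zero hx (by omega)]
  simp

omit hs in
theorem grJ_mem_D (x : g) : C.grJ s x ∈ s.F (-1) :=
  add_mem (s.pr_mem _ _) (s.antitone (by omega) (s.pr_mem 0 _))

omit hs in
theorem grJ_mem_K {x : g} (hx : x ∈ s.F 0) : C.grJ s x ∈ s.F 0 := by
  rw [grJ_apply, s.pr_eq_zero hx (by omega)]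
  simpa using s.pr_mem 0 _

theorem grJ_sub_mem_h {x : g} (hx : x ∈ s.F 0) : C.grJ s x - C.J x ∈ C.h := by
  rw [grJ_apply, s.pr_eq_zero hx (by omega), map_zero, map_zero, zero_add]
  have h1 : C.J (x - s.pr 0 x) ∈ C.h := C.J_isotropy _ (hs.F_one_le (s.sub_pr_mem hx))
  have h2 := hs.F_one_le (s.sub_pr_mem (hs.J_K (s.pr_mem 0 x)))
  rw [map_sub] at h1
  have h3 := C.h.neg_mem (C.h.add_mem h1 h2)
  refine mem_of_eq_of_mem ?_ (h3)
  abel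

theorem grJ_sub_mem_K {x : g} (hx : x ∈ s.F (-1)) : C.grJ s x - C.J x ∈ s.F 0 := by
  have h1 := hs.J_K (by simpa using s.sub_pr_mem hx : x - s.pr (-1) x ∈ s.F 0)
  have h2 : C.J (s.pr (-1) x) - s.pr (-1) (C.J (s.pr (-1) x)) ∈ s.F 0 := by
    simpa using s.sub_pr_mem (hs.J_D (s.pr_mem (-1) x))
  rw [map_sub] at h1
  have h3 := sub_mem (s.pr_mem 0 (C.J (s.pr 0 x))) (add_mem h1 h2)
  refine mem_of_eq_of_mem ?_ (h3)
  rw [grJ_apply]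
  abel

/-- On the complement of degree `0`, the complex structures agree modulo terms of degree `1`. -/
theorem grJ_pr_sub_mem (x : g) : C.grJ s (s.pr 0 x) - C.J (s.pr 0 x) ∈ s.F 1 := by
  have h2 := s.sub_pr_mem (hs.J_K (s.pr_mem 0 x))
  rw [grJ_apply, s.pr_pr, s.pr_pr, if_neg (by omega), if_pos rfl, map_zero, map_zero, zero_add,
    ← neg_sub]
  exact neg_mem h2

theorem grJ_isotropy {x : g} (hx : x ∈ C.h) : C.grJ s x ∈ C.h := by
  have := C.h.add_mem (hs.grJ_sub_mem_h (hs.h_le hx)) (C.J_isotropy x hx)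
  rwa [sub_add_cancel] at this

omit hs in
theorem eq_zero_of_pr_eq {i j : ℤ} (hij : i < j) {x : g} (h : s.pr i x = x) (hx : x ∈ s.F j) :
    x = 0 := by
  rw [← h, s.pr_eq_zero hx hij]

omit hs in
theorem pr_grBracket {i j : ℤ} {x y : g} (hx : s.pr i x = x) (hy : s.pr j y = y) :
    s.pr (i + j) (s.grBracket x y) = s.grBracket x y := by
  rw [← hx, ← hy, s.grBracket_pr_pr, s.pr_pr, if_pos rfl]

omit hs in
theorem pr_grJ_eq {i : ℤ} {x : g} (hx : s.pr i x = x) : s.pr i (C.grJ s x) = C.grJ s x := by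
  rw [pr_grJ, hx]

omit hs in
theorem pr_pr_self (i : ℤ) (x : g) : s.pr i (s.pr i x) = s.pr i x := by
  rw [s.pr_pr, if_pos rfl]

omit hs in
theorem sub_pr_mem_K {x : g} (hx : x ∈ s.F (-1)) : x - s.pr (-1) x ∈ s.F 0 := by
  simpa using s.sub_pr_mem hx

theorem grJ_sq {x : g} (hx : x ∈ s.F (-1)) : C.grJ s (C.grJ s x) + x ∈ C.h := by
  have hK : ∀ y ∈ s.F 0, C.grJ s (C.grJ s y) + y ∈ C.h := by
    intro y hy
    have h1 := hs.grJ_isotropy (hs.grJ_sub_mem_h hy)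
    have h2 := hs.grJ_sub_mem_h (hs.J_K hy)
    have h3 := C.J_sq y (hs.mem_D.2 (hs.F_zero_le hy))
    rw [map_sub] at h1
    refine mem_of_eq_of_mem ?_ (C.h.add_mem (C.h.add_mem h1 h2) h3)
    abel
  have hV : C.grJ s (C.grJ s (s.pr (-1) x)) + s.pr (-1) x = 0 := by
    refine eq_zero_of_pr_eq (s := s) (show -1 < 0 by omega) ?_ ?_
    · rw [map_add, pr_grJ, pr_grJ, pr_pr_self]
    · have hu := s.pr_mem (-1) x
      have h1 := grJ_mem_K (C := C) (hs.grJ_sub_mem_K hu)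
      have h2 := hs.grJ_sub_mem_K (hs.J_D hu)
      have h3 := hs.h_le (C.J_sq _ (hs.mem_D.2 hu))
      rw [map_sub] at h1
      refine mem_of_eq_of_mem ?_ (add_mem (add_mem h1 h2) h3)
      abel
  have h := hK _ (sub_pr_mem_K hx)
  have e : C.grJ s (C.grJ s x) + x = (C.grJ s (C.grJ s (s.pr (-1) x)) + s.pr (-1) x) +
      (C.grJ s (C.grJ s (x - s.pr (-1) x)) + (x - s.pr (-1) x)) := by
    simp only [map_sub]; abel
  rw [e, hV, zero_add]
  exact h

theorem isotropy_grBracket_grJ {x y : g} (hx : x ∈ C.h) (hy : y ∈ s.F (-1)) :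
    s.grBracket x (C.grJ s y) - C.grJ s (s.grBracket x y) ∈ C.h := by
  have hlow : ∀ x ∈ s.F 1, ∀ y ∈ s.F (-1),
      s.grBracket x (C.grJ s y) - C.grJ s (s.grBracket x y) ∈ C.h := by
    intro x hx y hy
    have h1 := hs.F_one_le (hs.grBracket_one_D hx (grJ_mem_D (C := C) y))
    have h2 := hs.F_one_le (hs.lie_one_K hx (hs.grJ_sub_mem_K hy))
    have h3 := C.isotropy_lie_J x (hs.F_one_le hx) y (hs.mem_D.2 hy)
    have h4 := C.J_isotropy _ (hs.F_one_le (hs.grBracket_one_D hx hy))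
    have h5 := hs.grJ_sub_mem_h (by simpa using s.grBracket_mem hx hy : s.grBracket x y ∈ s.F 0)
    rw [map_sub] at h4
    rw [lie_sub] at h2
    refine mem_of_eq_of_mem ?_
      (C.h.sub_mem (C.h.sub_mem (C.h.add_mem (C.h.add_mem h1 h2) h3) h4) h5)
    abel
  have hzero : ∀ x ∈ C.h, ∀ y ∈ s.F 0,
      s.grBracket x (C.grJ s y) - C.grJ s (s.grBracket x y) ∈ C.h := by
    intro x hx y hy
    have hx0 := hs.h_le hx
    have h1 := hs.F_one_le (hs.grBracket_K_K hx0 (grJ_mem_K (C := C) hy))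
    have h2 := C.h.lie_mem hx (hs.grJ_sub_mem_h hy)
    have h3 := C.isotropy_lie_J x hx y (hs.mem_D.2 (hs.F_zero_le hy))
    have h4 := C.J_isotropy _ (hs.F_one_le (hs.grBracket_K_K hx0 hy))
    have h5 := hs.grJ_sub_mem_h (by simpa using s.grBracket_mem hx0 hy : s.grBracket x y ∈ s.F 0)
    rw [map_sub] at h4
    rw [lie_sub] at h2
    refine mem_of_eq_of_mem ?_
      (C.h.sub_mem (C.h.sub_mem (C.h.add_mem (C.h.add_mem h1 h2) h3) h4) h5)
    abel
  have hneg : ∀ x ∈ C.h, s.pr 0 x = x → ∀ y ∈ s.F (-1), s.pr (-1) y = y →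
      s.grBracket x (C.grJ s y) - C.grJ s (s.grBracket x y) = 0 := by
    intro x hx hx0 y hy hy1
    have hxK := hs.h_le hx
    refine eq_zero_of_pr_eq (s := s) (show -1 < 0 by omega) ?_ ?_
    · have h1 := pr_grBracket hx0 hy1
      have h2 := pr_grBracket hx0 (pr_grJ_eq (C := C) hy1)
      rw [zero_add] at h1 h2
      rw [map_sub, h2, pr_grJ, h1]
    · have h1 := hs.grBracket_K_D hxK (grJ_mem_D (C := C) y)
      have h2 := hs.lie_K_K hxK (hs.grJ_sub_mem_K hy)
      have h3 := hs.h_le (C.isotropy_lie_J x hx y (hs.mem_D.2 hy))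
      have h4 := hs.J_K (hs.grBracket_K_D hxK hy)
      have h5 := hs.grJ_sub_mem_K
        (by simpa using s.grBracket_mem hxK hy : s.grBracket x y ∈ s.F (-1))
      rw [map_sub] at h4
      rw [lie_sub] at h2
      refine mem_of_eq_of_mem ?_ (sub_mem (sub_mem (add_mem (add_mem h1 h2) h3) h4) h5)
      abel
  have hx1 : x - s.pr 0 x ∈ s.F 1 := by simpa using s.sub_pr_mem (hs.h_le hx)
  have hx0 : s.pr 0 x ∈ C.h := by
    have := C.h.sub_mem hx (hs.F_one_le hx1)
    rwa [sub_sub_cancel] at this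
  have e1 := hlow _ hx1 y hy
  have e2 := hzero _ hx0 _ (sub_pr_mem_K hy)
  have e3 := hneg _ hx0 (pr_pr_self 0 x) _ (s.pr_mem (-1) y) (pr_pr_self (-1) y)
  have e : s.grBracket x (C.grJ s y) - C.grJ s (s.grBracket x y) =
      (s.grBracket (x - s.pr 0 x) (C.grJ s y) - C.grJ s (s.grBracket (x - s.pr 0 x) y)) +
      (s.grBracket (s.pr 0 x) (C.grJ s (y - s.pr (-1) y)) -
        C.grJ s (s.grBracket (s.pr 0 x) (y - s.pr (-1) y))) +
      (s.grBracket (s.pr 0 x) (C.grJ s (s.pr (-1) y)) -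
        C.grJ s (s.grBracket (s.pr 0 x) (s.pr (-1) y))) := by
    simp only [map_sub, LinearMap.sub_apply]; abel
  rw [e, e3, add_zero]
  exact C.h.add_mem e1 e2

theorem levi_gr {x y : g} (hx : x ∈ s.F (-1)) (hy : y ∈ s.F (-1)) :
    s.grBracket (C.grJ s x) (C.grJ s y) - s.grBracket x y ∈ s.F (-1) := by
  have h1 := hs.grBracket_D_D (grJ_mem_D (C := C) (s := s) x) (grJ_mem_D (C := C) y)
  have h2 := hs.grBracket_D_D hx hy
  have h3 := hs.lie_K_D (hs.grJ_sub_mem_K hx) (grJ_mem_D (C := C) y)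
  have h4 := hs.lie_D_K (hs.J_D hx) (hs.grJ_sub_mem_K hy)
  have h5 := hs.mem_D.1 (C.levi x (hs.mem_D.2 hx) y (hs.mem_D.2 hy))
  rw [sub_lie] at h3
  rw [lie_sub] at h4
  refine mem_of_eq_of_mem ?_ (add_mem (add_mem (add_mem (sub_mem h1 h2) h3) h4) h5)
  abel

/-- The integrability of the graded complex structure: by bilinearity and skew symmetry, it suffices
to consider arguments of degrees `-1` and `0` and of positive degree. -/
theorem grNijenhuis_mem {x y : g} (hx : x ∈ s.F (-1)) (hy : y ∈ s.F (-1)) :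
    C.grNijenhuis s x y ∈ C.h := by
  -- one argument of positive degree
  have hlow : ∀ x ∈ s.F 1, ∀ y ∈ s.F (-1), C.grNijenhuis s x y ∈ C.h := by
    intro x hx y hy
    have hxh := hs.F_one_le hx
    have e1 := C.isotropy_lie_J x hxh y (hs.mem_D.2 hy)
    have e2 := C.J_isotropy _ e1
    have e3 := C.J_sq _ (hs.mem_D.2 (hs.F_zero_le (hs.lie_one_D hx hy)))
    have e4 := hs.F_one_le (hs.grBracket_one_D hx hy)
    have e5 := C.J_isotropy _ (hs.F_one_le (hs.grBracket_one_D hx (grJ_mem_D (C := C) y)))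
    have e6 := C.J_isotropy _ (hs.F_one_le (hs.lie_one_K hx (hs.grJ_sub_mem_K hy)))
    have e7 := hs.grJ_sub_mem_h (by simpa using s.grBracket_mem hx (grJ_mem_D (C := C) y) :
      s.grBracket x (C.grJ s y) ∈ s.F 0)
    rw [map_sub] at e2 e5
    rw [lie_sub, map_sub] at e6
    rw [grNijenhuis, grJ_eq_zero (C := C) hx]
    refine mem_of_eq_of_mem ?_ (C.h.neg_mem (C.h.add_mem
      (C.h.add_mem (C.h.add_mem (C.h.add_mem e4 e7) e5) e6) (C.h.add_mem e2 e3)))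
    simp only [map_zero, LinearMap.zero_apply]
    simp only [zero_add, zero_sub]
    abel
  -- both arguments of degree `0`
  have hzero : ∀ x y, C.grNijenhuis s (s.pr 0 x) (s.pr 0 y) ∈ C.h := by
    intro x y
    have hx := s.pr_mem 0 x
    have hy := s.pr_mem 0 y
    have hx1 := hs.grJ_pr_sub_mem x
    have hy1 := hs.grJ_pr_sub_mem y
    set u := s.pr 0 x
    set v := s.pr 0 y
    have hJu := grJ_mem_K (C := C) hx
    have hJv := grJ_mem_K (C := C) hy
    have e0 := C.integrable u (hs.mem_D.2 (hs.F_zero_le hx)) v (hs.mem_D.2 (hs.F_zero_le hy))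
    have e1 := hs.F_one_le (hs.grBracket_K_K hJu hJv)
    have e2 := hs.F_one_le (hs.grBracket_K_K hx hy)
    have e3 := hs.F_one_le (hs.lie_one_K hx1 hJv)
    have e4 := hs.F_one_le (hs.lie_K_one (hs.J_K hx) hy1)
    have e5 := hs.grJ_sub_mem_h (add_mem (by simpa using s.grBracket_mem hJu hy)
      (by simpa using s.grBracket_mem hx hJv) :
      s.grBracket (C.grJ s u) v + s.grBracket u (C.grJ s v) ∈ s.F 0)
    have e6 := C.J_isotropy _ (hs.F_one_le (hs.grBracket_K_K hJu hy))
    have e7 := C.J_isotropy _ (hs.F_one_le (hs.grBracket_K_K hx hJv))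
    have e8 := C.J_isotropy _ (hs.F_one_le (hs.lie_one_K hx1 hy))
    have e9 := C.J_isotropy _ (hs.F_one_le (hs.lie_K_one hx hy1))
    rw [sub_lie] at e3
    rw [lie_sub] at e4
    rw [map_sub] at e6 e7
    rw [sub_lie, map_sub] at e8
    rw [lie_sub, map_sub] at e9
    rw [map_add] at e0
    refine mem_of_eq_of_mem ?_ (C.h.sub_mem
      (C.h.add_mem (C.h.add_mem (C.h.sub_mem e1 e2) (C.h.add_mem e3 e4)) e0)
      (C.h.add_mem e5 (C.h.add_mem (C.h.add_mem e6 e7) (C.h.add_mem e8 e9))))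
    rw [grNijenhuis, map_add, map_add]
    abel
  have hneg : ∀ x y, C.grNijenhuis s (s.pr (-1) x) (s.pr 0 y) = 0 := by
    intro x y
    have hx := s.pr_mem (-1) x
    have hy := s.pr_mem 0 y
    have hpx := pr_pr_self (s := s) (-1) x
    have hpy := pr_pr_self (s := s) 0 y
    have hy1 := hs.grJ_pr_sub_mem y
    set u := s.pr (-1) x
    set v := s.pr 0 y
    refine eq_zero_of_pr_eq (s := s) (show -1 < 0 by omega) ?_ ?_
    · have h1 := pr_grBracket hpx hpy
      have h2 := pr_grBracket (pr_grJ_eq (C := C) hpx) hpy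
      have h3 := pr_grBracket hpx (pr_grJ_eq (C := C) hpy)
      have h4 := pr_grBracket (pr_grJ_eq (C := C) hpx) (pr_grJ_eq (C := C) hpy)
      rw [add_zero] at h1 h2 h3 h4
      rw [grNijenhuis, map_sub, map_sub, pr_grJ, map_add, h1, h2, h3, h4]
    · have hJu := grJ_mem_D (C := C) (s := s) u
      have hJv := grJ_mem_K (C := C) hy
      have hxK := hs.grJ_sub_mem_K hx
      have e0 := hs.h_le (C.integrable u (hs.mem_D.2 hx) v (hs.mem_D.2 (hs.F_zero_le hy)))
      have e1 := hs.grBracket_D_K hJu hJv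
      have e2 := hs.grBracket_D_K hx hy
      have e3 := hs.lie_K_K hxK hJv
      have e4 := hs.lie_D_one (hs.J_D hx) hy1
      have e5 := hs.grJ_sub_mem_K (add_mem (by simpa using s.grBracket_mem hJu hy)
        (by simpa using s.grBracket_mem hx hJv) :
        s.grBracket (C.grJ s u) v + s.grBracket u (C.grJ s v) ∈ s.F (-1))
      have e6 := hs.J_K (hs.grBracket_D_K hJu hy)
      have e7 := hs.J_K (hs.grBracket_D_K hx hJv)
      have e8 := hs.J_K (hs.lie_K_K hxK hy)
      have e9 := hs.J_K (hs.lie_D_one hx hy1)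
      rw [sub_lie] at e3
      rw [lie_sub] at e4
      rw [map_sub] at e6 e7
      rw [sub_lie, map_sub] at e8
      rw [lie_sub, map_sub] at e9
      rw [map_add] at e0
      refine mem_of_eq_of_mem ?_ (sub_mem (add_mem (add_mem (sub_mem e1 e2) (add_mem e3 e4)) e0)
        (add_mem e5 (add_mem (add_mem e6 e7) (add_mem e8 e9))))
      rw [grNijenhuis, map_add, map_add]
      abel
  have hneg2 : ∀ x y, C.grNijenhuis s (s.pr (-1) x) (s.pr (-1) y) = 0 := by
    intro x y
    have hpx := pr_pr_self (s := s) (-1) x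
    have hpy := pr_pr_self (s := s) (-1) y
    have hx := s.pr_mem (-1) x
    have hy := s.pr_mem (-1) y
    set u := s.pr (-1) x
    set v := s.pr (-1) y
    have h1 := pr_grBracket hpx hpy
    have h2 := pr_grBracket (pr_grJ_eq (C := C) hpx) hpy
    have h3 := pr_grBracket hpx (pr_grJ_eq (C := C) hpy)
    have h4 := pr_grBracket (pr_grJ_eq (C := C) hpx) (pr_grJ_eq (C := C) hpy)
    have h5 : s.grBracket (C.grJ s u) (C.grJ s v) - s.grBracket u v = 0 := by
      refine eq_zero_of_pr_eq (s := s) (show -1 + -1 < -1 by omega) ?_ (hs.levi_gr hx hy)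
      rw [map_sub, h1, h4]
    have h6 : ∀ z, C.grJ s (s.pr (-1 + -1) z) = 0 := by
      intro z
      rw [grJ_apply, s.pr_pr, s.pr_pr]
      simp
    rw [grNijenhuis, h5, ← h2, ← h3, map_add, h6, h6]
    simp
  -- decomposition into the homogeneous components
  have hx1 : x - s.pr (-1) x - s.pr 0 (x - s.pr (-1) x) ∈ s.F 1 := by
    simpa using s.sub_pr_mem (sub_pr_mem_K hx)
  have hy1 : y - s.pr (-1) y - s.pr 0 (y - s.pr (-1) y) ∈ s.F 1 := by
    simpa using s.sub_pr_mem (sub_pr_mem_K hy)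
  have key : ∀ x z, x ∈ s.F (-1) →
      C.grNijenhuis s (s.pr (-1) x) z ∈ C.h → C.grNijenhuis s (s.pr 0 (x - s.pr (-1) x)) z ∈ C.h →
      z ∈ s.F (-1) → C.grNijenhuis s x z ∈ C.h := by
    intro x z hx h1 h2 hz
    have hx1 : x - s.pr (-1) x - s.pr 0 (x - s.pr (-1) x) ∈ s.F 1 := by
      simpa using s.sub_pr_mem (sub_pr_mem_K hx)
    have h3 := hlow _ hx1 z hz
    have e : x = s.pr (-1) x + s.pr 0 (x - s.pr (-1) x) +
        (x - s.pr (-1) x - s.pr 0 (x - s.pr (-1) x)) := by abel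
    rw [e, grNijenhuis_add_left, grNijenhuis_add_left]
    exact C.h.add_mem (C.h.add_mem h1 h2) h3
  have hskew : ∀ x y, C.grNijenhuis s x y ∈ C.h → C.grNijenhuis s y x ∈ C.h := by
    intro x y h
    rw [grNijenhuis_skew]
    exact C.h.neg_mem h
  refine key x y hx (hskew _ _ (key y _ hy ?_ ?_ (s.pr_mem _ _)))
    (hskew _ _ (key y _ hy ?_ ?_ (s.antitone (by omega) (s.pr_mem 0 _)))) hy
  · rw [hneg2]; exact C.h.zero_mem
  · refine hskew _ _ ?_
    rw [hneg]; exact C.h.zero_mem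
  · rw [hneg]; exact C.h.zero_mem
  · exact hzero _ _

/-- The integrability condition for brackets with the grading element of the extension. -/
theorem euler_add_grJ_mem {x : g} (hx : x ∈ s.F (-1)) :
    s.euler x + C.grJ s (s.euler (C.grJ s x)) ∈ C.h := by
  have hK : ∀ y ∈ s.F 0, s.euler y ∈ s.F 1 := fun y hy => by
    simpa using s.euler_sub_mem hy
  have h1 : ∀ y ∈ s.F 0, s.euler y + C.grJ s (s.euler (C.grJ s y)) ∈ C.h := by
    intro y hy
    rw [grJ_eq_zero (hK _ (grJ_mem_K hy)), add_zero]
    exact hs.F_one_le (hK y hy)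
  have h2 : s.euler (s.pr (-1) x) + C.grJ s (s.euler (C.grJ s (s.pr (-1) x))) ∈ C.h := by
    rw [← pr_grJ, s.euler_pr, s.euler_pr, map_smul, pr_grJ, ← smul_add, add_comm]
    exact C.h.smul_mem _ (hs.grJ_sq (s.pr_mem (-1) x))
  refine mem_of_eq_of_mem ?_ (C.h.add_mem h2 (h1 _ (sub_pr_mem_K hx)))
  simp only [map_sub]
  abel

end SplitBy

end HomogeneousCR



/-! ### Geometries of maximal dimension have a grading element -/

namespace HomogeneousCR

variable {g : Type u} [LieRing g] [LieAlgebra ℝ g] {C : HomogeneousCR g} {s : SplitFiltration g}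

namespace SplitBy

variable (hs : SplitBy C s)

/-- An ideal of the extended graded algebra that lies in the isotropy yields a grading element of
the original geometry, up to terms of higher order. -/
theorem eq_bot_of_le {n : ℕ} (hn : s.F n = ⊥)
    (hE : ¬ ∃ E ∈ C.leviKernel, ∀ y ∈ C.D, ⁅E, y⁆ + y ∈ C.leviKernel) (hs : SplitBy C s)
    (𝔞 : LieIdeal ℝ s.Extension) (h𝔞 : ∀ X ∈ 𝔞, X.1 ∈ C.h) : 𝔞 = ⊥ := by
  have h1 : ∀ k : ℕ, ∀ X ∈ 𝔞, X.2 = 0 → X.1 ∈ s.F k := by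
    intro k
    induction k with
    | zero => intro X hX _; exact hs.h_le (h𝔞 X hX)
    | succ k ih =>
      intro X hX hX2
      have hXk := ih X hX hX2
      rw [hs.F_eq] at hXk ⊢
      push_cast
      rw [C.mem_fil_succ (by omega)]
      refine ⟨hXk, fun y hy => ?_⟩
      let Y : s.Extension := SplitFiltration.Extension.mk s y 0
      have hXY : ⁅X, Y⁆ ∈ 𝔞 := by
        rw [← lie_skew]
        exact neg_mem (𝔞.lie_mem hX)
      have h2 := ih _ hXY rfl
      rw [SplitFiltration.Extension.lie_fst, hX2, zero_smul, add_zero] at h2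
      change s.grBracket X.1 y - (0 : ℝ) • _ ∈ _ at h2
      rw [zero_smul, sub_zero] at h2
      rw [← hs.F_eq] at hXk ⊢
      have h3 := s.grBracket_sub_lie_mem hXk (hs.mem_D.1 hy)
      rw [neg_add_cancel_right] at h3
      have h4 := sub_mem h2 h3
      rwa [sub_sub_cancel] at h4
  have h2 : ∀ X ∈ 𝔞, X.2 = 0 → X = 0 := by
    intro X hX hX2
    have := h1 n X hX hX2
    rw [hn] at this
    exact Prod.ext this hX2
  rw [LieSubmodule.eq_bot_iff]
  intro X hX
  by_contra hX0
  have hX2 : X.2 ≠ 0 := fun h => hX0 (h2 X hX h)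
  refine hE ⟨-(X.2⁻¹ • X.1), C.leviKernel.neg_mem (C.leviKernel.smul_mem _
    (C.h_le_leviKernel (h𝔞 X hX))), fun y hy => ?_⟩
  let Y : s.Extension := SplitFiltration.Extension.mk s y 0
  have hXY : ⁅X, Y⁆ ∈ 𝔞 := by
    rw [← lie_skew]
    exact neg_mem (𝔞.lie_mem hX)
  have h3 : ⁅X, Y⁆.1 = 0 := congrArg Prod.fst (h2 _ hXY rfl)
  rw [SplitFiltration.Extension.lie_fst] at h3
  change s.grBracket X.1 y + X.2 • s.euler y - (0 : ℝ) • _ = 0 at h3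
  rw [zero_smul, sub_zero] at h3
  have hyD := hs.mem_D.1 hy
  have h4 := hs.grBracket_K_D (hs.h_le (h𝔞 X hX)) hyD
  have h5 : s.euler y - ((-1 : ℤ) : ℝ) • y ∈ s.F 0 := by simpa using s.euler_sub_mem hyD
  rw [hs.mem_K]
  refine mem_of_eq_of_mem ?_ (Submodule.smul_mem _ X.2⁻¹
    (add_mem h4 (Submodule.smul_mem _ X.2 h5)))
  have h6 : s.grBracket X.1 y = - (X.2 • s.euler y) := eq_neg_of_add_eq_zero_left h3
  rw [h6, neg_lie, smul_lie]
  push_cast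
  have e : -(X.2 • s.euler y) - ⁅X.1, y⁆ + X.2 • (s.euler y - (-1 : ℝ) • y) =
      X.2 • y - ⁅X.1, y⁆ := by
    rw [neg_one_smul, sub_neg_eq_add, smul_add]; abel
  rw [e, smul_sub, inv_smul_smul₀ hX2]
  abel

/-- The graded homogeneous CR geometry, with the grading element added to the symmetries. -/
def gradedGeometry {n : ℕ} (hn : s.F n = ⊥)
    (hE : ¬ ∃ E ∈ C.leviKernel, ∀ y ∈ C.D, ⁅E, y⁆ + y ∈ C.leviKernel) :
    HomogeneousCR s.Extension where
  h :=
    { C.h.toSubmodule.comap (SplitFiltration.Extension.fst s) with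
      lie_mem' := by
        intro X Y hX hY
        change s.grBracket X.1 Y.1 + X.2 • s.euler Y.1 - Y.2 • s.euler X.1 ∈ C.h
        change X.1 ∈ C.h at hX
        change Y.1 ∈ C.h at hY
        have h1 := hs.F_one_le (hs.grBracket_K_K (hs.h_le hX) (hs.h_le hY))
        have h2 : ∀ x ∈ C.h, s.euler x ∈ C.h := fun x hx => hs.F_one_le
          (by simpa using s.euler_sub_mem (hs.h_le hx))
        refine C.h.sub_mem (C.h.add_mem ?_ (C.h.smul_mem _ (h2 _ hY))) (C.h.smul_mem _ (h2 _ hX))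
        have h3 := C.h.add_mem h1 (C.h.lie_mem hX hY)
        rwa [sub_add_cancel] at h3 }
  D := C.D.comap (SplitFiltration.Extension.fst s)
  h_le := fun X hX => C.h_le (show X.1 ∈ C.h from hX)
  J := LinearMap.inl ℝ g ℝ ∘ₗ C.grJ s ∘ₗ SplitFiltration.Extension.fst s
  J_mem X _ := hs.mem_D.2 (grJ_mem_D (C := C) X.1)
  J_isotropy X hX := hs.grJ_isotropy (x := X.1) hX
  J_sq X hX := hs.grJ_sq (x := X.1) (hs.mem_D.1 hX)
  isotropy_lie_mem X hX Y hY := by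
    have hX' : X.1 ∈ s.F 0 := hs.h_le hX
    have hY' : Y.1 ∈ s.F (-1) := hs.mem_D.1 hY
    refine hs.mem_D.2 (sub_mem (add_mem ?_ (Submodule.smul_mem _ _ (s.euler_mem hY')))
      (Submodule.smul_mem _ _ (s.euler_mem (hs.F_zero_le hX'))))
    simpa using s.grBracket_mem hX' hY'
  isotropy_lie_J X hX Y hY := by
    have hY' : Y.1 ∈ s.F (-1) := hs.mem_D.1 hY
    have h0 : s.euler X.1 ∈ s.F 1 := by
      simpa using s.euler_sub_mem (hs.h_le (show X.1 ∈ C.h from hX))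
    have h1 := hs.isotropy_grBracket_grJ (x := X.1) hX hY'
    have h2 : s.euler (C.grJ s Y.1) - C.grJ s (s.euler Y.1) ∈ C.h := by
      have e1 := hs.euler_add_grJ_mem (C := C) (grJ_mem_D (C := C) Y.1)
      have e2 := hs.grJ_isotropy (hs.euler_add_grJ_mem (C := C) hY')
      have e3 := hs.grJ_sq (s.euler_mem (grJ_mem_D (C := C) Y.1))
      rw [map_add] at e2
      refine mem_of_eq_of_mem ?_ (C.h.sub_mem e3 e2)
      abel
    change s.grBracket X.1 (C.grJ s Y.1) + X.2 • s.euler (C.grJ s Y.1) -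
      (0 : ℝ) • s.euler X.1 - C.grJ s (s.grBracket X.1 Y.1 + X.2 • s.euler Y.1 -
        Y.2 • s.euler X.1) ∈ C.h
    rw [zero_smul, sub_zero, map_sub, map_add, map_smul, map_smul, grJ_eq_zero h0, smul_zero,
      sub_zero]
    refine mem_of_eq_of_mem ?_ (C.h.add_mem h1 (C.h.smul_mem X.2 h2))
    rw [smul_sub]
    abel
  levi X hX Y hY := by
    have hX' : X.1 ∈ s.F (-1) := hs.mem_D.1 hX
    have hY' : Y.1 ∈ s.F (-1) := hs.mem_D.1 hY
    change s.grBracket (C.grJ s X.1) (C.grJ s Y.1) + (0 : ℝ) • s.euler _ - (0 : ℝ) • s.euler _ -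
      (s.grBracket X.1 Y.1 + X.2 • s.euler Y.1 - Y.2 • s.euler X.1) ∈ C.D
    rw [hs.mem_D, zero_smul, zero_smul, add_zero, sub_zero]
    refine mem_of_eq_of_mem ?_ (sub_mem (hs.levi_gr hX' hY') (sub_mem
      (Submodule.smul_mem _ X.2 (s.euler_mem hY')) (Submodule.smul_mem _ Y.2 (s.euler_mem hX'))))
    abel
  integrable X hX Y hY := by
    have hX' : X.1 ∈ s.F (-1) := hs.mem_D.1 hX
    have hY' : Y.1 ∈ s.F (-1) := hs.mem_D.1 hY
    change s.grBracket (C.grJ s X.1) (C.grJ s Y.1) + (0 : ℝ) • s.euler _ - (0 : ℝ) • s.euler _ -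
      (s.grBracket X.1 Y.1 + X.2 • s.euler Y.1 - Y.2 • s.euler X.1) -
      C.grJ s ((s.grBracket (C.grJ s X.1) Y.1 + (0 : ℝ) • s.euler Y.1 -
          Y.2 • s.euler (C.grJ s X.1)) +
        (s.grBracket X.1 (C.grJ s Y.1) + X.2 • s.euler (C.grJ s Y.1) -
          (0 : ℝ) • s.euler X.1)) ∈ C.h
    refine mem_of_eq_of_mem ?_ (C.h.add_mem (C.h.sub_mem (hs.grNijenhuis_mem hX' hY')
      (C.h.smul_mem X.2 (hs.euler_add_grJ_mem hY'))) (C.h.smul_mem Y.2 (hs.euler_add_grJ_mem hX')))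
    simp only [grNijenhuis, map_add, map_sub, map_smul, zero_smul]
    module
  effective 𝔞 h𝔞 := hs.eq_bot_of_le hn hE 𝔞 fun X hX => h𝔞 hX

section

variable {n : ℕ} (hn : s.F n = ⊥)
    (hE : ¬ ∃ E ∈ C.leviKernel, ∀ y ∈ C.D, ⁅E, y⁆ + y ∈ C.leviKernel)

/-- Brackets of degree `i + j` agree with those of the original geometry to leading order. -/
theorem lie_fst_sub_mem {i j : ℤ} (hi : i ≤ 0) (hj : j ≤ 0) (hij : i + j < 0)
    {X Y : s.Extension} (hX : X.1 ∈ s.F i) (hY : Y.1 ∈ s.F j)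
    (hX' : i = 0 → j + 1 ≤ 0 → X.2 = 0) (hY' : j = 0 → i + 1 ≤ 0 → Y.2 = 0) :
    ⁅X, Y⁆.1 - ⁅X.1, Y.1⁆ ∈ s.F (i + j + 1) := by
  have h1 := s.grBracket_sub_lie_mem hX hY
  have h2 : X.2 • s.euler Y.1 ∈ s.F (i + j + 1) := by
    rcases eq_or_lt_of_le hi with h | h
    · rw [hX' h (by omega), zero_smul]; exact zero_mem _
    · exact Submodule.smul_mem _ _ (s.antitone (by omega) (s.euler_mem hY))
  have h3 : Y.2 • s.euler X.1 ∈ s.F (i + j + 1) := by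
    rcases eq_or_lt_of_le hj with h | h
    · rw [hY' h (by omega), zero_smul]; exact zero_mem _
    · exact Submodule.smul_mem _ _ (s.antitone (by omega) (s.euler_mem hX))
  rw [SplitFiltration.Extension.lie_fst]
  refine mem_of_eq_of_mem ?_ (sub_mem (add_mem h1 h2) h3)
  abel

theorem mem_gradedGeometry_leviKernel {X : s.Extension} :
    X ∈ (hs.gradedGeometry hn hE).leviKernel ↔ X.1 ∈ C.leviKernel := by
  have key : ∀ X Y : s.Extension, X.1 ∈ s.F (-1) → Y.1 ∈ s.F (-1) →
      ⁅X, Y⁆.1 - ⁅X.1, Y.1⁆ ∈ s.F (-1) := fun X Y hX hY =>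
    lie_fst_sub_mem (by omega) (by omega) (by omega) hX hY (by omega) (by omega)
  constructor
  · rintro ⟨h1, h2⟩
    refine ⟨h1, fun y hy => ?_⟩
    let Y : s.Extension := SplitFiltration.Extension.mk s y 0
    have h3 := hs.mem_D.1 (h2 Y hy)
    have h4 := key X Y (hs.mem_D.1 h1) (hs.mem_D.1 hy)
    rw [hs.mem_D]
    refine mem_of_eq_of_mem ?_ (sub_mem h3 h4)
    change _ = ⁅X, Y⁆.1 - (⁅X, Y⁆.1 - ⁅X.1, y⁆)
    abel
  · rintro ⟨h1, h2⟩
    refine ⟨h1, fun Y hY => ?_⟩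
    have h3 := hs.mem_D.1 (h2 Y.1 hY)
    have h4 := key X Y (hs.mem_D.1 h1) (hs.mem_D.1 hY)
    refine hs.mem_D.2 (mem_of_eq_of_mem ?_ (add_mem h3 h4))
    change ⁅X, Y⁆.1 = _
    abel

include hs in
theorem mem_F_neg {k : ℕ} {x : g} : x ∈ C.filt k ↔ x ∈ s.F (-k) := by
  rw [hs.F_eq, C.fil_neg]

/-- The filtration of the graded geometry is that of the original one, with the grading element
added in degree `0`. -/
theorem mem_gradedGeometry_filt (k : ℕ) {X : s.Extension} :
    X ∈ (hs.gradedGeometry hn hE).filt k ↔ X.1 ∈ C.filt k := by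
  induction k generalizing X with
  | zero => exact hs.mem_gradedGeometry_leviKernel hn hE
  | succ k ih =>
    cases k with
    | zero => exact Iff.rfl
    | succ k =>
      have key : ∀ X Y : s.Extension, X.1 ∈ s.F (-1) → Y.1 ∈ s.F (-(k + 1 : ℕ)) →
          ⁅X, Y⁆.1 - ⁅X.1, Y.1⁆ ∈ s.F (-(k + 1 : ℕ)) := by
        intro X Y hX hY
        have := lie_fst_sub_mem (by omega) (by omega) (by omega) hX hY (by omega) (by omega)
        rwa [show -1 + -((k + 1 : ℕ) : ℤ) + 1 = -((k + 1 : ℕ) : ℤ) by omega] at this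
      constructor
      · intro hX
        obtain ⟨A, hA, B, hB, rfl⟩ := Submodule.mem_sup.1 hX
        refine Submodule.add_mem _ (Submodule.mem_sup_left (ih.1 hA)) ?_
        clear hX
        induction hB using Submodule.span_induction with
        | mem Z hZ =>
          obtain ⟨Y, hY, W, hW, rfl⟩ := hZ
          have hW' := ih.1 hW
          have h1 := hs.mem_F_neg.2 (key Y W (hs.mem_D.1 hY) (hs.mem_F_neg.1 hW'))
          have h2 : ⁅Y.1, W.1⁆ ∈ C.filt (k + 2) :=
            Submodule.mem_sup_right (Submodule.subset_span ⟨Y.1, hY, W.1, hW', rfl⟩)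
          refine mem_of_eq_of_mem ?_ (Submodule.add_mem _ (Submodule.mem_sup_left h1) h2)
          abel
        | zero => exact zero_mem _
        | add _ _ _ _ h1 h2 => exact Submodule.add_mem _ h1 h2
        | smul c _ _ h1 => exact Submodule.smul_mem _ c h1
      · intro hX
        obtain ⟨a, ha, b, hb, hab⟩ := Submodule.mem_sup.1 hX
        have hlow : ∀ (x : g) (t : ℝ), x ∈ C.filt (k + 1) →
            SplitFiltration.Extension.mk s x t ∈
              (hs.gradedGeometry hn hE).filt (k + 2) := fun x t hx =>
          Submodule.mem_sup_left (ih.2 hx)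
        have hb' : SplitFiltration.Extension.mk s b 0 ∈ (hs.gradedGeometry hn hE).filt (k + 2) := by
          clear hX hab
          induction hb using Submodule.span_induction with
          | mem z hz =>
            obtain ⟨y, hy, w, hw, rfl⟩ := hz
            let Y : s.Extension := SplitFiltration.Extension.mk s y 0
            let W : s.Extension := SplitFiltration.Extension.mk s w 0
            have hW : W ∈ (hs.gradedGeometry hn hE).filt (k + 1) := ih.2 hw
            have h1 : ⁅Y, W⁆ ∈ (hs.gradedGeometry hn hE).filt (k + 2) :=
              Submodule.mem_sup_right (Submodule.subset_span ⟨Y, hy, W, hW, rfl⟩)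
            have h2 := hlow _ 0 (hs.mem_F_neg.2 (key Y W (hs.mem_D.1 hy) (hs.mem_F_neg.1 hw)))
            refine mem_of_eq_of_mem ?_ (Submodule.sub_mem _ h1 h2)
            refine Prod.ext ?_ (sub_zero _).symm
            change ⁅y, w⁆ = ⁅Y, W⁆.1 - (⁅Y, W⁆.1 - ⁅y, w⁆)
            abel
          | zero => exact zero_mem _
          | add x y _ _ h1 h2 =>
            refine mem_of_eq_of_mem ?_ (Submodule.add_mem _ h1 h2)
            exact Prod.ext rfl (add_zero _).symm
          | smul c x _ h1 =>
            refine mem_of_eq_of_mem ?_ (Submodule.smul_mem _ c h1)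
            exact Prod.ext rfl (mul_zero c).symm
        refine mem_of_eq_of_mem ?_ (Submodule.add_mem _ (hlow a X.2 ha) hb')
        exact Prod.ext hab.symm (add_zero _).symm

/-- The antilinear part of the bracket agrees with that of the original geometry to leading order,
so that 2-nondegeneracy and `𝔨` are inherited. -/
theorem antilinearBracket_sub_mem {X Y : s.Extension} (hX : X.1 ∈ C.leviKernel) (hY : Y.1 ∈ C.D) :
    ((hs.gradedGeometry hn hE).antilinearBracket X Y).1 - C.antilinearBracket X.1 Y.1 ∈
      C.leviKernel := by
  rw [hs.mem_K] at hX
  rw [hs.mem_D] at hY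
  change s.grBracket X.1 Y.1 + X.2 • s.euler Y.1 - Y.2 • s.euler X.1 +
    C.grJ s (s.grBracket X.1 (C.grJ s Y.1) + X.2 • s.euler (C.grJ s Y.1) -
      (0 : ℝ) • s.euler X.1) - (⁅X.1, Y.1⁆ + C.J ⁅X.1, C.J Y.1⁆) ∈ _
  rw [hs.mem_K]
  have hJY := grJ_mem_D (C := C) (s := s) Y.1
  have e1 := hs.grBracket_K_D hX hY
  have e2 := hs.h_le (hs.euler_add_grJ_mem hY)
  have e3 := s.euler_mem hX
  have e4 := hs.J_K (hs.grBracket_K_D hX hJY)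
  have e5 := hs.J_K (hs.lie_K_K hX (hs.grJ_sub_mem_K hY))
  have e6 := hs.grJ_sub_mem_K (by simpa using s.grBracket_mem hX hJY :
    s.grBracket X.1 (C.grJ s Y.1) ∈ s.F (-1))
  rw [map_sub] at e4
  rw [lie_sub, map_sub] at e5
  refine mem_of_eq_of_mem ?_ (add_mem (sub_mem (add_mem e1 (Submodule.smul_mem _ X.2 e2))
    (Submodule.smul_mem _ Y.2 e3)) (add_mem e6 (add_mem e4 e5)))
  simp only [map_add, map_sub, map_smul, zero_smul, smul_add, map_zero]
  abel

theorem gradedGeometry_isTwoNondegenerate (hC : C.IsTwoNondegenerate) :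
    (hs.gradedGeometry hn hE).IsTwoNondegenerate := by
  constructor
  · obtain ⟨k, hk⟩ := hC.1
    exact ⟨k, eq_top_iff.2 fun X _ => (hs.mem_gradedGeometry_filt hn hE k).2
      (hk ▸ Submodule.mem_top)⟩
  · intro X hX h
    have hX' := (hs.mem_gradedGeometry_leviKernel hn hE).1 hX
    refine hC.2 X.1 hX' fun y hy => ?_
    let Y : s.Extension := SplitFiltration.Extension.mk s y 0
    have h1 := (hs.mem_gradedGeometry_leviKernel hn hE).1 (h Y hy)
    have h2 := hs.antilinearBracket_sub_mem hn hE (Y := Y) hX' hy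
    refine mem_of_eq_of_mem ?_ (sub_mem h1 h2)
    rw [sub_sub_cancel]
    rfl

theorem gradedGeometry_hasSecondOrderLeviTanaka {m : Type v} [LieRing m] [LieAlgebra ℝ m]
    {S : SecondOrderLeviTanaka m} (hS : C.HasSecondOrderLeviTanaka S) :
    (hs.gradedGeometry hn hE).HasSecondOrderLeviTanaka S := by
  obtain ⟨π, h1, h2, h3, h4, h5⟩ := hS
  have hker : ∀ k, ∀ x ∈ C.filt k, π (k + 1) x = 0 := by
    intro k x hx
    have : x ∈ C.filt (k + 1) := by
      rw [hs.mem_F_neg] at hx ⊢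
      exact s.antitone (by omega) hx
    exact (h2 k x this).2 hx
  have hker1 : ∀ x y, x - y ∈ C.leviKernel → π 1 x = π 1 y := by
    intro x y hxy
    rw [← sub_eq_zero, ← map_sub]
    exact hker 0 _ hxy
  refine ⟨fun k => π k ∘ₗ SplitFiltration.Extension.fst s, ?_, ?_, ?_, ?_, ?_⟩
  · intro k
    rw [← h1 k]
    ext z
    constructor
    · rintro ⟨X, hX, rfl⟩
      exact ⟨X.1, (hs.mem_gradedGeometry_filt hn hE _).1 hX, rfl⟩
    · rintro ⟨x, hx, rfl⟩
      exact ⟨SplitFiltration.Extension.mk s x 0, (hs.mem_gradedGeometry_filt hn hE _).2 hx, rfl⟩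
  · intro k X hX
    rw [hs.mem_gradedGeometry_filt] at hX ⊢
    exact h2 k X.1 hX
  · intro i j hi hj X hX Y hY
    rw [hs.mem_gradedGeometry_filt] at hX hY
    change π (i + j) ⁅X, Y⁆.1 = ⁅π i X.1, π j Y.1⁆
    rw [← h3 i j hi hj X.1 hX Y.1 hY, ← sub_eq_zero, ← map_sub]
    obtain ⟨l, hl⟩ : ∃ l, i + j = l + 1 := ⟨i + j - 1, by omega⟩
    rw [hl]
    refine hker l _ ?_
    have := lie_fst_sub_mem (by omega) (by omega) (by omega) (hs.mem_F_neg.1 hX)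
      (hs.mem_F_neg.1 hY) (by omega) (by omega)
    rw [hs.mem_F_neg]
    rwa [show -(i : ℤ) + -(j : ℤ) + 1 = -(l : ℤ) by omega] at this
  · intro Y hY v hv
    rw [h4 Y.1 hY v hv]
    refine (hker1 _ _ ?_).symm
    exact hs.mem_K.2 (hs.grJ_sub_mem_K (hs.mem_D.1 hY))
  · intro T
    rw [h5 T]
    constructor
    · rintro ⟨x, hx, hT⟩
      refine ⟨SplitFiltration.Extension.mk s x 0,
        (hs.mem_gradedGeometry_leviKernel hn hE).2 hx, fun Y hY v hv => ?_⟩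
      rw [hT Y.1 hY v hv]
      exact (hker1 _ _ (hs.antilinearBracket_sub_mem hn hE
        (X := SplitFiltration.Extension.mk s x 0) hx hY)).symm
    · rintro ⟨X, hX, hT⟩
      have hX' := (hs.mem_gradedGeometry_leviKernel hn hE).1 hX
      refine ⟨X.1, hX', fun y hy v hv => ?_⟩
      rw [hT (SplitFiltration.Extension.mk s y 0) hy v hv]
      exact hker1 _ _ (hs.antilinearBracket_sub_mem hn hE
        (Y := SplitFiltration.Extension.mk s y 0) hX' hy)

end

end SplitBy

/-- A geometry with symmetry algebra of maximal dimension has a grading element, up to terms of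
higher order. -/
theorem IsTwoNondegenerate.exists_grading_element [FiniteDimensional ℝ g]
    (hC : C.IsTwoNondegenerate) {m : Type v} [LieRing m] [LieAlgebra ℝ m]
    {S : SecondOrderLeviTanaka m} (hS : C.HasSecondOrderLeviTanaka S)
    (hmax : ∀ (g' : Type u) [LieRing g'] [LieAlgebra ℝ g'] [FiniteDimensional ℝ g']
      (C' : HomogeneousCR g'), C'.IsTwoNondegenerate → C'.HasSecondOrderLeviTanaka S →
      Module.finrank ℝ g' ≤ Module.finrank ℝ g) :
    ∃ E ∈ C.leviKernel, ∀ y ∈ C.D, ⁅E, y⁆ + y ∈ C.leviKernel := by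
  by_contra hE
  obtain ⟨s, hsF⟩ := hC.exists_splitFiltration
  obtain ⟨n, hn⟩ := hC.exists_fil_eq_bot
  have hs : SplitBy C s := ⟨hsF, hsF ▸ hC.fil_one_le⟩
  have hn' : s.F n = ⊥ := hsF ▸ hn
  have := hmax s.Extension (hs.gradedGeometry hn' hE)
    (hs.gradedGeometry_isTwoNondegenerate hn' hE hC)
    (hs.gradedGeometry_hasSecondOrderLeviTanaka hn' hE hS)
  rw [SplitFiltration.Extension.finrank] at this
  omega

end HomogeneousCR


/-! ### The real grading -/

section RealGrading

open LieAlgebra Module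

namespace HomogeneousCR

variable {g : Type u} [LieRing g] [LieAlgebra ℝ g]

/-- The part of degree `i` of `g` with respect to a grading element `E`. -/
def gr (E : g) (i : ℤ) : Submodule ℝ g := (ad ℝ g E).eigenspace (i : ℝ)

theorem mem_gr {E x : g} {i : ℤ} : x ∈ gr E i ↔ ⁅E, x⁆ = (i : ℝ) • x := by
  rw [gr, End.mem_eigenspace_iff, ad_apply]

theorem mem_gr_zero {E x : g} : x ∈ gr E 0 ↔ ⁅E, x⁆ = 0 := by
  simp [mem_gr]

theorem mem_gr_neg_one {E x : g} : x ∈ gr E (-1) ↔ ⁅E, x⁆ = -x := by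
  simp [mem_gr]

theorem lie_mem_gr {E x y : g} {i j : ℤ} (hx : x ∈ gr E i) (hy : y ∈ gr E j) :
    ⁅x, y⁆ ∈ gr E (i + j) := by
  rw [mem_gr] at *
  rw [leibniz_lie, hx, hy, smul_lie, lie_smul, Int.cast_add, add_smul]

/-- `E` acts on `D / leviKernel` by `-1`. -/
structure IsGradingElement (C : HomogeneousCR g) (E : g) : Prop where
  mem : E ∈ C.leviKernel
  lie_add_mem : ∀ y ∈ C.D, ⁅E, y⁆ + y ∈ C.leviKernel

namespace IsGradingElement

variable {C : HomogeneousCR g} {E : g} (hE : C.IsGradingElement E)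

include hE

/-- By induction in both directions from degree `-1`, `E` acts by `i` on `F^i / F^{i+1}`. -/
theorem lie_sub_mem_fil (i : ℤ) {x : g} (hx : x ∈ C.fil i) :
    ⁅E, x⁆ - (i : ℝ) • x ∈ C.fil (i + 1) := by
  have hE0 : ∀ {i : ℤ} {x : g}, x ∈ C.fil i → ⁅E, x⁆ ∈ C.fil i := fun {i x} hx => by
    have := C.lie_mem_fil (i := 0) hE.mem hx
    rwa [zero_add] at this
  have hpos : ∀ n : ℕ, ∀ x ∈ C.fil (n - 1), ⁅E, x⁆ - ((n - 1 : ℤ) : ℝ) • x ∈ C.fil n := by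
    intro n
    induction n with
    | zero =>
      intro x hx
      simpa [fil_zero] using hE.lie_add_mem x (by simpa [fil_neg_one] using hx)
    | succ n ih =>
      intro x hx
      have hx' : x ∈ C.fil n := by simpa using hx
      rw [Nat.cast_succ, C.mem_fil_succ (by omega)]
      refine ⟨sub_mem (hE0 hx') (Submodule.smul_mem _ _ hx'), fun y hy => ?_⟩
      have h1 := ih _ (C.lie_D_mem_fil n hx' hy)
      have h2 := C.lie_mem_fil hx' (j := 0) (hE.lie_add_mem y hy)
      rw [add_zero] at h2
      refine mem_of_eq_of_mem ?_ (sub_mem h1 h2)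
      rw [sub_lie, lie_lie, lie_add, smul_lie]
      push_cast
      module
  have hneg : ∀ k : ℕ, ∀ x ∈ C.filt (k + 1), ⁅E, x⁆ + (k + 1 : ℝ) • x ∈ C.filt k := by
    intro k
    induction k with
    | zero =>
      intro x hx
      simpa [filt] using hE.lie_add_mem x hx
    | succ k ih =>
      intro x hx
      obtain ⟨a, ha, b, hb, rfl⟩ := Submodule.mem_sup.1 hx
      clear hx
      have h0 : ∀ a ∈ C.filt (k + 1), ⁅E, a⁆ ∈ C.filt (k + 1) := fun a ha => by
        rw [← fil_neg] at ha ⊢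
        exact hE0 ha
      rw [lie_add, smul_add, add_add_add_comm]
      refine add_mem (add_mem (h0 a ha) (Submodule.smul_mem _ _ ha)) ?_
      induction hb using Submodule.span_induction with
      | mem z hz =>
        obtain ⟨d, hd, w, hw, rfl⟩ := hz
        have h1 := C.lie_mem_fil (i := 0) (hE.lie_add_mem d hd)
          (j := -((k + 1 : ℕ) : ℤ)) (by rwa [fil_neg])
        have h2 := C.lie_mem_fil (i := -1) (j := -(k : ℤ)) hd (by rw [fil_neg]; exact ih w hw)
        rw [zero_add, fil_neg] at h1
        rw [show -1 + -(k : ℤ) = -((k + 1 : ℕ) : ℤ) by push_cast; ring, fil_neg] at h2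
        refine mem_of_eq_of_mem ?_ (add_mem h1 h2)
        rw [leibniz_lie, add_lie, lie_add, lie_smul]
        push_cast
        module
      | zero => simp
      | add _ _ _ _ h1 h2 =>
        rw [lie_add, smul_add, add_add_add_comm]
        exact add_mem h1 h2
      | smul c _ _ h1 =>
        rw [lie_smul, smul_comm, ← smul_add]
        exact Submodule.smul_mem _ c h1
  rcases le_or_gt 0 i with h | h
  · obtain ⟨n, hn⟩ := Int.eq_ofNat_of_zero_le (by omega : 0 ≤ i + 1)
    obtain rfl : i = n - 1 := by omega
    simpa using hpos n x hx
  · obtain ⟨k, rfl⟩ : ∃ k : ℕ, i = -((k + 1 : ℕ) : ℤ) := ⟨(-i).toNat - 1, by omega⟩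
    rw [fil_neg] at hx
    rw [show -((k + 1 : ℕ) : ℤ) + 1 = -(k : ℤ) by push_cast; ring, fil_neg]
    refine mem_of_eq_of_mem ?_ (hneg k x hx)
    push_cast
    module

theorem gr_inf_fil [FiniteDimensional ℝ g] (hC : C.IsTwoNondegenerate) {i j : ℤ} (hij : i < j)
    {x : g} (hx : x ∈ gr E i) (hxj : x ∈ C.fil j) : x = 0 := by
  obtain ⟨n, hn⟩ := hC.exists_fil_eq_bot
  have h : ∀ d : ℕ, x ∈ C.fil (j + d) := by
    intro d
    induction d with
    | zero => simpa using hxj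
    | succ d ih =>
      have h1 := hE.lie_sub_mem_fil _ ih
      rw [mem_gr.1 hx, ← sub_smul] at h1
      have h2 := (Submodule.smul_mem_iff _ (by
        rw [← Int.cast_sub]
        exact_mod_cast (by omega : i - (j + d) ≠ 0))).1 h1
      rwa [Nat.cast_succ, ← add_assoc]
  have := C.fil_antitone (show (n : ℤ) ≤ j + (n + j.natAbs : ℕ) by omega) (h _)
  rwa [hn, Submodule.mem_bot] at this

theorem gr_le_fil (hC : C.IsTwoNondegenerate) (i : ℤ) : gr E i ≤ C.fil i := by
  intro x hx
  obtain ⟨m, hm⟩ := hC.1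
  rw [← fil_neg] at hm
  have h : ∀ d : ℕ, -(m : ℤ) + d ≤ i → x ∈ C.fil (-m + d) := by
    intro d
    induction d with
    | zero => intro _; simp [hm]
    | succ d ih =>
      intro hd
      have h1 := hE.lie_sub_mem_fil _ (ih (by omega))
      rw [mem_gr.1 hx, ← sub_smul] at h1
      have h2 := (Submodule.smul_mem_iff _ (by
        rw [← Int.cast_sub]
        exact_mod_cast (by omega : i - (-m + d) ≠ 0))).1 h1
      rwa [Nat.cast_succ, ← add_assoc]
  rcases le_or_gt (-(m : ℤ)) i with hi | hi
  · have := h (i + m).toNat (by omega)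
    rwa [show -(m : ℤ) + (i + m).toNat = i by omega] at this
  · exact C.fil_antitone hi.le (hm ▸ Submodule.mem_top)

theorem fil_le_iSup_gr [FiniteDimensional ℝ g] (hC : C.IsTwoNondegenerate) (i : ℤ) :
    C.fil i ≤ ⨆ k : ℤ, ⨆ _ : i ≤ k, gr E k := by
  obtain ⟨n, hn⟩ := hC.exists_fil_eq_bot
  have h : ∀ d : ℕ, C.fil (n - d) ≤ ⨆ k : ℤ, ⨆ _ : (n : ℤ) - d ≤ k, gr E k := by
    intro d
    induction d with
    | zero => simp [hn]
    | succ d ih =>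
      intro x hx
      set i : ℤ := n - (d + 1 : ℕ) with hi
      rw [show (n : ℤ) - d = i + 1 by omega] at ih
      have h1 := ih (hE.lie_sub_mem_fil i hx)
      -- `ad E - i` is invertible on the parts of degree greater than `i`
      have h2 : (⨆ k : ℤ, ⨆ _ : i + 1 ≤ k, gr E k) ≤
          (⨆ k : ℤ, ⨆ _ : i + 1 ≤ k, gr E k).map (ad ℝ g E - (i : ℝ) • LinearMap.id) := by
        refine iSup₂_le fun k hk z hz => ⟨((k : ℝ) - i)⁻¹ • z, ?_, ?_⟩
        · exact Submodule.mem_iSup_of_mem k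
            (Submodule.mem_iSup_of_mem hk (Submodule.smul_mem _ _ hz))
        · have : (k : ℝ) - i ≠ 0 := by
            rw [← Int.cast_sub]
            exact_mod_cast (by omega : k - i ≠ 0)
          rw [LinearMap.sub_apply, LinearMap.smul_apply, LinearMap.id_apply, ad_apply, lie_smul,
            mem_gr.1 hz, smul_comm _ (k : ℝ), ← sub_smul, smul_smul, mul_inv_cancel₀ this,
            one_smul]
      obtain ⟨z, hz, hzx⟩ := h2 h1
      have h3 : x - z ∈ gr E i := by
        rw [mem_gr]
        rw [LinearMap.sub_apply, LinearMap.smul_apply, LinearMap.id_apply, ad_apply] at hzx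
        rw [lie_sub, smul_sub, sub_eq_sub_iff_sub_eq_sub, ← hzx]
      rw [← sub_add_cancel x z]
      refine add_mem ?_ ?_
      · exact Submodule.mem_iSup_of_mem i (Submodule.mem_iSup_of_mem le_rfl h3)
      · have h4 : (⨆ k : ℤ, ⨆ _ : i + 1 ≤ k, gr E k) ≤ ⨆ k : ℤ, ⨆ _ : i ≤ k, gr E k :=
          iSup₂_mono' fun k hk => ⟨k, by omega, le_rfl⟩
        exact h4 hz
  rcases le_or_gt i n with hi | hi
  · have := h (n - i).toNat
    rwa [show (n : ℤ) - (n - i).toNat = i by omega] at this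
  · exact (C.fil_antitone hi.le).trans (hn ▸ bot_le)

theorem fil_eq_iSup_gr [FiniteDimensional ℝ g] (hC : C.IsTwoNondegenerate) (i : ℤ) :
    C.fil i = ⨆ k : ℤ, ⨆ _ : i ≤ k, gr E k :=
  le_antisymm (hE.fil_le_iSup_gr hC i)
    (iSup₂_le fun k hk => (hE.gr_le_fil hC k).trans (C.fil_antitone hk))

theorem iSup_gr [FiniteDimensional ℝ g] (hC : C.IsTwoNondegenerate) : ⨆ k : ℤ, gr E k = ⊤ := by
  obtain ⟨m, hm⟩ := hC.1
  rw [← fil_neg, hE.fil_eq_iSup_gr hC] at hm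
  exact eq_top_iff.2 (hm ▸ iSup_mono fun k => iSup_le fun _ => le_rfl)

theorem exists_gr_add_fil [FiniteDimensional ℝ g] (hC : C.IsTwoNondegenerate) {i : ℤ} {x : g}
    (hx : x ∈ C.fil i) : ∃ a ∈ gr E i, ∃ b ∈ C.fil (i + 1), x = a + b := by
  have h : C.fil i ≤ gr E i ⊔ C.fil (i + 1) := by
    rw [hE.fil_eq_iSup_gr hC i]
    refine iSup₂_le fun k hk => ?_
    rcases eq_or_lt_of_le hk with rfl | hk
    · exact le_sup_left
    · exact le_sup_of_le_right ((hE.gr_le_fil hC k).trans (C.fil_antitone hk))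
  obtain ⟨a, ha, b, hb, rfl⟩ := Submodule.mem_sup.1 (h hx)
  exact ⟨a, ha, b, hb, rfl⟩

theorem isLieGrading_gr [FiniteDimensional ℝ g] (hC : C.IsTwoNondegenerate) :
    IsLieGrading (gr E) := by
  refine ⟨DirectSum.isInternal_submodule_of_iSupIndep_of_iSup_eq_top ?_ (hE.iSup_gr hC),
    fun i j x hx y hy => lie_mem_gr hx hy⟩
  exact (End.eigenspaces_iSupIndep (ad ℝ g E)).comp Int.cast_injective

theorem mem_h (hC : C.IsTwoNondegenerate) : E ∈ C.h := by
  refine hC.2 E hE.mem fun y hy => ?_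
  have h1 := hE.lie_add_mem y hy
  have h2 := C.J_mem_leviKernel (hE.lie_add_mem _ (C.J_mem y hy))
  have h3 := C.h_le_leviKernel (C.J_sq y hy)
  refine mem_of_eq_of_mem ?_ (sub_mem (add_mem h1 h2) h3)
  rw [antilinearBracket, map_add]
  abel

theorem gr_le_h (hC : C.IsTwoNondegenerate) {i : ℤ} (hi : 0 < i) : gr E i ≤ C.h.toSubmodule :=
  (hE.gr_le_fil hC i).trans ((C.fil_antitone hi).trans hC.fil_one_le)

theorem h_eq [FiniteDimensional ℝ g] (hC : C.IsTwoNondegenerate) :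
    C.h.toSubmodule = (gr E 0 ⊓ C.h.toSubmodule) ⊔ ⨆ i : ℤ, ⨆ _ : 0 < i, gr E i := by
  refine le_antisymm (fun x hx => ?_) (sup_le inf_le_right (iSup₂_le fun i hi => hE.gr_le_h hC hi))
  obtain ⟨a, ha, b, hb, rfl⟩ := hE.exists_gr_add_fil hC (i := 0) (C.h_le_leviKernel hx)
  have hbh := hC.fil_one_le hb
  rw [zero_add, hE.fil_eq_iSup_gr hC] at hb
  exact add_mem (Submodule.mem_sup_left ⟨ha, by simpa using sub_mem hx hbh⟩)
    (Submodule.mem_sup_right hb)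

/-- The complex structure of `C` is, modulo the isotropy algebra, homogeneous of degree `0`. -/
theorem exists_J_sub_mem [FiniteDimensional ℝ g] (hC : C.IsTwoNondegenerate) {y : g}
    (hy : y ∈ gr E (-1)) : ∃ y' ∈ gr E (-1), C.J y - y' ∈ C.h := by
  have hyD : y ∈ C.D := hE.gr_le_fil hC (-1) hy
  have h1 := C.isotropy_lie_J E (hE.mem_h hC) y hyD
  rw [mem_gr_neg_one.1 hy, map_neg, sub_neg_eq_add] at h1
  obtain ⟨y', hy', b, hb, hyb⟩ := hE.exists_gr_add_fil hC (i := -1) (C.J_mem y hyD)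
  obtain ⟨k, hk, w, hw, rfl⟩ := hE.exists_gr_add_fil hC (i := 0) hb
  refine ⟨y', hy', ?_⟩
  have hw1 := hC.fil_one_le hw
  have hkh : k ∈ C.h := by
    refine mem_of_eq_of_mem ?_
      (sub_mem (sub_mem h1 (C.h.lie_mem (hE.mem_h hC) hw1)) hw1)
    rw [hyb, lie_add, lie_add, mem_gr_neg_one.1 hy', mem_gr_zero.1 hk]
    abel
  rw [hyb, add_sub_cancel_left]
  exact add_mem hkh hw1

theorem exists_J_sub_mem_zero [FiniteDimensional ℝ g] (hC : C.IsTwoNondegenerate) {x : g}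
    (hx : x ∈ gr E 0) : ∃ x' ∈ gr E 0, C.J x - x' ∈ C.h := by
  obtain ⟨x', hx', b, hb, hxb⟩ := hE.exists_gr_add_fil hC (i := 0)
    (C.J_mem_leviKernel (hE.gr_le_fil hC 0 hx))
  exact ⟨x', hx', by rw [hxb, add_sub_cancel_left]; exact hC.fil_one_le hb⟩

theorem gr_neg_le_span [FiniteDimensional ℝ g] (hC : C.IsTwoNondegenerate) (k : ℕ) :
    gr E (-(k + 2 : ℕ)) ≤
      Submodule.span ℝ {z | ∃ x ∈ gr E (-1), ∃ y ∈ gr E (-(k + 1 : ℕ)), z = ⁅x, y⁆} := by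
  set P := Submodule.span ℝ {z | ∃ x ∈ gr E (-1), ∃ y ∈ gr E (-(k + 1 : ℕ)), z = ⁅x, y⁆}
  have hP : P ≤ gr E (-(k + 2 : ℕ)) := Submodule.span_le.2 (by
    rintro _ ⟨x, hx, y, hy, rfl⟩
    have := lie_mem_gr hx hy
    rwa [show (-1 + -((k + 1 : ℕ) : ℤ)) = -((k + 2 : ℕ) : ℤ) by push_cast; ring] at this)
  have h : C.filt (k + 2) ≤ P ⊔ C.filt (k + 1) := by
    refine sup_le le_sup_right (Submodule.span_le.2 ?_)
    rintro _ ⟨x, hx, y, hy, rfl⟩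
    rw [← fil_neg] at hy
    obtain ⟨a, ha, b, hb, rfl⟩ := hE.exists_gr_add_fil hC (i := -1) hx
    obtain ⟨c, hc, d, hd, rfl⟩ := hE.exists_gr_add_fil hC hy
    have h1 := C.lie_mem_fil (hE.gr_le_fil hC _ ha) hd
    have h2 := C.lie_mem_fil hb hy
    rw [show (-1 + (-((k + 1 : ℕ) : ℤ) + 1)) = -((k + 1 : ℕ) : ℤ) by ring, fil_neg] at h1
    rw [show (-1 + 1 + -((k + 1 : ℕ) : ℤ)) = -((k + 1 : ℕ) : ℤ) by ring, fil_neg] at h2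
    rw [add_lie, lie_add]
    exact add_mem (add_mem (Submodule.mem_sup_left (Submodule.subset_span ⟨a, ha, c, hc, rfl⟩))
      (Submodule.mem_sup_right h1)) (Submodule.mem_sup_right h2)
  intro x hx
  have hx' := hE.gr_le_fil hC _ hx
  rw [fil_neg] at hx'
  obtain ⟨a, ha, b, hb, rfl⟩ := Submodule.mem_sup.1 (h hx')
  have hbg : b ∈ gr E (-(k + 2 : ℕ)) := by simpa using sub_mem hx (hP ha)
  rw [← fil_neg] at hb
  rw [hE.gr_inf_fil hC (by push_cast; omega) hbg hb, add_zero]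
  exact ha

/-- An element of degree `0` is determined by its action in degree `-1`. All identities in `𝔤₀` are
verified there. -/
theorem eq_zero_of_lie_eq_zero [FiniteDimensional ℝ g] (hC : C.IsTwoNondegenerate) {x : g}
    (hx : x ∈ gr E 0) (h : ∀ y ∈ gr E (-1), ⁅x, y⁆ = 0) : x = 0 := by
  refine hE.gr_inf_fil hC (i := 0) (j := 0 + 1) (by omega) hx ?_
  have hx0 := hE.gr_le_fil hC 0 hx
  rw [C.mem_fil_succ (by omega)]
  refine ⟨hx0, fun y hy => ?_⟩
  obtain ⟨a, ha, b, hb, rfl⟩ := hE.exists_gr_add_fil hC (i := -1) hy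
  rw [lie_add, h a ha, zero_add]
  exact C.leviKernel_lie_mem hx0 hb

end IsGradingElement

end HomogeneousCR

end RealGrading


/-! ### The complexification and the element that acts by the complex structure -/

section Complexification

open LieAlgebra Module

namespace Complexification

variable {g : Type u} [AddCommGroup g] [Module ℝ g]

/-- The real part of an element of the complexification. -/
noncomputable def re : ℂ ⊗[ℝ] g →ₗ[ℝ] g := TensorProduct.lid ℝ g ∘ₗ Complex.reLm.rTensor g

/-- The imaginary part of an element of the complexification. -/
noncomputable def im : ℂ ⊗[ℝ] g →ₗ[ℝ] g := TensorProduct.lid ℝ g ∘ₗ Complex.imLm.rTensor g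

@[simp] theorem re_tmul (c : ℂ) (x : g) : re (c ⊗ₜ[ℝ] x) = c.re • x := rfl

@[simp] theorem im_tmul (c : ℂ) (x : g) : im (c ⊗ₜ[ℝ] x) = c.im • x := rfl

theorem tmul_eq (c : ℂ) (x : g) :
    c ⊗ₜ[ℝ] x = (1 : ℂ) ⊗ₜ[ℝ] (c.re • x) + Complex.I ⊗ₜ[ℝ] (c.im • x) := by
  rw [← TensorProduct.smul_tmul, ← TensorProduct.smul_tmul, ← TensorProduct.add_tmul]
  congr 1
  apply Complex.ext <;> simp

theorem eq_re_add_im (z : ℂ ⊗[ℝ] g) : z = (1 : ℂ) ⊗ₜ[ℝ] re z + Complex.I ⊗ₜ[ℝ] im z := by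
  induction z using TensorProduct.induction_on with
  | zero => simp
  | tmul c x => simpa using tmul_eq c x
  | add z w hz hw =>
    rw [map_add, map_add, TensorProduct.tmul_add, TensorProduct.tmul_add, add_add_add_comm, ← hz,
      ← hw]

theorem ext {z w : ℂ ⊗[ℝ] g} (h1 : re z = re w) (h2 : im z = im w) : z = w := by
  rw [eq_re_add_im z, eq_re_add_im w, h1, h2]

@[simp] theorem re_smul (c : ℂ) (z : ℂ ⊗[ℝ] g) : re (c • z) = c.re • re z - c.im • im z := by
  induction z using TensorProduct.induction_on with
  | zero => simp
  | tmul d x => simp [TensorProduct.smul_tmul', smul_smul, ← sub_smul]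
  | add z w hz hw => rw [smul_add, map_add, hz, hw, map_add, map_add]; module

@[simp] theorem im_smul (c : ℂ) (z : ℂ ⊗[ℝ] g) : im (c • z) = c.re • im z + c.im • re z := by
  induction z using TensorProduct.induction_on with
  | zero => simp
  | tmul d x => simp [TensorProduct.smul_tmul', smul_smul, ← add_smul]
  | add z w hz hw => rw [smul_add, map_add, hz, hw, map_add, map_add]; module

theorem mem_baseChange {W : Submodule ℝ g} {z : ℂ ⊗[ℝ] g} :
    z ∈ W.baseChange ℂ ↔ re z ∈ W ∧ im z ∈ W := by
  constructor
  · intro hz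
    rw [Submodule.baseChange_eq_span] at hz
    induction hz using Submodule.span_induction with
    | mem z hz =>
      obtain ⟨x, hx, rfl⟩ := hz
      have hx' : x ∈ W := hx
      simp [hx']
    | zero => simp
    | add z w _ _ h1 h2 =>
      rw [map_add, map_add]
      exact ⟨W.add_mem h1.1 h2.1, W.add_mem h1.2 h2.2⟩
    | smul c z _ h =>
      rw [re_smul, im_smul]
      exact ⟨W.sub_mem (W.smul_mem _ h.1) (W.smul_mem _ h.2),
        W.add_mem (W.smul_mem _ h.2) (W.smul_mem _ h.1)⟩
  · rintro ⟨h1, h2⟩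
    rw [eq_re_add_im z]
    exact add_mem (Submodule.tmul_mem_baseChange_of_mem _ h1)
      (Submodule.tmul_mem_baseChange_of_mem _ h2)

end Complexification

namespace Complexification

variable {g : Type u} [LieRing g] [LieAlgebra ℝ g]

@[simp] theorem re_lie (z w : ℂ ⊗[ℝ] g) : re ⁅z, w⁆ = ⁅re z, re w⁆ - ⁅im z, im w⁆ := by
  conv_lhs => rw [eq_re_add_im z, eq_re_add_im w]
  simp [ExtendScalars.bracket_tmul, sub_eq_add_neg]

@[simp] theorem im_lie (z w : ℂ ⊗[ℝ] g) : im ⁅z, w⁆ = ⁅re z, im w⁆ + ⁅im z, re w⁆ := by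
  conv_lhs => rw [eq_re_add_im z, eq_re_add_im w]
  simp [ExtendScalars.bracket_tmul, add_comm]

theorem killingForm_tmul [FiniteDimensional ℝ g] (x : g) (z : ℂ ⊗[ℝ] g) :
    killingForm ℂ (ℂ ⊗[ℝ] g) ((1 : ℂ) ⊗ₜ x) z =
      (killingForm ℝ g x (re z) : ℂ) + Complex.I * (killingForm ℝ g x (im z) : ℂ) := by
  have h : killingForm ℂ (ℂ ⊗[ℝ] g) = (killingForm ℝ g).baseChange ℂ :=
    LieModule.traceForm_baseChange ℝ g g ℂ
  conv_lhs => rw [h, eq_re_add_im z]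
  simp [mul_comm]

instance isKilling [FiniteDimensional ℝ g] [IsKilling ℝ g] : IsKilling ℂ (ℂ ⊗[ℝ] g) where
  killingCompl_top_eq_bot := by
    rw [LieSubmodule.eq_bot_iff]
    intro z hz
    rw [LieIdeal.mem_killingCompl] at hz
    have h : ∀ x, killingForm ℝ g x (re z) = 0 ∧ killingForm ℝ g x (im z) = 0 := by
      intro x
      have h1 := hz ((1 : ℂ) ⊗ₜ x) (LieSubmodule.mem_top _)
      have h2 := killingForm_tmul x z
      rw [killingForm] at h2
      rw [h2, Complex.ext_iff] at h1
      simpa using h1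
    have h0 : ∀ y, (∀ x, killingForm ℝ g x y = 0) → y = 0 := fun y hy =>
      (IsKilling.killingForm_nondegenerate ℝ g).2 y hy
    exact ext (by simpa using h0 _ fun x => (h x).1) (by simpa using h0 _ fun x => (h x).2)

end Complexification

namespace HomogeneousCR

open Complexification

variable {g : Type u} [LieRing g] [LieAlgebra ℝ g] (C : HomogeneousCR g)

theorem lie_add_lie_mem {x y : g} (hx : x ∈ C.D) (hy : y ∈ C.D) :
    ⁅C.J x, y⁆ + ⁅x, C.J y⁆ ∈ C.D := by
  have h1 := C.levi x hx _ (C.J_mem y hy)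
  have h2 := C.isotropy_lie_mem _ (C.J_sq y hy) _ (C.J_mem x hx)
  refine mem_of_eq_of_mem ?_ (C.D.neg_mem (C.D.add_mem h1 h2))
  rw [← lie_skew _ (C.J x), lie_add]
  abel

/-- The preimage in the complexification of the `(0,1)`-part of the complexified tangent space: it
is spanned by the complexification of `h` and the elements `x + i J x`, for `x ∈ D`. -/
def half : LieSubalgebra ℂ (ℂ ⊗[ℝ] g) where
  carrier := {z | re z ∈ C.D ∧ im z - C.J (re z) ∈ C.h}
  add_mem' := by
    rintro z w ⟨h1, h2⟩ ⟨h3, h4⟩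
    refine ⟨by rw [map_add]; exact add_mem h1 h3, mem_of_eq_of_mem ?_ (add_mem h2 h4)⟩
    rw [map_add, map_add, map_add]
    abel
  zero_mem' := by simp
  smul_mem' := by
    rintro c z ⟨h1, h2⟩
    have h3 : im z ∈ C.D := by
      simpa using add_mem (C.h_le h2) (C.J_mem _ h1)
    refine ⟨?_, ?_⟩
    · rw [re_smul]
      exact sub_mem (C.D.smul_mem _ h1) (C.D.smul_mem _ h3)
    · have h4 := add_mem (C.J_isotropy _ h2) (C.J_sq _ h1)
      refine mem_of_eq_of_mem ?_ (add_mem (C.h.smul_mem c.re h2) (C.h.smul_mem c.im h4))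
      rw [re_smul, im_smul]
      simp only [map_sub, map_smul]
      module
  lie_mem' := by
    rintro z w ⟨hz, hz'⟩ ⟨hw, hw'⟩
    change re ⁅z, w⁆ ∈ C.D ∧ im ⁅z, w⁆ - C.J (re ⁅z, w⁆) ∈ C.h
    rw [re_lie, im_lie]
    -- the imaginary parts are `J x + a` and `J y + b`, with `a` and `b` in `h`
    set x := re z
    set y := re w
    obtain ⟨a, ha⟩ : ∃ a, a = im z - C.J x := ⟨_, rfl⟩
    obtain ⟨b, hb⟩ : ∃ b, b = im w - C.J y := ⟨_, rfl⟩
    rw [← ha] at hz'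
    rw [← hb] at hw'
    rw [show im z = C.J x + a by rw [ha]; abel, show im w = C.J y + b by rw [hb]; abel]
    have hJx := C.J_mem x hz
    have hJy := C.J_mem y hw
    have hN := C.integrable x hz y hw
    have hS := C.lie_add_lie_mem hz hw
    have hax := C.isotropy_lie_mem a hz' y hw
    have hbx := C.isotropy_lie_mem b hw' x hz
    have haJ := C.isotropy_lie_J a hz' y hw
    have hbJ := C.isotropy_lie_J b hw' x hz
    have hab := C.h.lie_mem hz' hw'
    constructor
    · refine mem_of_eq_of_mem ?_ (C.D.sub_mem (C.D.neg_mem (C.levi x hz y hw))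
        (C.D.add_mem (C.D.sub_mem (C.isotropy_lie_mem a hz' _ hJy)
          (C.isotropy_lie_mem b hw' _ hJx)) (C.h_le hab)))
      rw [add_lie, lie_add, lie_add, ← lie_skew (C.J x) b]
      abel
    · have h1 := add_mem (C.J_isotropy _ hN) (C.J_sq _ hS)
      have h2 := add_mem (C.J_isotropy _ haJ) (C.J_sq _ hax)
      have h3 := add_mem (C.J_isotropy _ hbJ) (C.J_sq _ hbx)
      refine mem_of_eq_of_mem ?_ (add_mem (add_mem h1 (sub_mem h2 h3)) (C.J_isotropy _ hab))
      simp only [add_lie, lie_add]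
      rw [← lie_skew (C.J x) b, ← lie_skew x b]
      simp only [map_sub, map_add, map_neg]
      abel

/-- The geometry with the conjugate complex structure. -/
def conj : HomogeneousCR g where
  h := C.h
  D := C.D
  h_le := C.h_le
  J := -C.J
  J_mem x hx := C.D.neg_mem (C.J_mem x hx)
  J_isotropy x hx := C.h.neg_mem_iff.2 (C.J_isotropy x hx)
  J_sq x hx := by simpa using C.J_sq x hx
  isotropy_lie_mem := C.isotropy_lie_mem
  isotropy_lie_J x hx y hy := by
    refine mem_of_eq_of_mem ?_ (C.h.neg_mem_iff.2 (C.isotropy_lie_J x hx y hy))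
    simp only [LinearMap.neg_apply, lie_neg]
    abel
  levi x hx y hy := by simpa using C.levi x hx y hy
  integrable x hx y hy := by
    refine mem_of_eq_of_mem ?_ (C.integrable x hx y hy)
    simp only [LinearMap.neg_apply, lie_neg, neg_lie, map_add, map_neg]
    abel
  effective := C.effective

theorem conj_filt (k : ℕ) : C.conj.filt (k + 1) = C.filt (k + 1) := by
  induction k with
  | zero => rfl
  | succ k ih => rw [filt, filt, ih]; rfl

theorem conj_isTwoNondegenerate {C : HomogeneousCR g} (hC : C.IsTwoNondegenerate) :
    C.conj.IsTwoNondegenerate := by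
  refine ⟨?_, fun x hx h => hC.2 x hx fun y hy => ?_⟩
  · obtain ⟨k, hk⟩ := hC.1
    cases k with
    | zero => exact ⟨0, hk⟩
    | succ k => exact ⟨k + 1, by rw [conj_filt, hk]⟩
  · refine mem_of_eq_of_mem ?_ (h y hy)
    simp only [antilinearBracket, conj, LinearMap.neg_apply, lie_neg, map_neg, neg_neg]

namespace IsGradingElement

variable {C} {E : g} (hE : C.IsGradingElement E) (hC : C.IsTwoNondegenerate)

theorem conj (hE : C.IsGradingElement E) : C.conj.IsGradingElement E := ⟨hE.mem, hE.lie_add_mem⟩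

theorem re_im_mem_gr {k : ℤ} {z : ℂ ⊗[ℝ] g} (hz : ⁅(1 : ℂ) ⊗ₜ[ℝ] E, z⁆ = (k : ℂ) • z) :
    re z ∈ gr E k ∧ im z ∈ gr E k := by
  have h1 := congrArg re hz
  have h2 := congrArg im hz
  rw [mem_gr, mem_gr]
  simpa using And.intro h1 h2

theorem mem_gr_baseChange {k : ℤ} {z : ℂ ⊗[ℝ] g} :
    z ∈ (gr E k).baseChange ℂ ↔ ⁅(1 : ℂ) ⊗ₜ[ℝ] E, z⁆ = (k : ℂ) • z := by
  rw [mem_baseChange]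
  refine ⟨fun h => ?_, re_im_mem_gr⟩
  rw [mem_gr, mem_gr] at h
  exact Complexification.ext (by simpa using h.1) (by simpa using h.2)

theorem eigenspace_ad_tmul (k : ℤ) :
    (ad ℂ (ℂ ⊗[ℝ] g) ((1 : ℂ) ⊗ₜ[ℝ] E)).eigenspace (k : ℂ) = (gr E k).baseChange ℂ := by
  ext z
  rw [mem_gr_baseChange, End.mem_eigenspace_iff, ad_apply]

variable [FiniteDimensional ℝ g]

include hE hC

theorem iSup_eigenspace_ad_tmul :
    ⨆ k : ℤ, (ad ℂ (ℂ ⊗[ℝ] g) ((1 : ℂ) ⊗ₜ[ℝ] E)).eigenspace (k : ℂ) = ⊤ := by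
  have h : ∀ (c : ℂ) (x : g), c ⊗ₜ[ℝ] x ∈ ⨆ k : ℤ, (gr E k).baseChange ℂ := by
    intro c x
    have hx : x ∈ ⨆ k : ℤ, gr E k := hE.iSup_gr hC ▸ Submodule.mem_top
    induction hx using Submodule.iSup_induction' with
    | mem k x hx => exact Submodule.mem_iSup_of_mem k (Submodule.tmul_mem_baseChange_of_mem c hx)
    | zero => simp
    | add x y _ _ h1 h2 => rw [TensorProduct.tmul_add]; exact add_mem h1 h2
  simp only [eigenspace_ad_tmul]
  refine eq_top_iff.2 fun z _ => ?_
  rw [eq_re_add_im z]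
  exact add_mem (h _ _) (h _ _)

omit [FiniteDimensional ℝ g] in
theorem tmul_mem_half {y y' : g} {i : ℤ} (hi : -1 ≤ i) (hy : y ∈ gr E i) (h : C.J y - y' ∈ C.h) :
    (1 : ℂ) ⊗ₜ[ℝ] y + Complex.I ⊗ₜ[ℝ] y' ∈ C.half := by
  refine ⟨?_, ?_⟩
  · simpa [fil_neg_one] using C.fil_antitone hi (hE.gr_le_fil hC i hy)
  · simpa using C.h.neg_mem_iff.2 h

/-- The condition `stab` is 2-nondegeneracy: up to an element of the subalgebra, an element of
degree `0` is `i w` with `w` real, and if it preserves the `(0,1)`-part in degree `-1`, then `w`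
acts complex linearly and belongs to `h`. -/
theorem isHalfStructure_half : IsHalfStructure ((1 : ℂ) ⊗ₜ[ℝ] E) C.half where
  mem := by
    have := hE.mem_h hC
    refine ⟨by simpa using C.h_le this, by simpa using C.h.neg_mem_iff.2 (C.J_isotropy _ this)⟩
  pos k hk z hz := by
    obtain ⟨h1, h2⟩ := re_im_mem_gr hz
    have h3 := hE.gr_le_h hC hk h1
    exact ⟨C.h_le h3, C.h.sub_mem (hE.gr_le_h hC hk h2) (C.J_isotropy _ h3)⟩
  stab z hz h := by
    obtain ⟨h1, h2⟩ := re_im_mem_gr (k := 0) (by simpa using hz)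
    have hreF := hE.gr_le_fil hC 0 h1
    obtain ⟨a, ha, haJ⟩ := hE.exists_J_sub_mem_zero hC h1
    -- as `z - i w` lies in the subalgebra, for real `w`, it suffices that `w` belongs to `h`
    have hw0 : im z - a ∈ gr E 0 := sub_mem h2 ha
    have hwF := hE.gr_le_fil hC 0 hw0
    obtain ⟨w, hw⟩ : ∃ w, w = im z - a := ⟨_, rfl⟩
    rw [← hw] at hw0 hwF
    have hwh : w ∈ C.h := by
      refine hC.2 w hwF fun y hyk => ?_
      obtain ⟨y, hy, k, hk, rfl⟩ := hE.exists_gr_add_fil hC (i := -1) hyk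
      have hyD : y ∈ C.D := hE.gr_le_fil hC (-1) hy
      have hk1 : C.antilinearBracket w k ∈ C.leviKernel :=
        add_mem (C.leviKernel_lie_mem hwF hk)
          (C.J_mem_leviKernel (C.leviKernel_lie_mem hwF (C.J_mem_leviKernel hk)))
      obtain ⟨y', hy', hyJ⟩ := hE.exists_J_sub_mem hC hy
      have hv : (1 : ℂ) ⊗ₜ[ℝ] y + Complex.I ⊗ₜ[ℝ] y' ∈ C.half :=
        hE.tmul_mem_half hC le_rfl hy hyJ
      have h4 := h _ hv (by
        rw [mem_gr_neg_one] at hy hy'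
        apply Complexification.ext <;> simp [hy, hy'])
      have h5 := C.half.lie_mem (hE.tmul_mem_half hC (by norm_num) h1 haJ) hv
      have h6 := C.half.smul_mem (-Complex.I) (C.half.sub_mem h4 h5)
      have h7 : -Complex.I • (⁅z, (1 : ℂ) ⊗ₜ[ℝ] y + Complex.I ⊗ₜ[ℝ] y'⁆ -
          ⁅(1 : ℂ) ⊗ₜ[ℝ] re z + Complex.I ⊗ₜ[ℝ] a, (1 : ℂ) ⊗ₜ[ℝ] y + Complex.I ⊗ₜ[ℝ] y'⁆) =
          (1 : ℂ) ⊗ₜ[ℝ] ⁅w, y⁆ + Complex.I ⊗ₜ[ℝ] ⁅w, y'⁆ := by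
        rw [hw]
        refine Complexification.ext ?_ ?_
        · simp
        · simp only [re_lie, im_lie, im_smul, map_sub, map_add, re_tmul, im_tmul, sub_lie]
          simp
      rw [h7] at h6
      have h8 : ⁅w, y'⁆ - C.J ⁅w, y⁆ ∈ C.h := by simpa using h6.2
      have h9 := C.h_le_leviKernel (add_mem (C.J_isotropy _ h8) (C.J_sq _ (hwF.2 y hyD)))
      have h10 := C.J_mem_leviKernel (C.leviKernel_lie_mem hwF (C.h_le_leviKernel hyJ))
      refine mem_of_eq_of_mem ?_ (add_mem (add_mem hk1 h9) h10)
      simp only [antilinearBracket, lie_add, lie_sub, map_add, map_sub]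
      abel
    refine ⟨hreF.1, mem_of_eq_of_mem ?_ (C.h.sub_mem hwh haJ)⟩
    rw [hw]
    abel

omit [FiniteDimensional ℝ g] hE hC in
/-- The complexification of `D` is the sum of the two conjugate half structures. -/
theorem exists_add_of_mem_D {z : ℂ ⊗[ℝ] g} (h1 : re z ∈ C.D) (h2 : im z ∈ C.D) :
    ∃ a ∈ C.half, ∃ b ∈ C.conj.half, z = a + b := by
  have key : ∀ x ∈ C.D, (1 : ℂ) ⊗ₜ[ℝ] x ∈ C.half.toSubmodule ⊔ C.conj.half.toSubmodule := by
    intro x hx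
    have h3 : (1 : ℂ) ⊗ₜ[ℝ] x + Complex.I ⊗ₜ[ℝ] C.J x ∈ C.half :=
      ⟨by simpa using hx, by simp⟩
    have h4 : (1 : ℂ) ⊗ₜ[ℝ] x - Complex.I ⊗ₜ[ℝ] C.J x ∈ C.conj.half :=
      ⟨by simpa [HomogeneousCR.conj] using hx, by simp [HomogeneousCR.conj]⟩
    refine mem_of_eq_of_mem ?_ (Submodule.smul_mem _ (1 / 2 : ℂ)
      (add_mem (Submodule.mem_sup_left h3) (Submodule.mem_sup_right h4)))
    module
  have h3 := add_mem (key _ h1) (Submodule.smul_mem _ Complex.I (key _ h2))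
  rw [TensorProduct.smul_tmul', smul_eq_mul, mul_one, ← eq_re_add_im] at h3
  obtain ⟨a, ha, b, hb, h⟩ := Submodule.mem_sup.1 h3
  exact ⟨a, ha, b, hb, h.symm⟩

omit [FiniteDimensional ℝ g] hE hC in
theorem lie_sub_smul_eq {G : Type*} [LieRing G] [LieAlgebra ℂ G] {E e u v : G} (hu : ⁅E, u⁆ = -u)
    (h1 : ⁅e, u + v⁆ = 0) (h2 : ⁅e, u - v⁆ = -(u - v)) :
    ⁅Complex.I • E - (2 * Complex.I) • e, u⁆ = -Complex.I • v := by
  have h3 : ⁅e, u⁆ = (1 / 2 : ℂ) • -(u - v) := by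
    rw [← h2, ← add_zero ⁅e, u - v⁆, ← h1, ← lie_add, ← lie_smul]
    congr 1
    module
  rw [sub_lie, smul_lie, smul_lie, h3, hu]
  module

/-- The element that acts by `J` on the part of degree `-1`: it is the component of degree `0` of
the real part of `i E - 2 i e`, for the element `e` found in the complexification. -/
theorem exists_lie_eq_J [IsKilling ℝ g] :
    ∃ j ∈ gr E 0, ∀ y ∈ gr E (-1), C.J y - ⁅j, y⁆ ∈ C.h := by
  obtain ⟨e, he, he'⟩ := (hE.isHalfStructure_half hC).exists_lie_eq
    (hE.conj.isHalfStructure_half (conj_isTwoNondegenerate hC))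
    (hE.iSup_eigenspace_ad_tmul hC)
    (fun x hx => by
      obtain ⟨h1, h2⟩ := re_im_mem_gr (k := 0) (by simpa using hx)
      exact exists_add_of_mem_D (hE.gr_le_fil hC 0 h1).1 (hE.gr_le_fil hC 0 h2).1)
    (fun x hx => by
      obtain ⟨h1, h2⟩ := re_im_mem_gr (k := -1) (by simpa using hx)
      exact exists_add_of_mem_D (hE.gr_le_fil hC (-1) h1) (hE.gr_le_fil hC (-1) h2))
    (fun x hx hx' hx1 => by
      obtain ⟨h1, h2⟩ := re_im_mem_gr (k := -1) (by simpa using hx1)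
      have h3 : im x - C.J (re x) ∈ C.h := hx.2
      have h4 : im x - -C.J (re x) ∈ C.h := hx'.2
      have h5 : im x ∈ C.h := by
        refine mem_of_eq_of_mem ?_ (C.h.smul_mem (1 / 2 : ℝ) (C.h.add_mem h3 h4))
        module
      have h6 : C.J (re x) ∈ C.h := by
        refine mem_of_eq_of_mem ?_ (C.h.sub_mem h5 h3)
        abel
      have h7 : re x ∈ C.h := by
        refine mem_of_eq_of_mem ?_ (C.h.sub_mem (C.J_sq _ hx.1) (C.J_isotropy _ h6))
        abel
      have h0 : ∀ y ∈ gr E (-1), y ∈ C.h → y = 0 := fun y hy hyh =>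
        hE.gr_inf_fil hC (i := -1) (j := 0) (by norm_num) hy (C.h_le_leviKernel hyh)
      exact Complexification.ext (by simpa using h0 _ h1 h7) (by simpa using h0 _ h2 h5))
  set r := re (Complex.I • ((1 : ℂ) ⊗ₜ[ℝ] E) - (2 * Complex.I) • e) with hr
  have hrJ : ∀ y ∈ gr E (-1), ∀ y' ∈ gr E (-1), C.J y - y' ∈ C.h → ⁅r, y⁆ = y' := by
    intro y hy y' hy' h
    have hy1 := mem_gr_neg_one.1 hy
    have hy1' := mem_gr_neg_one.1 hy'
    have h1 := he _ (hE.tmul_mem_half hC le_rfl hy h)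
      (by apply Complexification.ext <;> simp [hy1, hy1'])
    have h2 := he' _ (hE.conj.tmul_mem_half (y' := -y') (conj_isTwoNondegenerate hC) le_rfl hy
        (mem_of_eq_of_mem (by simp [HomogeneousCR.conj]; abel) (C.h.neg_mem_iff.2 h)))
      (by apply Complexification.ext <;> simp [hy1, hy1'])
    rw [TensorProduct.tmul_neg, ← sub_eq_add_neg] at h2
    have h3 := lie_sub_smul_eq (E := (1 : ℂ) ⊗ₜ[ℝ] E)
      (by apply Complexification.ext <;> simp [hy1]) h1 h2
    have h5 := congrArg re h3
    rw [re_lie, ← hr] at h5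
    simpa using h5
  -- pass from `r` to its component of degree `0`
  obtain ⟨j, hj, ρ, hρ, hjρ⟩ : ∃ j ∈ gr E 0, ∃ ρ ∈ ⨆ k : ℤ, ⨆ _ : k ≠ 0, gr E k, j + ρ = r := by
    have h1 : r ∈ ⨆ k : ℤ, gr E k := hE.iSup_gr hC ▸ Submodule.mem_top
    rw [iSup_split_single (gr E) 0] at h1
    exact Submodule.mem_sup.1 h1
  refine ⟨j, hj, fun y hy => ?_⟩
  obtain ⟨y', hy', h⟩ := hE.exists_J_sub_mem hC hy
  have h1 : ⁅ρ, y⁆ ∈ ⨆ k : ℤ, ⨆ _ : k ≠ -1, gr E k := by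
    clear hjρ
    induction hρ using Submodule.iSup_induction' with
    | mem k x hx =>
      by_cases hk : k = 0
      · simp only [hk, ne_eq, not_true_eq_false, iSup_false, Submodule.mem_bot] at hx
        simp [hx]
      · simp only [ne_eq, hk, not_false_eq_true, iSup_true] at hx
        have h2 := lie_mem_gr hx hy
        exact Submodule.mem_iSup_of_mem (k + -1) (Submodule.mem_iSup_of_mem (by omega) h2)
    | zero => simp
    | add _ _ _ _ h1 h2 => rw [add_lie]; exact add_mem h1 h2
  have h2 : ⁅ρ, y⁆ = y' - ⁅j, y⁆ := by
    rw [← hrJ y hy y' hy' h, ← hjρ, add_lie]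
    abel
  have h3 : ⁅ρ, y⁆ ∈ gr E (-1) := by
    have := lie_mem_gr hj hy
    rw [zero_add] at this
    exact h2 ▸ sub_mem hy' this
  have h4 : ⁅ρ, y⁆ = 0 :=
    Submodule.disjoint_def.1 ((End.eigenspaces_iSupIndep (ad ℝ g E)).comp
      Int.cast_injective (-1)) _ h3 h1
  rw [h4] at h2
  rwa [← sub_eq_zero.1 h2.symm]

end IsGradingElement

end HomogeneousCR

end Complexification


/-! ### The symmetric pair of degree 0 -/

section HermitianPair

open LieAlgebra Module

namespace HomogeneousCR

variable {g : Type u} [LieRing g] [LieAlgebra ℝ g]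

theorem lie_mem_gr_of_zero {E x y : g} {i : ℤ} (hx : x ∈ gr E 0) (hy : y ∈ gr E i) :
    ⁅x, y⁆ ∈ gr E i := by
  have := lie_mem_gr hx hy
  rwa [zero_add] at this

/-- A grading element `E` together with an element `j` of degree `0` which acts on the part of
degree `-1` by the complex structure. -/
structure IsBigradingPair (C : HomogeneousCR g) (E j : g) : Prop extends C.IsGradingElement E where
  j_mem : j ∈ gr E 0
  J_sub_mem : ∀ y ∈ gr E (-1), C.J y - ⁅j, y⁆ ∈ C.h

namespace IsBigradingPair

variable {C : HomogeneousCR g} {E j : g} [FiniteDimensional ℝ g] (hC : C.IsTwoNondegenerate)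
  (hj : C.IsBigradingPair E j)

omit [FiniteDimensional ℝ g] in
include hj in
theorem lie_mem_gr' {i : ℤ} {x : g} (hx : x ∈ gr E i) : ⁅j, x⁆ ∈ gr E i :=
  lie_mem_gr_of_zero hj.j_mem hx

include hC hj

theorem eq_zero_of_mem_h {y : g} (hy : y ∈ gr E (-1)) (hyh : y ∈ C.h) : y = 0 :=
  hj.gr_inf_fil hC (i := -1) (j := 0) (by norm_num) hy (C.h_le_leviKernel hyh)

theorem lie_lie_eq_neg {y : g} (hy : y ∈ gr E (-1)) : ⁅j, ⁅j, y⁆⁆ = -y := by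
  have hy' := hj.lie_mem_gr' hy
  refine eq_neg_of_add_eq_zero_left (hj.eq_zero_of_mem_h hC (add_mem (hj.lie_mem_gr' hy') hy) ?_)
  have h1 := hj.J_sub_mem y hy
  have h2 := hj.J_sub_mem _ hy'
  have h3 := C.J_sq y (hj.gr_le_fil hC (-1) hy)
  refine mem_of_eq_of_mem ?_ (C.h.sub_mem (C.h.sub_mem h3 (C.J_isotropy _ h1)) h2)
  rw [map_sub]
  abel

omit [FiniteDimensional ℝ g] in
/-- On the part of degree `-1`, the antilinear part of the bracket with an element of degree `0` is
expressed through `ad j`. -/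
theorem antilinearBracket_sub_mem {x y : g} (hx : x ∈ gr E 0) (hy : y ∈ gr E (-1)) :
    C.antilinearBracket x y - (⁅x, y⁆ + ⁅j, ⁅x, ⁅j, y⁆⁆⁆) ∈ C.leviKernel := by
  have hxF := hj.gr_le_fil hC 0 hx
  have h1 := C.J_mem_leviKernel
    (C.leviKernel_lie_mem hxF (C.h_le_leviKernel (hj.J_sub_mem y hy)))
  have h2 := lie_mem_gr_of_zero hx (hj.lie_mem_gr' hy)
  have h3 := C.h_le_leviKernel (hj.J_sub_mem _ h2)
  refine mem_of_eq_of_mem ?_ (add_mem h1 h3)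
  rw [antilinearBracket, lie_sub, map_sub]
  abel

omit [FiniteDimensional ℝ g] hC hj in
theorem antilinearBracket_mem_of_mem_leviKernel {x k : g} (hx : x ∈ C.leviKernel)
    (hk : k ∈ C.leviKernel) : C.antilinearBracket x k ∈ C.leviKernel :=
  add_mem (C.leviKernel_lie_mem hx hk)
    (C.J_mem_leviKernel (C.leviKernel_lie_mem hx (C.J_mem_leviKernel hk)))

theorem mem_h_of_forall {x : g} (hx : x ∈ gr E 0)
    (h : ∀ y ∈ gr E (-1), ⁅x, y⁆ + ⁅j, ⁅x, ⁅j, y⁆⁆⁆ = 0) : x ∈ C.h := by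
  have hxF := hj.gr_le_fil hC 0 hx
  refine hC.2 x hxF fun y hyk => ?_
  obtain ⟨y, hy, k, hk, rfl⟩ := hj.exists_gr_add_fil hC (i := -1) hyk
  have h1 := hj.antilinearBracket_sub_mem hC hx hy
  rw [h y hy, sub_zero] at h1
  refine mem_of_eq_of_mem ?_ (add_mem h1 (antilinearBracket_mem_of_mem_leviKernel hxF hk))
  simp only [antilinearBracket, lie_add, map_add]
  abel

/-- In degree `0`, the isotropy is the centralizer of `j`: it consists of the elements that act
complex linearly in degree `-1`. -/
theorem mem_h_iff {x : g} (hx : x ∈ gr E 0) : x ∈ C.h ↔ ⁅j, x⁆ = 0 := by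
  constructor
  · intro hxh
    refine hj.eq_zero_of_lie_eq_zero hC (hj.lie_mem_gr' hx) fun y hy => ?_
    have hxy := lie_mem_gr_of_zero hx hy
    have hxjy := lie_mem_gr_of_zero hx (hj.lie_mem_gr' hy)
    rw [lie_lie]
    refine hj.eq_zero_of_mem_h hC (sub_mem (hj.lie_mem_gr' hxy) hxjy) ?_
    have h1 := C.isotropy_lie_J x hxh y (hj.gr_le_fil hC (-1) hy)
    have h2 := C.h.lie_mem hxh (hj.J_sub_mem y hy)
    have h3 := hj.J_sub_mem _ hxy
    refine mem_of_eq_of_mem ?_ (C.h.sub_mem (C.h.sub_mem h2 h1) h3)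
    rw [lie_sub]
    abel
  · intro h
    refine hj.mem_h_of_forall hC hx fun y hy => ?_
    have hxy := lie_mem_gr_of_zero hx hy
    have h1 : ⁅x, ⁅j, y⁆⁆ = ⁅j, ⁅x, y⁆⁆ := by
      rw [leibniz_lie j, h, zero_lie, zero_add]
    rw [h1, hj.lie_lie_eq_neg hC hxy, add_neg_cancel]

theorem lie_lie_lie {x y : g} (hx : x ∈ gr E 0) (hy : y ∈ gr E (-1)) :
    ⁅⁅j, ⁅j, x⁆⁆, y⁆ = -(2 : ℝ) • (⁅x, y⁆ + ⁅j, ⁅x, ⁅j, y⁆⁆⁆) := by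
  have hxy := lie_mem_gr_of_zero hx hy
  rw [lie_lie, lie_lie, lie_lie, lie_sub, hj.lie_lie_eq_neg hC hxy, hj.lie_lie_eq_neg hC hy,
    lie_neg]
  module

/-- On the part of degree `0`, `ad j` has the eigenvalues `0` and `± 2 i`, as the commutator with a
complex structure. -/
theorem ad_cube {x : g} (hx : x ∈ gr E 0) : ⁅j, ⁅j, ⁅j, x⁆⁆⁆ = -(4 : ℝ) • ⁅j, x⁆ := by
  have hjx := hj.lie_mem_gr' hx
  refine sub_eq_zero.1 (hj.eq_zero_of_lie_eq_zero hC
    (sub_mem (hj.lie_mem_gr' (hj.lie_mem_gr' hjx)) (Submodule.smul_mem _ _ hjx)) fun y hy => ?_)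
  have hjy := hj.lie_mem_gr' hy
  have hxjy := lie_mem_gr_of_zero hx hjy
  rw [sub_lie, hj.lie_lie_lie hC hjx hy, smul_lie, lie_lie, lie_lie, hj.lie_lie_eq_neg hC hy,
    lie_sub, lie_neg, lie_neg, hj.lie_lie_eq_neg hC hxjy]
  module

/-- The involution of the part of degree `0`: if `X` and `J` are the actions of `x` and `j` in
degree `-1`, then the image of `x` acts by `-J X J`. -/
noncomputable def invol (j : g) : g →ₗ[ℝ] g := LinearMap.id + (1 / 2 : ℝ) • (ad ℝ g j * ad ℝ g j)

omit [FiniteDimensional ℝ g] hC hj in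
theorem invol_apply (x : g) : invol j x = x + (1 / 2 : ℝ) • ⁅j, ⁅j, x⁆⁆ := rfl

omit [FiniteDimensional ℝ g] hC in
theorem invol_mem {x : g} (hx : x ∈ gr E 0) : invol j x ∈ gr E 0 :=
  add_mem hx (Submodule.smul_mem _ _ (hj.lie_mem_gr' (hj.lie_mem_gr' hx)))

theorem invol_lie_eq {x y : g} (hx : x ∈ gr E 0) (hy : y ∈ gr E (-1)) :
    ⁅invol j x, y⁆ = -⁅j, ⁅x, ⁅j, y⁆⁆⁆ := by
  rw [invol_apply, add_lie, smul_lie, hj.lie_lie_lie hC hx hy]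
  module

theorem invol_invol {x : g} (hx : x ∈ gr E 0) : invol j (invol j x) = x := by
  rw [invol_apply, invol_apply, lie_add, lie_add, lie_smul, lie_smul, hj.ad_cube hC
    (hj.lie_mem_gr' hx)]
  module

theorem invol_lie {x y : g} (hx : x ∈ gr E 0) (hy : y ∈ gr E 0) :
    invol j ⁅x, y⁆ = ⁅invol j x, invol j y⁆ := by
  have hxy : ⁅x, y⁆ ∈ gr E 0 := lie_mem_gr_of_zero hx hy
  have hxy' : ⁅invol j x, invol j y⁆ ∈ gr E 0 :=
    lie_mem_gr_of_zero (hj.invol_mem hx) (hj.invol_mem hy)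
  refine sub_eq_zero.1 (hj.eq_zero_of_lie_eq_zero hC (sub_mem (hj.invol_mem hxy) hxy')
    fun z hz => ?_)
  have hjz := hj.lie_mem_gr' hz
  have key : ∀ {x y : g}, x ∈ gr E 0 → y ∈ gr E 0 →
      ⁅invol j x, ⁅invol j y, z⁆⁆ = -⁅j, ⁅x, ⁅y, ⁅j, z⁆⁆⁆⁆ := fun {x y} hx hy => by
    rw [hj.invol_lie_eq hC hy hz,
      hj.invol_lie_eq hC hx (neg_mem (hj.lie_mem_gr' (lie_mem_gr_of_zero hy hjz))), lie_neg,
      hj.lie_lie_eq_neg hC (lie_mem_gr_of_zero hy hjz), neg_neg]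
  rw [sub_lie, lie_lie, key hx hy, key hy hx, hj.invol_lie_eq hC hxy hz, lie_lie, lie_sub]
  abel

omit [FiniteDimensional ℝ g] hC hj in
theorem invol_eq_neg_iff {x : g} : invol j x = -x ↔ ⁅j, ⁅j, x⁆⁆ = -(4 : ℝ) • x := by
  rw [invol_apply]
  constructor
  · intro h
    have h1 : ⁅j, ⁅j, x⁆⁆ = (2 : ℝ) • ((x + (1 / 2 : ℝ) • ⁅j, ⁅j, x⁆⁆) - x) := by module
    rw [h1, h]
    module
  · intro h
    rw [h]
    module

theorem invol_eq_self_iff {x : g} (hx : x ∈ gr E 0) : invol j x = x ↔ x ∈ C.h := by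
  rw [hj.mem_h_iff hC hx, invol_apply]
  constructor
  · intro h
    have h1 : ⁅j, ⁅j, x⁆⁆ = 0 := by
      have h2 : ⁅j, ⁅j, x⁆⁆ = (2 : ℝ) • ((x + (1 / 2 : ℝ) • ⁅j, ⁅j, x⁆⁆) - x) := by module
      rw [h2, h, sub_self, smul_zero]
    have h3 := hj.ad_cube hC hx
    rw [h1, lie_zero] at h3
    have h4 : ⁅j, x⁆ = -(1 / 4 : ℝ) • (-(4 : ℝ) • ⁅j, x⁆) := by module
    rw [h4, ← h3, smul_zero]
  · intro h
    rw [h, lie_zero, smul_zero, add_zero]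

/-- On the `-1`-eigenspace of the involution, the complex structure of the geometry is
`(1/2) ad j`. -/
theorem lie_sub_J_mem {x : g} (hx : x ∈ gr E 0) (hσ : invol j x = -x) :
    (1 / 2 : ℝ) • ⁅j, x⁆ - C.J x ∈ C.h := by
  obtain ⟨x', hx', hxx'⟩ := hj.exists_J_sub_mem_zero hC hx
  have hxD : x ∈ C.D := (hj.gr_le_fil hC 0 hx).1
  have hjx : ⁅j, x'⁆ = -(2 : ℝ) • x := by
    refine sub_eq_zero.1 (hj.eq_zero_of_lie_eq_zero hC
      (sub_mem (hj.lie_mem_gr' hx') (Submodule.smul_mem _ _ hx)) fun y hy => ?_)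
    have hyD : y ∈ C.D := hj.gr_le_fil hC (-1) hy
    have hjy := hj.lie_mem_gr' hy
    -- the formal integrability condition, modulo `h`
    have h1 := C.integrable x hxD y hyD
    have h2 := C.isotropy_lie_J _ hxx' y hyD
    have h3 := C.isotropy_lie_J _ (hj.J_sub_mem y hy) x hxD
    have h4 := C.h.lie_mem hxx' (hj.J_sub_mem y hy)
    have h5 := hj.J_sub_mem _ (lie_mem_gr_of_zero hx' hy)
    have h6 := hj.J_sub_mem _ (lie_mem_gr_of_zero hx hjy)
    have h7 : ⁅x', ⁅j, y⁆⁆ - ⁅x, y⁆ - ⁅j, ⁅x', y⁆⁆ - ⁅j, ⁅x, ⁅j, y⁆⁆⁆ = 0 := by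
      refine hj.eq_zero_of_mem_h hC (sub_mem (sub_mem (sub_mem (lie_mem_gr_of_zero hx' hjy)
        (lie_mem_gr_of_zero hx hy)) (hj.lie_mem_gr' (lie_mem_gr_of_zero hx' hy)))
        (hj.lie_mem_gr' (lie_mem_gr_of_zero hx hjy))) ?_
      refine mem_of_eq_of_mem ?_
        (add_mem (add_mem (add_mem (sub_mem h1 h2) (add_mem h3 h4)) h5) h6)
      rw [← lie_skew (C.J y - ⁅j, y⁆) (C.J x), ← lie_skew (C.J y - ⁅j, y⁆) x]
      simp only [lie_sub, sub_lie, map_add, map_sub, map_neg]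
      abel
    have h8 := hj.invol_lie_eq hC hx hy
    rw [hσ, neg_lie, neg_inj] at h8
    rw [← h8] at h7
    rw [sub_lie, smul_lie, lie_lie, ← neg_eq_zero, ← h7]
    module
  have h1 : x' - (1 / 2 : ℝ) • ⁅j, x⁆ ∈ C.h := by
    rw [hj.mem_h_iff hC (sub_mem hx' (Submodule.smul_mem _ _ (hj.lie_mem_gr' hx))), lie_sub, hjx,
      lie_smul, invol_eq_neg_iff.1 hσ]
    module
  refine mem_of_eq_of_mem ?_ (C.h.neg_mem_iff.2 (C.h.add_mem h1 hxx'))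
  abel

omit [FiniteDimensional ℝ g] hC hj in
/-- The subalgebra of elements of degree `0`. -/
def grZero (E : g) : LieSubalgebra ℝ g :=
  { gr E 0 with lie_mem' := fun hx hy => lie_mem_gr_of_zero hx hy }

omit [FiniteDimensional ℝ g] hC hj in
theorem killingForm_lie_left_real (x y z : g) :
    killingForm ℝ g ⁅x, y⁆ z = killingForm ℝ g x ⁅y, z⁆ :=
  LieModule.traceForm_apply_lie_apply ℝ g g x y z

omit [FiniteDimensional ℝ g] hC hj in
theorem killingForm_eq_zero_of_gr {a b : ℤ} {x y : g} (hx : x ∈ gr E a) (hy : y ∈ gr E b)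
    (hab : a + b ≠ 0) : killingForm ℝ g x y = 0 := by
  have h := killingForm_lie_left_real x E y
  rw [← lie_skew, mem_gr.1 hx, mem_gr.1 hy, map_neg, map_smul, map_smul, LinearMap.neg_apply,
    LinearMap.smul_apply, smul_eq_mul, smul_eq_mul] at h
  have hab' : (a : ℝ) + b ≠ 0 := by exact_mod_cast hab
  refine (mul_eq_zero.1 (?_ : ((a : ℝ) + b) * killingForm ℝ g x y = 0)).resolve_left hab'
  linear_combination -h

theorem eq_zero_of_killingForm [IsKilling ℝ g] {a : ℤ} {x : g} (hx : x ∈ gr E a)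
    (h : ∀ y ∈ gr E (-a), killingForm ℝ g x y = 0) : x = 0 := by
  refine (IsKilling.killingForm_nondegenerate ℝ g).1 x fun y => ?_
  have hy : y ∈ ⨆ k : ℤ, gr E k := hj.iSup_gr hC ▸ Submodule.mem_top
  induction hy using Submodule.iSup_induction' with
  | mem k y hy =>
    by_cases hk : k = -a
    · exact h y (hk ▸ hy)
    · exact killingForm_eq_zero_of_gr hx hy (by omega)
  | zero => simp
  | add y z _ _ h1 h2 => rw [map_add, h1, h2, add_zero]

/-- The symmetric pair of degree `0`. The invariant form is the Killing form of `g`. -/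
noncomputable def pseudoHermitianPair [IsKilling ℝ g] :
    PseudoHermitianPair (C.h.comap (grZero E).incl) where
  σ :=
    { toFun := fun x => ⟨invol j x, hj.invol_mem x.2⟩
      map_add' := fun x y => Subtype.ext (map_add (invol j) (x : g) y)
      map_smul' := fun c x => Subtype.ext (map_smul (invol j) c (x : g))
      map_lie' := fun {x y} => Subtype.ext (hj.invol_lie hC x.2 y.2)
      invFun := fun x => ⟨invol j x, hj.invol_mem x.2⟩
      left_inv := fun x => Subtype.ext (hj.invol_invol hC x.2)
      right_inv := fun x => Subtype.ext (hj.invol_invol hC x.2) }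
  σ_σ x := Subtype.ext (hj.invol_invol hC x.2)
  σ_fixed x := by
    rw [Subtype.ext_iff]
    exact hj.invol_eq_self_iff hC x.2
  J := (1 / 2 : ℝ) • ad ℝ (grZero E) ⟨j, hj.j_mem⟩
  J_mem x hx := by
    have hx' : invol j x = -x := congrArg Subtype.val hx
    apply Subtype.ext
    change invol j ((1 / 2 : ℝ) • ⁅j, (x : g)⁆) = -((1 / 2 : ℝ) • ⁅j, (x : g)⁆)
    rw [invol_eq_neg_iff] at hx' ⊢
    rw [lie_smul, lie_smul, hx', lie_smul]
    module
  J_sq x hx := by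
    have hx' : invol j x = -x := congrArg Subtype.val hx
    apply Subtype.ext
    change (1 / 2 : ℝ) • ⁅j, (1 / 2 : ℝ) • ⁅j, (x : g)⁆⁆ = -x
    rw [invol_eq_neg_iff] at hx'
    rw [lie_smul, hx']
    module
  J_inv x hx y _ := by
    have hx' : ⁅j, (x : g)⁆ = 0 := (hj.mem_h_iff hC x.2).1 hx
    apply Subtype.ext
    change (1 / 2 : ℝ) • ⁅j, ⁅(x : g), (y : g)⁆⁆ = ⁅(x : g), (1 / 2 : ℝ) • ⁅j, (y : g)⁆⁆
    rw [leibniz_lie, hx', zero_lie, zero_add, lie_smul]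
  B := (killingForm ℝ g).restrict (gr E 0)
  B_symm x y _ _ := LieModule.traceForm_comm ℝ g g x y
  B_nondeg x hx h := by
    have hx' : invol j x = -x := congrArg Subtype.val hx
    apply Subtype.ext
    refine hj.eq_zero_of_killingForm hC x.2 fun y hy => ?_
    rw [neg_zero] at hy
    -- split `y` into its components for the two eigenvalues of the involution
    have h1 : killingForm ℝ g x ((1 / 2 : ℝ) • (y - invol j y)) = 0 := by
      refine h ⟨_, Submodule.smul_mem _ _ (sub_mem hy (hj.invol_mem hy))⟩ (Subtype.ext ?_)
      change invol j ((1 / 2 : ℝ) • (y - invol j y)) = -((1 / 2 : ℝ) • (y - invol j y))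
      rw [map_smul, map_sub, hj.invol_invol hC hy]
      module
    have h2 : ⁅j, (1 / 2 : ℝ) • (y + invol j y)⁆ = 0 := by
      have hm : (1 / 2 : ℝ) • (y + invol j y) ∈ gr E 0 :=
        Submodule.smul_mem _ _ (add_mem hy (hj.invol_mem hy))
      rw [← hj.mem_h_iff hC hm, ← hj.invol_eq_self_iff hC hm, map_smul, map_add,
        hj.invol_invol hC hy, add_comm]
    have h3 : killingForm ℝ g x ((1 / 2 : ℝ) • (y + invol j y)) = 0 := by
      have h4 : (x : g) = (1 / 4 : ℝ) • ⁅⁅j, (x : g)⁆, j⁆ := by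
        rw [← lie_skew, invol_eq_neg_iff.1 hx']
        module
      rw [h4, map_smul (killingForm ℝ g), LinearMap.smul_apply, killingForm_lie_left_real, h2,
        map_zero, smul_zero]
    have h5 : y = (1 / 2 : ℝ) • (y - invol j y) + (1 / 2 : ℝ) • (y + invol j y) := by module
    rw [h5, map_add, h1, h3, add_zero]
  B_inv x _ y z _ _ := by
    change killingForm ℝ g ⁅(x : g), (y : g)⁆ z + killingForm ℝ g y ⁅(x : g), (z : g)⁆ = 0
    rw [← lie_skew, map_neg, LinearMap.neg_apply, killingForm_lie_left_real, neg_add_cancel]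
  B_J x y _ hy := by
    have hy' : invol j y = -y := congrArg Subtype.val hy
    change killingForm ℝ g ((1 / 2 : ℝ) • ⁅j, (x : g)⁆) ((1 / 2 : ℝ) • ⁅j, (y : g)⁆) =
      killingForm ℝ g x y
    rw [invol_eq_neg_iff] at hy'
    rw [← lie_skew, map_smul (killingForm ℝ g), map_neg, LinearMap.smul_apply,
      LinearMap.neg_apply, killingForm_lie_left_real, lie_smul, hy', map_smul, map_smul]
    simp only [smul_eq_mul]
    ring

theorem exists_pseudoHermitianPair [IsKilling ℝ g] :
    ∃ P : PseudoHermitianPair (C.h.comap (grZero E).incl),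
      ∀ x : grZero E, P.σ x = -x → (P.J x : g) - C.J x ∈ C.h :=
  ⟨hj.pseudoHermitianPair hC, fun x hx =>
    hj.lie_sub_J_mem hC x.2 (congrArg Subtype.val hx)⟩

end IsBigradingPair

theorem IsTwoNondegenerate.exists_isBigradingPair [FiniteDimensional ℝ g] [IsKilling ℝ g]
    {C : HomogeneousCR g} (hC : C.IsTwoNondegenerate) {m : Type v} [LieRing m] [LieAlgebra ℝ m]
    {S : SecondOrderLeviTanaka m} (hS : C.HasSecondOrderLeviTanaka S)
    (hmax : ∀ (g' : Type u) [LieRing g'] [LieAlgebra ℝ g'] [FiniteDimensional ℝ g']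
      (C' : HomogeneousCR g'), C'.IsTwoNondegenerate → C'.HasSecondOrderLeviTanaka S →
      Module.finrank ℝ g' ≤ Module.finrank ℝ g) :
    ∃ E j : g, C.IsBigradingPair E j := by
  obtain ⟨E, hE, hE'⟩ := hC.exists_grading_element hS hmax
  have hE : C.IsGradingElement E := ⟨hE, hE'⟩
  obtain ⟨j, hj, hj'⟩ := hE.exists_lie_eq_J hC
  exact ⟨E, j, hE, hj, hj'⟩

end HomogeneousCR

end HermitianPair


/-! ### Bigradings -/

section Bigrading

open LieAlgebra Module

variable {G : Type*} [LieRing G] [LieAlgebra ℂ G]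

/-- The common eigenspaces of `ad E` and `ad e` for integral eigenvalues. -/
def bigr (E e : G) (a b : ℤ) : Submodule ℂ G :=
  (ad ℂ G E).eigenspace (a : ℂ) ⊓ (ad ℂ G e).eigenspace (b : ℂ)

theorem mem_bigr {E e x : G} {a b : ℤ} :
    x ∈ bigr E e a b ↔ ⁅E, x⁆ = (a : ℂ) • x ∧ ⁅e, x⁆ = (b : ℂ) • x := by
  rw [bigr, Submodule.mem_inf, End.mem_eigenspace_iff, End.mem_eigenspace_iff, ad_apply, ad_apply]

theorem lie_mem_eigenspace_ad {e x y : G} {a b : ℂ} (hx : ⁅e, x⁆ = a • x) (hy : ⁅e, y⁆ = b • y) :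
    ⁅e, ⁅x, y⁆⁆ = (a + b) • ⁅x, y⁆ := by
  rw [leibniz_lie, hx, hy, smul_lie, lie_smul, add_smul]

theorem lie_mem_iSup_eigenspace_ad {e x y : G}
    (hx : x ∈ ⨆ k : ℤ, (ad ℂ G e).eigenspace (k : ℂ))
    (hy : y ∈ ⨆ k : ℤ, (ad ℂ G e).eigenspace (k : ℂ)) :
    ⁅x, y⁆ ∈ ⨆ k : ℤ, (ad ℂ G e).eigenspace (k : ℂ) := by
  induction hx using Submodule.iSup_induction' with
  | mem a x hx =>
    induction hy using Submodule.iSup_induction' with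
    | mem b y hy =>
      rw [End.mem_eigenspace_iff, ad_apply] at hx hy
      refine Submodule.mem_iSup_of_mem (a + b) ?_
      rw [End.mem_eigenspace_iff, ad_apply, lie_mem_eigenspace_ad hx hy, Int.cast_add]
    | zero => simp
    | add _ _ _ _ h1 h2 => rw [lie_add]; exact add_mem h1 h2
  | zero => simp
  | add _ _ _ _ h1 h2 => rw [add_lie]; exact add_mem h1 h2

omit [LieAlgebra ℂ G] in
theorem lie_lie_comm {E e : G} (hEe : ⁅E, e⁆ = 0) (x : G) : ⁅E, ⁅e, x⁆⁆ = ⁅e, ⁅E, x⁆⁆ := by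
  rw [leibniz_lie, hEe, zero_lie, zero_add]

variable [FiniteDimensional ℂ G] {E e : G} (hEe : ⁅E, e⁆ = 0)
  (hE : ⨆ k : ℤ, (ad ℂ G E).eigenspace (k : ℂ) = ⊤)

include hEe in
theorem eigenspace_eq_iSup_bigr (he : ⨆ k : ℤ, (ad ℂ G e).eigenspace (k : ℂ) = ⊤) (a : ℤ) :
    (ad ℂ G E).eigenspace (a : ℂ) = ⨆ b : ℤ, bigr E e a b := by
  refine Submodule.eq_iSup_inf_eigenspace_intCast he _ fun x hx => ?_
  rw [End.mem_eigenspace_iff, ad_apply] at hx ⊢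
  rw [ad_apply, lie_lie_comm hEe, hx, lie_smul]

include hEe hE in
theorem isLieGrading_bigr (he : ⨆ k : ℤ, (ad ℂ G e).eigenspace (k : ℂ) = ⊤) :
    IsLieGrading (fun ab : ℤ × ℤ => bigr E e ab.1 ab.2) := by
  refine ⟨DirectSum.isInternal_submodule_of_iSupIndep_of_iSup_eq_top ?_ ?_, ?_⟩
  · -- the spaces of the bigrading lie in distinct eigenspaces of `ad (E + i e)`
    have h := ((ad ℂ G (E + Complex.I • e)).eigenspaces_iSupIndep).comp
      (f := fun ab : ℤ × ℤ => (ab.1 : ℂ) + Complex.I * ab.2) (fun x y hxy => by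
        have h1 := Complex.ext_iff.1 hxy
        simp only [Complex.add_re, Complex.add_im, Complex.intCast_re, Complex.intCast_im,
          Complex.mul_re, Complex.mul_im, Complex.I_re, Complex.I_im] at h1
        refine Prod.ext ?_ ?_
        · have := h1.1
          simp at this
          exact this
        · have := h1.2
          simp at this
          exact this)
    refine h.mono fun ab x hx => ?_
    have hx' := mem_bigr.1 hx
    rw [Function.comp_apply, End.mem_eigenspace_iff, ad_apply, add_lie, smul_lie, hx'.1, hx'.2]
    module
  · rw [iSup_prod]
    rw [← hE]
    exact iSup_congr fun a => (eigenspace_eq_iSup_bigr hEe he a).symm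
  · rintro ⟨a, b⟩ ⟨c, d⟩ x hx y hy
    rw [mem_bigr] at *
    rw [Prod.fst_add, Prod.snd_add, Int.cast_add, Int.cast_add]
    exact ⟨lie_mem_eigenspace_ad hx.1 hy.1, lie_mem_eigenspace_ad hx.2 hy.2⟩

include hE in
omit [FiniteDimensional ℂ G] in
theorem eq_zero_of_killingForm_eq_zero [IsKilling ℂ G] {k : ℤ} {z : G}
    (hz : ⁅E, z⁆ = (k : ℂ) • z)
    (h : ∀ x, ⁅E, x⁆ = ((-k : ℤ) : ℂ) • x → killingForm ℂ G z x = 0) : z = 0 := by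
  refine (IsKilling.killingForm_nondegenerate ℂ G).1 z fun x => ?_
  have hx : x ∈ ⨆ k : ℤ, (ad ℂ G E).eigenspace (k : ℂ) := hE ▸ Submodule.mem_top
  induction hx using Submodule.iSup_induction' with
  | mem j x hx =>
    rw [End.mem_eigenspace_iff, ad_apply] at hx
    by_cases hj : j = -k
    · exact h x (hj ▸ hx)
    · refine killingForm_eq_zero_of_eigenvector hz hx ?_
      have : k + j ≠ 0 := by omega
      exact_mod_cast this
  | zero => simp
  | add y z _ _ h1 h2 => rw [map_add, h1, h2, add_zero]

include hEe hE in
/-- If `ad e` is diagonalizable with integral eigenvalues in the degrees `≤ 0`, then it is so on the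
whole algebra, by the duality between opposite degrees given by the Killing form. -/
theorem iSup_eigenspace_eq_top_of_nonpos [IsKilling ℂ G]
    (h : ∀ k : ℤ, k ≤ 0 →
      (ad ℂ G E).eigenspace (k : ℂ) ≤ ⨆ b : ℤ, (ad ℂ G e).eigenspace (b : ℂ)) :
    ⨆ b : ℤ, (ad ℂ G e).eigenspace (b : ℂ) = ⊤ := by
  rw [eq_top_iff, ← hE]
  refine iSup_le fun k => ?_
  rcases le_or_gt k 0 with hk | hk
  · exact h k hk
  have hstab : ∀ (k : ℤ), ∀ x ∈ (ad ℂ G E).eigenspace (k : ℂ),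
      ad ℂ G e x ∈ (ad ℂ G E).eigenspace (k : ℂ) := by
    intro k x hx
    rw [End.mem_eigenspace_iff, ad_apply] at hx ⊢
    rw [ad_apply, lie_lie_comm hEe, hx, lie_smul]
  -- in degree `-k`, it suffices to consider eigenvectors of `ad e`
  have hdual : ∀ z : G, (∀ (b : ℂ) (x : G), ⁅E, x⁆ = ((-k : ℤ) : ℂ) • x → ⁅e, x⁆ = b • x →
      killingForm ℂ G z x = 0) → ∀ x, ⁅E, x⁆ = ((-k : ℤ) : ℂ) • x → killingForm ℂ G z x = 0 := by
    intro z hz x hx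
    have hx' : x ∈ (ad ℂ G E).eigenspace ((-k : ℤ) : ℂ) ⊓
        ⨆ b : ℂ, (ad ℂ G e).genEigenspace b 1 := by
      refine ⟨End.mem_eigenspace_iff.2 hx, ?_⟩
      have h1 := h (-k) (by omega) (End.mem_eigenspace_iff.2 hx)
      exact (iSup_le fun b : ℤ => le_iSup (fun b => (ad ℂ G e).genEigenspace b 1) (b : ℂ)) h1
    rw [Submodule.inf_iSup_genEigenspace (hstab (-k))] at hx'
    clear hx
    induction hx' using Submodule.iSup_induction' with
    | mem b x hx =>
      exact hz b x (End.mem_eigenspace_iff.1 hx.1) (End.mem_eigenspace_iff.1 hx.2)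
    | zero => simp
    | add y z _ _ h1 h2 => rw [map_add, h1, h2, add_zero]
  have hint : ∀ (b : ℂ) (x : G), ⁅E, x⁆ = ((-k : ℤ) : ℂ) • x → ⁅e, x⁆ = b • x → x ≠ 0 →
      ∃ c : ℤ, b = c := by
    intro b x hx hb hx0
    by_contra! hbc
    have h1 := h (-k) (by omega) (End.mem_eigenspace_iff.2 hx)
    have h2 : (⨆ b : ℤ, (ad ℂ G e).eigenspace (b : ℂ)) ≤
        ⨆ c : ℂ, ⨆ _ : c ≠ b, (ad ℂ G e).eigenspace c :=
      iSup_le fun c => le_iSup₂_of_le (c : ℂ) (hbc c).symm le_rfl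
    exact hx0 (Submodule.disjoint_def.1 ((ad ℂ G e).eigenspaces_iSupIndep b) x
      (End.mem_eigenspace_iff.2 hb) (h2 h1))
  have hinv : ∀ (μ b : ℂ) (z x : G), ⁅e, x⁆ = b • x →
      killingForm ℂ G ((ad ℂ G e - algebraMap ℂ (End ℂ G) μ) z) x =
        -(b + μ) * killingForm ℂ G z x := by
    intro μ b z x hx
    have h1 := killingForm_lie_left z e x
    rw [hx, ← lie_skew, map_neg, LinearMap.neg_apply, map_smul, smul_eq_mul] at h1
    rw [LinearMap.sub_apply, map_sub, LinearMap.sub_apply, Module.algebraMap_end_apply, map_smul,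
      LinearMap.smul_apply, smul_eq_mul, ad_apply]
    linear_combination -h1
  rw [Submodule.eq_iSup_inf_genEigenspace ⊤ (hstab k) (End.iSup_maxGenEigenspace_eq_top _)]
  refine iSup_le fun μ => ?_
  rintro z ⟨hz, hzμ⟩
  rw [SetLike.mem_coe, End.mem_eigenspace_iff, ad_apply] at hz
  obtain ⟨n, hn⟩ := (End.mem_maxGenEigenspace _ _ _).1 hzμ
  have hpow : ∀ (b : ℂ) (x : G), ⁅e, x⁆ = b • x → ∀ n : ℕ,
      killingForm ℂ G (((ad ℂ G e - algebraMap ℂ (End ℂ G) μ) ^ n) z) x =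
        (-(b + μ)) ^ n * killingForm ℂ G z x := by
    intro b x hx n
    induction n with
    | zero => simp
    | succ n ih => rw [pow_succ', Module.End.mul_apply, hinv μ b _ x hx, ih, pow_succ']; ring
  -- `z` is an eigenvector: `(ad e - μ) z` is orthogonal to all eigenvectors in degree `-k`
  have hzero : (ad ℂ G e - algebraMap ℂ (End ℂ G) μ) z = 0 := by
    refine eq_zero_of_killingForm_eq_zero hE (k := k) ?_ (hdual _ fun b x _ hx => ?_)
    · rw [LinearMap.sub_apply, Module.algebraMap_end_apply, ad_apply, lie_sub, lie_lie_comm hEe,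
        lie_smul, hz, lie_smul]
      module
    · rw [hinv μ b z x hx]
      have h1 := hpow b x hx n
      have h2 : ((ad ℂ G e - algebraMap ℂ (End ℂ G) μ) ^ n) z = 0 := by
        rw [Algebra.algebraMap_eq_smul_one]
        exact hn
      rw [h2, map_zero, LinearMap.zero_apply] at h1
      rcases mul_eq_zero.1 h1.symm with h3 | h3
      · rw [eq_zero_of_pow_eq_zero h3, zero_mul]
      · rw [h3, mul_zero]
  by_cases hz0 : z = 0
  · rw [hz0]
    exact zero_mem _
  obtain ⟨b, x, hx, hbx, hzx⟩ : ∃ (b : ℂ) (x : G), ⁅E, x⁆ = ((-k : ℤ) : ℂ) • x ∧ ⁅e, x⁆ = b • x ∧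
      killingForm ℂ G z x ≠ 0 := by
    by_contra! hcon
    exact hz0 (eq_zero_of_killingForm_eq_zero hE hz (hdual z hcon))
  obtain ⟨c, rfl⟩ := hint b x hx hbx (by rintro rfl; simp at hzx)
  have h1 := hinv μ c z x hbx
  rw [hzero, map_zero, LinearMap.zero_apply] at h1
  have h2 : μ = ((-c : ℤ) : ℂ) := by
    have h3 := (mul_eq_zero.1 h1.symm).resolve_right hzx
    push_cast
    linear_combination -h3
  refine Submodule.mem_iSup_of_mem (-c) ?_
  rw [End.mem_eigenspace_iff, ← h2, ← sub_eq_zero]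
  simpa using hzero

end Bigrading


/-! ### The bigrading of the complexification and the parabolic subalgebra -/

section ComplexBigrading

open LieAlgebra Module

section

variable {G : Type*} [LieRing G] [LieAlgebra ℂ G] {E e : G} (hEe : ⁅E, e⁆ = 0)

include hEe

theorem eigenspace_eq_sup_of_cube {a : ℤ}
    (h : ∀ z : G, ⁅E, z⁆ = (a : ℂ) • z → ⁅e, ⁅e, ⁅e, z⁆⁆⁆ = ⁅e, z⁆) :
    (ad ℂ G E).eigenspace (a : ℂ) = bigr E e a (-1) ⊔ bigr E e a 0 ⊔ bigr E e a 1 := by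
  refine le_antisymm (fun z hz => ?_)
    (sup_le (sup_le inf_le_left inf_le_left) inf_le_left)
  rw [End.mem_eigenspace_iff, ad_apply] at hz
  have h3 := h z hz
  have hz1 : ⁅E, ⁅e, z⁆⁆ = (a : ℂ) • ⁅e, z⁆ := by rw [lie_lie_comm hEe, hz, lie_smul]
  have hz2 : ⁅E, ⁅e, ⁅e, z⁆⁆⁆ = (a : ℂ) • ⁅e, ⁅e, z⁆⁆ := by rw [lie_lie_comm hEe, hz1, lie_smul]
  have h4 : z = (1 / 2 : ℂ) • (⁅e, ⁅e, z⁆⁆ - ⁅e, z⁆) + (z - ⁅e, ⁅e, z⁆⁆) +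
      (1 / 2 : ℂ) • (⁅e, ⁅e, z⁆⁆ + ⁅e, z⁆) := by module
  rw [h4]
  refine add_mem (Submodule.mem_sup_left (add_mem (Submodule.mem_sup_left ?_)
    (Submodule.mem_sup_right ?_))) (Submodule.mem_sup_right ?_) <;>
  rw [mem_bigr]
  · rw [lie_smul, lie_sub, hz1, hz2, lie_smul, lie_sub, h3]
    push_cast
    constructor <;> module
  · rw [lie_sub, hz, hz2, lie_sub, h3]
    push_cast
    constructor <;> module
  · rw [lie_smul, lie_add, hz1, hz2, lie_smul, lie_add, h3]
    push_cast
    constructor <;> module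

theorem eigenspace_eq_sup_of_sq {a : ℤ}
    (h : ∀ z : G, ⁅E, z⁆ = (a : ℂ) • z → ⁅e, ⁅e, z⁆⁆ = -⁅e, z⁆) :
    (ad ℂ G E).eigenspace (a : ℂ) = bigr E e a (-1) ⊔ bigr E e a 0 := by
  refine le_antisymm (fun z hz => ?_) (sup_le inf_le_left inf_le_left)
  rw [End.mem_eigenspace_iff, ad_apply] at hz
  have h3 := h z hz
  have hz1 : ⁅E, ⁅e, z⁆⁆ = (a : ℂ) • ⁅e, z⁆ := by rw [lie_lie_comm hEe, hz, lie_smul]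
  rw [show z = -⁅e, z⁆ + (z + ⁅e, z⁆) by abel]
  refine add_mem (Submodule.mem_sup_left ?_) (Submodule.mem_sup_right ?_) <;> rw [mem_bigr]
  · rw [lie_neg, hz1, lie_neg, h3]
    push_cast
    constructor <;> module
  · rw [lie_add, hz, hz1, lie_add, h3]
    push_cast
    constructor <;> module

end

namespace HomogeneousCR

open Complexification

variable {g : Type u} [LieRing g] [LieAlgebra ℝ g]

namespace IsBigradingPair

/-- The element of the complexification whose eigenvalues give the second degree: it acts on the
`i`-eigenspace of the complex structure, in degree `-1`, by `-1`, and on the `-i`-eigenspace by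
`0`. -/
noncomputable def cplx (E j : g) : ℂ ⊗[ℝ] g :=
  (1 / 2 : ℂ) • ((1 : ℂ) ⊗ₜ[ℝ] E) + (Complex.I / 2) • ((1 : ℂ) ⊗ₜ[ℝ] j)

theorem re_cplx (E j : g) : re (cplx E j) = (1 / 2 : ℝ) • E := by
  simp [cplx]

theorem im_cplx (E j : g) : im (cplx E j) = (1 / 2 : ℝ) • j := by
  simp [cplx]

theorem re_lie_cplx (E j : g) (z : ℂ ⊗[ℝ] g) :
    re ⁅cplx E j, z⁆ = (1 / 2 : ℝ) • (⁅E, re z⁆ - ⁅j, im z⁆) := by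
  rw [re_lie, re_cplx, im_cplx, smul_lie, smul_lie, smul_sub]

theorem im_lie_cplx (E j : g) (z : ℂ ⊗[ℝ] g) :
    im ⁅cplx E j, z⁆ = (1 / 2 : ℝ) • (⁅E, im z⁆ + ⁅j, re z⁆) := by
  rw [im_lie, re_cplx, im_cplx, smul_lie, smul_lie, smul_add]

variable {C : HomogeneousCR g} {E j : g} [FiniteDimensional ℝ g] (hC : C.IsTwoNondegenerate)
  (hj : C.IsBigradingPair E j)

omit [FiniteDimensional ℝ g] in
include hj in
theorem lie_cplx : ⁅(1 : ℂ) ⊗ₜ[ℝ] E, cplx E j⁆ = 0 := by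
  have := mem_gr_zero.1 hj.j_mem
  apply Complexification.ext <;> simp [re_cplx, im_cplx, this]

include hC hj

/-- In degree `0`, the eigenvalues of `ad e` are `-1`, `0` and `1`. -/
theorem cplx_cube {z : ℂ ⊗[ℝ] g} (hz : ⁅(1 : ℂ) ⊗ₜ[ℝ] E, z⁆ = ((0 : ℤ) : ℂ) • z) :
    ⁅cplx E j, ⁅cplx E j, ⁅cplx E j, z⁆⁆⁆ = ⁅cplx E j, z⁆ := by
  obtain ⟨h1, h2⟩ := IsGradingElement.re_im_mem_gr hz
  have h0 : ∀ {x}, x ∈ gr E 0 → ⁅E, ⁅j, x⁆⁆ = 0 := fun hx => mem_gr_zero.1 (hj.lie_mem_gr' hx)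
  have h00 : ∀ {x}, x ∈ gr E 0 → ⁅E, ⁅j, ⁅j, x⁆⁆⁆ = 0 := fun hx => h0 (hj.lie_mem_gr' hx)
  have hE1 := mem_gr_zero.1 h1
  have hE2 := mem_gr_zero.1 h2
  apply Complexification.ext
  · simp only [re_lie_cplx, im_lie_cplx, lie_smul, lie_sub, lie_add, hE1, hE2, h0 h1, h0 h2,
      h00 h1, hj.ad_cube hC h2, lie_zero]
    module
  · simp only [re_lie_cplx, im_lie_cplx, lie_smul, lie_sub, lie_add, hE1, hE2, h0 h1, h0 h2,
      h00 h2, hj.ad_cube hC h1, lie_zero]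
    module

/-- In degree `-1`, the eigenvalues of `ad e` are `-1` and `0`. -/
theorem cplx_sq {z : ℂ ⊗[ℝ] g} (hz : ⁅(1 : ℂ) ⊗ₜ[ℝ] E, z⁆ = ((-1 : ℤ) : ℂ) • z) :
    ⁅cplx E j, ⁅cplx E j, z⁆⁆ = -⁅cplx E j, z⁆ := by
  obtain ⟨h1, h2⟩ := IsGradingElement.re_im_mem_gr hz
  have h0 : ∀ {x}, x ∈ gr E (-1) → ⁅E, ⁅j, x⁆⁆ = -⁅j, x⁆ := fun hx =>
    mem_gr_neg_one.1 (hj.lie_mem_gr' hx)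
  have hE1 := mem_gr_neg_one.1 h1
  have hE2 := mem_gr_neg_one.1 h2
  apply Complexification.ext
  · simp only [map_neg, re_lie_cplx, im_lie_cplx, lie_smul, lie_sub, lie_add, lie_neg, hE1, hE2,
      h0 h2, hj.lie_lie_eq_neg hC h1]
    module
  · simp only [map_neg, re_lie_cplx, im_lie_cplx, lie_smul, lie_sub, lie_add, lie_neg, hE1, hE2,
      h0 h1, hj.lie_lie_eq_neg hC h2]
    module

/-- By the compatibility of the complex structure with the Levi bracket, `j` acts trivially in
degree `-2`. -/
theorem lie_eq_zero_of_mem_gr_neg_two {x : g} (hx : x ∈ gr E (-2)) : ⁅j, x⁆ = 0 := by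
  have h1 := hj.gr_neg_le_span hC 0 hx
  clear hx
  induction h1 using Submodule.span_induction with
  | mem x hx =>
    obtain ⟨y, hy, z, hz, rfl⟩ := hx
    have hjy := hj.lie_mem_gr' hy
    have hz : z ∈ gr E (-1) := hz
    have hyD : y ∈ C.D := hj.gr_le_fil hC (-1) hy
    have hzD : z ∈ C.D := hj.gr_le_fil hC (-1) hz
    have hjyD : ⁅j, y⁆ ∈ C.D := hj.gr_le_fil hC (-1) hjy
    have hjz := hj.lie_mem_gr' hz
    have hjzD : ⁅j, z⁆ ∈ C.D := hj.gr_le_fil hC (-1) hjz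
    have h1 := C.levi _ hjyD z hzD
    have h2 := hj.J_sub_mem _ hjy
    rw [hj.lie_lie_eq_neg hC hy, sub_neg_eq_add] at h2
    have h3 := hj.J_sub_mem z hz
    have h4 := C.isotropy_lie_mem _ h2 _ (C.J_mem z hzD)
    have h5 := C.isotropy_lie_mem _ h3 y hyD
    have h6 := lie_mem_gr hjy hz
    have h7 := lie_mem_gr hy hjz
    rw [leibniz_lie]
    refine hj.gr_inf_fil hC (i := -2) (j := -1) (by norm_num) (add_mem h6 h7) ?_
    refine mem_of_eq_of_mem ?_ (C.D.add_mem (C.D.sub_mem h4 h1) h5)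
    rw [add_lie, ← lie_skew (C.J z - ⁅j, z⁆) y, lie_sub]
    abel
  | zero => simp
  | add _ _ _ _ h1 h2 => rw [lie_add, h1, h2, add_zero]
  | smul c _ _ h => rw [lie_smul, h, smul_zero]

theorem lie_cplx_of_degree_neg_two {z : ℂ ⊗[ℝ] g}
    (hz : ⁅(1 : ℂ) ⊗ₜ[ℝ] E, z⁆ = ((-2 : ℤ) : ℂ) • z) : ⁅cplx E j, z⁆ = ((-1 : ℤ) : ℂ) • z := by
  obtain ⟨h1, h2⟩ := IsGradingElement.re_im_mem_gr hz
  have hj1 := hj.lie_eq_zero_of_mem_gr_neg_two hC h1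
  have hj2 := hj.lie_eq_zero_of_mem_gr_neg_two hC h2
  rw [mem_gr] at h1 h2
  apply Complexification.ext
  · rw [re_lie_cplx, hj2, h1]
    simp
  · rw [im_lie_cplx, hj1, h2]
    simp

theorem iSup_eigenspace_cplx [IsKilling ℝ g] :
    ⨆ b : ℤ, (ad ℂ (ℂ ⊗[ℝ] g) (cplx E j)).eigenspace (b : ℂ) = ⊤ := by
  set W := ⨆ b : ℤ, (ad ℂ (ℂ ⊗[ℝ] g) (cplx E j)).eigenspace (b : ℂ) with hW
  have hle : ∀ a b : ℤ, bigr ((1 : ℂ) ⊗ₜ[ℝ] E) (cplx E j) a b ≤ W := fun a b =>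
    inf_le_right.trans (le_iSup (fun b : ℤ => (ad ℂ (ℂ ⊗[ℝ] g) (cplx E j)).eigenspace (b : ℂ)) b)
  have h0 : (ad ℂ (ℂ ⊗[ℝ] g) ((1 : ℂ) ⊗ₜ[ℝ] E)).eigenspace ((0 : ℤ) : ℂ) ≤ W := by
    rw [eigenspace_eq_sup_of_cube hj.lie_cplx fun z hz => hj.cplx_cube hC hz]
    exact sup_le (sup_le (hle _ _) (hle _ _)) (hle _ _)
  have h1 : (ad ℂ (ℂ ⊗[ℝ] g) ((1 : ℂ) ⊗ₜ[ℝ] E)).eigenspace ((-1 : ℤ) : ℂ) ≤ W := by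
    rw [eigenspace_eq_sup_of_sq hj.lie_cplx fun z hz => hj.cplx_sq hC hz]
    exact sup_le (hle _ _) (hle _ _)
  have htmul : ∀ k : ℕ, ∀ x ∈ gr E (-(k + 1 : ℕ)), (1 : ℂ) ⊗ₜ[ℝ] x ∈ W := by
    intro k
    induction k with
    | zero =>
      intro x hx
      refine h1 ?_
      rw [IsGradingElement.eigenspace_ad_tmul]
      exact Submodule.tmul_mem_baseChange_of_mem _ hx
    | succ k ih =>
      intro x hx
      have h2 := hj.gr_neg_le_span hC k hx
      clear hx
      induction h2 using Submodule.span_induction with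
      | mem x hx =>
        obtain ⟨y, hy, z, hz, rfl⟩ := hx
        have hy' : (1 : ℂ) ⊗ₜ[ℝ] y ∈ W := h1 (by
          rw [IsGradingElement.eigenspace_ad_tmul]
          exact Submodule.tmul_mem_baseChange_of_mem _ hy)
        have h3 := lie_mem_iSup_eigenspace_ad hy' (ih z hz)
        rwa [ExtendScalars.bracket_tmul, mul_one] at h3
      | zero => simp
      | add _ _ _ _ h1 h2 => rw [TensorProduct.tmul_add]; exact add_mem h1 h2
      | smul c x _ h =>
        have h3 := W.smul_mem (c : ℂ) h
        have h4 : (c : ℂ) • (1 : ℂ) ⊗ₜ[ℝ] x = (1 : ℂ) ⊗ₜ[ℝ] (c • x) := by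
          refine Complexification.ext ?_ ?_
          · rw [re_smul, re_tmul, re_tmul, im_tmul]
            simp
          · rw [im_smul, re_tmul, im_tmul, im_tmul]
            simp
        rwa [h4] at h3
  refine iSup_eigenspace_eq_top_of_nonpos hj.lie_cplx (hj.iSup_eigenspace_ad_tmul hC)
    fun k hk => ?_
  rcases eq_or_lt_of_le hk with rfl | hk
  · exact h0
  · obtain ⟨l, rfl⟩ : ∃ l : ℕ, k = -((l + 1 : ℕ) : ℤ) := ⟨(-k).toNat - 1, by omega⟩
    rw [IsGradingElement.eigenspace_ad_tmul]
    intro z hz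
    rw [mem_baseChange] at hz
    have h3 := add_mem (htmul l _ hz.1) (W.smul_mem Complex.I (htmul l _ hz.2))
    rw [TensorProduct.smul_tmul', smul_eq_mul, mul_one, ← eq_re_add_im] at h3
    exact h3

theorem baseChange_gr_inf_h :
    (gr E 0 ⊓ C.h.toSubmodule).baseChange ℂ = bigr ((1 : ℂ) ⊗ₜ[ℝ] E) (cplx E j) 0 0 := by
  ext z
  have hmem : ∀ x, x ∈ gr E 0 ⊓ C.h.toSubmodule ↔ x ∈ gr E 0 ∧ ⁅j, x⁆ = 0 := fun x =>
    and_congr_right fun hx => hj.mem_h_iff hC hx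
  rw [mem_baseChange, mem_bigr, ← IsGradingElement.mem_gr_baseChange, mem_baseChange, hmem, hmem]
  constructor
  · rintro ⟨⟨h1, h2⟩, h3, h4⟩
    refine ⟨⟨h1, h3⟩, Complexification.ext ?_ ?_⟩
    · rw [re_lie_cplx, mem_gr_zero.1 h1, h4]
      simp
    · rw [im_lie_cplx, mem_gr_zero.1 h3, h2]
      simp
  · rintro ⟨⟨h1, h3⟩, h⟩
    have h4 := congrArg re h
    have h5 := congrArg im h
    rw [re_lie_cplx, mem_gr_zero.1 h1] at h4
    rw [im_lie_cplx, mem_gr_zero.1 h3] at h5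
    refine ⟨⟨h1, ?_⟩, h3, ?_⟩
    · simpa using h5
    · rw [zero_sub, smul_neg, Int.cast_zero, zero_smul, map_zero, neg_eq_zero] at h4
      exact (smul_eq_zero.1 h4).resolve_left (by norm_num)

end IsBigradingPair

section Parabolic

variable (C : HomogeneousCR g) {E : g} [FiniteDimensional ℝ g]

/-- The Levi kernel, as a subalgebra. -/
def leviSubalgebra (C : HomogeneousCR g) : LieSubalgebra ℝ g :=
  { C.leviKernel with lie_mem' := fun hx hy => C.leviKernel_lie_mem hx hy }

variable {C}

theorem isNilpotent_ad_tmul (hC : C.IsTwoNondegenerate) {u : g} (hu : u ∈ C.fil 1) :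
    IsNilpotent (ad ℂ (ℂ ⊗[ℝ] g) ((1 : ℂ) ⊗ₜ[ℝ] u)) := by
  obtain ⟨m, hm⟩ := hC.1
  obtain ⟨n, hn⟩ := hC.exists_fil_eq_bot
  rw [← fil_neg] at hm
  have h : ∀ (d : ℕ) (z : ℂ ⊗[ℝ] g),
      re (((ad ℂ (ℂ ⊗[ℝ] g) ((1 : ℂ) ⊗ₜ[ℝ] u)) ^ d) z) ∈ C.fil (-m + d) ∧
        im (((ad ℂ (ℂ ⊗[ℝ] g) ((1 : ℂ) ⊗ₜ[ℝ] u)) ^ d) z) ∈ C.fil (-m + d) := by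
    intro d z
    induction d with
    | zero => simp [hm]
    | succ d ih =>
      rw [pow_succ', Module.End.mul_apply, ad_apply, re_lie, im_lie]
      have h1 := C.lie_mem_fil hu ih.1
      have h2 := C.lie_mem_fil hu ih.2
      rw [show (1 + (-(m : ℤ) + d)) = -m + (d + 1 : ℕ) by push_cast; ring] at h1 h2
      simpa using And.intro h1 h2
  refine ⟨m + n, LinearMap.ext fun z => ?_⟩
  have h1 := h (m + n) z
  rw [show -(m : ℤ) + (m + n : ℕ) = n by push_cast; ring, hn, Submodule.mem_bot,
    Submodule.mem_bot] at h1
  exact Complexification.ext (by rw [h1.1]; simp) (by rw [h1.2]; simp)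

namespace IsBigradingPair

variable {j : g} (hC : C.IsTwoNondegenerate) (hj : C.IsBigradingPair E j)

include hC hj

theorem killingForm_eq_zero {x y : g} (hx : x ∈ C.fil 1) (hy : y ∈ C.fil 1) :
    killingForm ℝ g x y = 0 := by
  have h1 : ∀ a : ℤ, 1 ≤ a → ∀ x ∈ gr E a, C.fil 1 ≤ LinearMap.ker (killingForm ℝ g x) := by
    intro a ha x hx
    rw [hj.fil_eq_iSup_gr hC]
    exact iSup₂_le fun b hb y hy => killingForm_eq_zero_of_gr hx hy (by omega)
  have h2 : C.fil 1 ≤ LinearMap.ker ((killingForm ℝ g).flip y) := by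
    conv_lhs => rw [hj.fil_eq_iSup_gr hC]
    exact iSup₂_le fun a ha x hx => h1 a ha x hx hy
  exact h2 hx

/-- The orthogonal complement of the part of positive degree lies in the nonnegative degrees. -/
theorem mem_leviKernel_of_killingForm [IsKilling ℝ g] {w : g}
    (hw : ∀ u ∈ C.fil 1, killingForm ℝ g u w = 0) : w ∈ C.leviKernel := by
  have hstab : ∀ w ∈ (killingForm ℝ g).orthogonal (C.fil 1),
      ad ℝ g E w ∈ (killingForm ℝ g).orthogonal (C.fil 1) := by
    intro w hw u hu
    have h1 : ⁅u, E⁆ ∈ C.fil 1 := by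
      have := C.lie_mem_fil hu (j := 0) hj.mem
      rwa [add_zero] at this
    have h2 := hw _ h1
    change killingForm ℝ g ⁅u, E⁆ w = 0 at h2
    rwa [killingForm_lie_left_real] at h2
  have hw' : w ∈ (killingForm ℝ g).orthogonal (C.fil 1) := hw
  rw [Submodule.eq_iSup_inf_eigenspace_intCast (hj.iSup_gr hC) _ hstab] at hw'
  refine (iSup_le fun k => ?_ : _ ≤ C.fil 0) hw'
  rintro x ⟨hx, hxk⟩
  rcases le_or_gt 0 k with hk | hk
  · exact C.fil_antitone hk (hj.gr_le_fil hC k hxk)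
  · have : x = 0 := hj.eq_zero_of_killingForm hC hxk fun y hy => by
      rw [LieModule.traceForm_comm]
      exact hx y (C.fil_antitone (by omega) (hj.gr_le_fil hC _ hy))
    rw [this]
    exact zero_mem _

/-- A Borel subalgebra that contains the nilpotent algebra of elements of positive degree is
contained in its orthogonal complement for the Killing form, that is in nonnegative degrees. -/
theorem isParabolicSubalgebra [IsKilling ℝ g] : IsParabolicSubalgebra (leviSubalgebra C) := by
  let U : LieSubalgebra ℂ (ℂ ⊗[ℝ] g) :=
    { (C.fil 1).baseChange ℂ with
      lie_mem' := fun {z w} hz hw => by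
        have hz' := mem_baseChange.1 hz
        have hw' := mem_baseChange.1 hw
        have h : ∀ {x y : g}, x ∈ C.fil 1 → y ∈ C.fil 1 → ⁅x, y⁆ ∈ C.fil 1 := fun hx hy =>
          C.fil_antitone (by norm_num) (C.lie_mem_fil hx hy)
        refine mem_baseChange.2 ⟨?_, ?_⟩
        · rw [re_lie]
          exact sub_mem (h hz'.1 hw'.1) (h hz'.2 hw'.2)
        · rw [im_lie]
          exact add_mem (h hz'.1 hw'.2) (h hz'.2 hw'.1) }
  have hmemU : ∀ {z}, z ∈ U ↔ re z ∈ C.fil 1 ∧ im z ∈ C.fil 1 := mem_baseChange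
  have hU : LieAlgebra.IsSolvable U := by
    refine isSolvable_of_killingForm_eq_zero U fun z hz w hw => ?_
    have hz' := hmemU.1 hz
    have hw' := hmemU.1 hw
    have h1 : z = (1 : ℂ) ⊗ₜ[ℝ] re z + Complex.I • ((1 : ℂ) ⊗ₜ[ℝ] im z) := by
      rw [TensorProduct.smul_tmul', smul_eq_mul, mul_one, ← eq_re_add_im]
    rw [h1, map_add, map_smul, LinearMap.add_apply, LinearMap.smul_apply, killingForm_tmul,
      killingForm_tmul, hj.killingForm_eq_zero hC hz'.1 hw'.1,
      hj.killingForm_eq_zero hC hz'.1 hw'.2, hj.killingForm_eq_zero hC hz'.2 hw'.1,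
      hj.killingForm_eq_zero hC hz'.2 hw'.2]
    simp
  obtain ⟨b, hb, hUb⟩ := exists_isBorelSubalgebra_ge U hU
  refine ⟨b, hb, fun z hz => ?_⟩
  have key : ∀ u ∈ C.fil 1, killingForm ℝ g u (re z) = 0 ∧ killingForm ℝ g u (im z) = 0 := by
    intro u hu
    have h1 : killingForm ℂ (ℂ ⊗[ℝ] g) z ((1 : ℂ) ⊗ₜ[ℝ] u) = 0 :=
      killingForm_eq_zero_of_isSolvable b hb.1 hz (hUb (hmemU.2 (by simpa using hu)))
        (Or.inl (isNilpotent_ad_tmul hC hu))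
    rw [killingForm_comm, killingForm_tmul] at h1
    rw [Complex.ext_iff] at h1
    simpa using h1
  exact mem_baseChange.2 ⟨hj.mem_leviKernel_of_killingForm hC fun u hu => (key u hu).1,
    hj.mem_leviKernel_of_killingForm hC fun u hu => (key u hu).2⟩

end IsBigradingPair

end Parabolic

end HomogeneousCR

end ComplexBigrading


/-! ### Regularity -/

section Regularity

open LieAlgebra Module

/-- A family of linear maps on the summands of an internal direct sum extends to the sum. -/
theorem DirectSum.IsInternal.exists_linearMap {R ι M N : Type*} [Ring R] [DecidableEq ι]
    [AddCommGroup M] [Module R M] [AddCommGroup N] [Module R N] {A : ι → Submodule R M}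
    (hA : DirectSum.IsInternal A) (f : ∀ i, A i →ₗ[R] N) :
    ∃ F : M →ₗ[R] N, ∀ i (x : A i), F x = f i x := by
  have hA' : Function.Bijective (DirectSum.coeLinearMap A) := hA
  refine ⟨DirectSum.toModule R ι N f ∘ₗ
    (LinearEquiv.ofBijective (DirectSum.coeLinearMap A) hA').symm.toLinearMap, fun i x => ?_⟩
  have h : (LinearEquiv.ofBijective (DirectSum.coeLinearMap A) hA').symm (x : M) =
      DirectSum.lof R ι (fun i => A i) i x := by
    rw [LinearEquiv.symm_apply_eq, LinearEquiv.ofBijective_apply, DirectSum.coeLinearMap_lof]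
  rw [LinearMap.comp_apply, LinearEquiv.coe_coe, h, DirectSum.toModule_lof]

namespace HomogeneousCR

variable {g : Type u} [LieRing g] [LieAlgebra ℝ g]

namespace IsBigradingPair

variable {C : HomogeneousCR g} {E j : g} [FiniteDimensional ℝ g] (hC : C.IsTwoNondegenerate)
  (hj : C.IsBigradingPair E j)
  {m : Type v} [LieRing m] [LieAlgebra ℝ m] {S : SecondOrderLeviTanaka m}

/-- The elements of degree `0` that act antilinearly in degree `-1`. -/
def anti (E j : g) : Submodule ℝ g where
  carrier := {x | x ∈ gr E 0 ∧ ∀ y ∈ gr E (-1), ⁅j, ⁅x, y⁆⁆ = -⁅x, ⁅j, y⁆⁆}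
  add_mem' := fun {a b} ha hb => ⟨add_mem ha.1 hb.1, fun y hy => by
    rw [add_lie, add_lie, lie_add, ha.2 y hy, hb.2 y hy, neg_add]⟩
  zero_mem' := ⟨zero_mem _, fun y _ => by simp⟩
  smul_mem' := fun c x hx => ⟨Submodule.smul_mem _ c hx.1, fun y hy => by
    rw [smul_lie, smul_lie, lie_smul, hx.2 y hy, smul_neg]⟩

omit [FiniteDimensional ℝ g] in
include hj in
/-- A product of three antilinear maps is antilinear. -/
theorem lie_lie_mem_anti {x y z : g} (hx : x ∈ anti E j) (hy : y ∈ anti E j)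
    (hz : z ∈ anti E j) : ⁅⁅x, y⁆, z⁆ ∈ anti E j := by
  refine ⟨lie_mem_gr_of_zero (lie_mem_gr_of_zero hx.1 hy.1) hz.1, fun v hv => ?_⟩
  have hjv := hj.lie_mem_gr' hv
  have key : ∀ {x y z : g}, x ∈ anti E j → y ∈ anti E j → z ∈ anti E j →
      ⁅j, ⁅x, ⁅y, ⁅z, v⁆⁆⁆⁆ = -⁅x, ⁅y, ⁅z, ⁅j, v⁆⁆⁆⁆ := by
    intro x y z hx hy hz
    rw [hx.2 _ (lie_mem_gr_of_zero hy.1 (lie_mem_gr_of_zero hz.1 hv)),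
      hy.2 _ (lie_mem_gr_of_zero hz.1 hv), hz.2 _ hv]
    simp only [lie_neg, neg_neg]
  simp only [lie_lie, sub_lie, lie_sub, key hx hy hz, key hy hx hz, key hz hx hy, key hz hy hx]
  abel

include hC hj

theorem antilinearBracket_sub_lie_mem {x y : g} (hx : x ∈ anti E j) (hy : y ∈ gr E (-1)) :
    C.antilinearBracket ((1 / 2 : ℝ) • x) y - ⁅x, y⁆ ∈ C.leviKernel := by
  have h1 := hj.antilinearBracket_sub_mem hC (Submodule.smul_mem _ (1 / 2 : ℝ) hx.1) hy
  have h2 : ⁅j, ⁅x, ⁅j, y⁆⁆⁆ = ⁅x, y⁆ := by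
    rw [hx.2 _ (hj.lie_mem_gr' hy), hj.lie_lie_eq_neg hC hy, lie_neg, neg_neg]
  refine mem_of_eq_of_mem ?_ h1
  rw [smul_lie, smul_lie, lie_smul, h2]
  module

/-- The antilinear part of the action of an element of the Levi kernel in degree `-1` is the action
of an element of `anti E j`, namely of a multiple of `⁅j, ⁅j, a⁆⁆`. -/
theorem exists_anti {x : g} (hx : x ∈ C.leviKernel) : ∃ w ∈ anti E j, ∀ y ∈ gr E (-1),
    C.antilinearBracket x y - ⁅w, y⁆ ∈ C.leviKernel := by
  obtain ⟨a, ha, f, hf, rfl⟩ := hj.exists_gr_add_fil hC (i := 0) hx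
  have h1 : ∀ {y}, y ∈ gr E (-1) →
      ⁅-(1 / 2 : ℝ) • ⁅j, ⁅j, a⁆⁆, y⁆ = ⁅a, y⁆ + ⁅j, ⁅a, ⁅j, y⁆⁆⁆ := fun {y} hy => by
    rw [smul_lie, hj.lie_lie_lie hC ha hy]
    module
  refine ⟨-(1 / 2 : ℝ) • ⁅j, ⁅j, a⁆⁆,
    ⟨Submodule.smul_mem _ _ (hj.lie_mem_gr' (hj.lie_mem_gr' ha)), fun y hy => ?_⟩, fun y hy => ?_⟩
  · have hjy := hj.lie_mem_gr' hy
    rw [h1 hy, h1 hjy, hj.lie_lie_eq_neg hC hy, lie_add,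
      hj.lie_lie_eq_neg hC (lie_mem_gr_of_zero ha hjy), lie_neg, lie_neg]
    abel
  · have hyD : y ∈ C.D := hj.gr_le_fil hC (-1) hy
    have hf' := ((C.mem_fil_succ (i := 0) (by omega)).1 hf).2
    have h2 : C.antilinearBracket f y ∈ C.leviKernel :=
      add_mem (hf' _ hyD) (C.J_mem_leviKernel (hf' _ (C.J_mem y hyD)))
    refine mem_of_eq_of_mem ?_ (add_mem (hj.antilinearBracket_sub_mem hC ha hy) h2)
    rw [h1 hy]
    simp only [antilinearBracket, add_lie, map_add]
    abel

/-- The maps that give the symbol of the geometry identify `anti E j` with `S.k`. -/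
theorem mem_k_iff {π : g →ₗ[ℝ] m} (hker : ∀ x ∈ C.D, π x = 0 ↔ x ∈ C.leviKernel)
    {T : Module.End ℝ (S.part 1)} :
    (∃ x ∈ C.leviKernel, ∀ y ∈ C.D, ∀ v : S.part 1, (v : m) = π y →
        (T v : m) = π (C.antilinearBracket x y)) ↔
      ∃ x ∈ anti E j, ∀ y ∈ gr E (-1), ∀ v : S.part 1, (v : m) = π y → (T v : m) = π ⁅x, y⁆ := by
  have hD : ∀ {y}, y ∈ gr E (-1) → y ∈ C.D := fun hy => hj.gr_le_fil hC (-1) hy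
  have hπ : ∀ {x y : g}, x - y ∈ C.leviKernel → π x = π y := fun {x y} h => by
    rw [← sub_eq_zero, ← map_sub]
    exact (hker _ h.1).2 h
  constructor
  · rintro ⟨x, hx, h⟩
    obtain ⟨w, hw, hxw⟩ := hj.exists_anti hC hx
    exact ⟨w, hw, fun y hy v hv => (h y (hD hy) v hv).trans (hπ (hxw y hy))⟩
  · rintro ⟨w, hw, h⟩
    have hwF : (1 / 2 : ℝ) • w ∈ C.leviKernel :=
      hj.gr_le_fil hC 0 (Submodule.smul_mem _ _ hw.1)
    refine ⟨(1 / 2 : ℝ) • w, hwF, fun y hyk v hv => ?_⟩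
    obtain ⟨y, hy, k, hk, rfl⟩ := hj.exists_gr_add_fil hC (i := -1) hyk
    have hk : k ∈ C.leviKernel := hk
    rw [h y hy v (hv.trans (hπ (by simpa using hk)))]
    refine (hπ ?_).symm
    refine mem_of_eq_of_mem ?_ (add_mem (hj.antilinearBracket_sub_lie_mem hC hw hy)
      (antilinearBracket_mem_of_mem_leviKernel hwF hk))
    simp only [antilinearBracket, lie_add, map_add]
    abel

theorem exists_mem_gr_of_mem_part {π : ℕ → g →ₗ[ℝ] m}
    (hsurj : ∀ k, (C.filt (k + 1)).map (π (k + 1)) = S.part (k + 1))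
    (hker : ∀ k, ∀ x ∈ C.filt (k + 1), π (k + 1) x = 0 ↔ x ∈ C.filt k) (k : ℕ) {v : m}
    (hv : v ∈ S.part (k + 1)) : ∃ y ∈ gr E (-(k + 1 : ℕ)), π (k + 1) y = v := by
  rw [← hsurj] at hv
  obtain ⟨x, hx, rfl⟩ := hv
  have hx' : x ∈ C.filt (k + 1) := hx
  rw [← fil_neg] at hx'
  obtain ⟨a, ha, b, hb, rfl⟩ := hj.exists_gr_add_fil hC hx'
  rw [show -((k + 1 : ℕ) : ℤ) + 1 = -(k : ℤ) by push_cast; ring, fil_neg] at hb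
  refine ⟨a, ha, ?_⟩
  have hb' : b ∈ C.filt (k + 1) := by
    rw [← fil_neg] at hb ⊢
    exact C.fil_antitone (by push_cast; omega) hb
  rw [map_add, (hker k b hb').2 hb, add_zero]

/-- An element of degree `0` induces a derivation of the symbol. -/
theorem exists_lieDerivation {π : ℕ → g →ₗ[ℝ] m}
    (hsurj : ∀ k, (C.filt (k + 1)).map (π (k + 1)) = S.part (k + 1))
    (hker : ∀ k, ∀ x ∈ C.filt (k + 1), π (k + 1) x = 0 ↔ x ∈ C.filt k)
    (hlie : ∀ i j, 1 ≤ i → 1 ≤ j → ∀ x ∈ C.filt i, ∀ y ∈ C.filt j,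
      π (i + j) ⁅x, y⁆ = ⁅π i x, π j y⁆) {w : g} (hw : w ∈ gr E 0) :
    ∃ δ : LieDerivation ℝ m m, ∀ k : ℕ, ∀ y ∈ gr E (-(k + 1 : ℕ)),
      δ (π (k + 1) y) = π (k + 1) ⁅w, y⁆ := by
  have hfilt : ∀ (k : ℕ) {y}, y ∈ gr E (-(k : ℕ)) → y ∈ C.filt k := fun k y hy => by
    rw [← fil_neg]
    exact hj.gr_le_fil hC _ hy
  have hbij := hj.exists_mem_gr_of_mem_part hC hsurj hker
  have hinj : ∀ k : ℕ, ∀ y ∈ gr E (-(k + 1 : ℕ)), π (k + 1) y = 0 → y = 0 := by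
    intro k y hy h
    have h1 := (hker k y (hfilt _ hy)).1 h
    rw [← fil_neg] at h1
    exact hj.gr_inf_fil hC (by push_cast; omega) hy h1
  -- the isomorphisms of the homogeneous components, and the inverse of their sum
  have hP : ∃ P : m →ₗ[ℝ] g, ∀ k : ℕ, ∀ y ∈ gr E (-(k + 1 : ℕ)), P (π (k + 1) y) = y := by
    have hmem : ∀ k : ℕ, ∀ y ∈ gr E (-(k + 1 : ℕ)), π (k + 1) y ∈ S.part (k + 1) :=
      fun k y hy => hsurj k ▸ Submodule.mem_map_of_mem (hfilt _ hy)
    let e : ∀ k : ℕ, gr E (-(k + 1 : ℕ)) ≃ₗ[ℝ] S.part (k + 1) := fun k =>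
      LinearEquiv.ofBijective ((π (k + 1)).restrict (hmem k)) (by
        refine ⟨?_, ?_⟩
        · rw [← LinearMap.ker_eq_bot, LinearMap.ker_eq_bot']
          intro y hy
          exact Subtype.ext (hinj k y y.2 (congrArg Subtype.val hy))
        · rintro ⟨v, hv⟩
          obtain ⟨y, hy, h⟩ := hbij k hv
          exact ⟨⟨y, hy⟩, Subtype.ext h⟩)
    let f : ∀ k : ℕ, S.part k →ₗ[ℝ] g := fun k => match k with
      | 0 => 0
      | k + 1 => (gr E (-(k + 1 : ℕ))).subtype ∘ₗ (e k).symm.toLinearMap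
    obtain ⟨P, hP⟩ := S.grading.1.exists_linearMap f
    refine ⟨P, fun k y hy => ?_⟩
    have h1 := hP (k + 1) ⟨π (k + 1) y, hmem k y hy⟩
    have h2 : (e k).symm ⟨π (k + 1) y, hmem k y hy⟩ = ⟨y, hy⟩ := by
      rw [LinearEquiv.symm_apply_eq]
      rfl
    refine h1.trans ?_
    change (((e k).symm ⟨π (k + 1) y, hmem k y hy⟩ : gr E (-(k + 1 : ℕ))) : g) = y
    rw [h2]
  obtain ⟨P, hP⟩ := hP
  obtain ⟨Q, hQ⟩ := (hj.isLieGrading_gr hC).1.exists_linearMap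
    (fun i => (π i.natAbs) ∘ₗ (gr E i).subtype)
  have hδ : ∀ k : ℕ, ∀ y ∈ gr E (-(k + 1 : ℕ)),
      (Q ∘ₗ ad ℝ g w ∘ₗ P) (π (k + 1) y) = π (k + 1) ⁅w, y⁆ := by
    intro k y hy
    rw [LinearMap.comp_apply, LinearMap.comp_apply, hP k y hy, ad_apply]
    have := hQ (-(k + 1 : ℕ)) ⟨⁅w, y⁆, lie_mem_gr_of_zero hw hy⟩
    simp only [Int.natAbs_neg, Int.natAbs_natCast] at this
    exact this
  refine ⟨{ toLinearMap := Q ∘ₗ ad ℝ g w ∘ₗ P, leibniz' := fun a b => ?_ }, hδ⟩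
  have htop : ∀ a : m, a ∈ ⨆ k, S.part k := fun a =>
    S.grading.1.submodule_iSup_eq_top ▸ Submodule.mem_top
  have ha := htop a
  induction ha using Submodule.iSup_induction' with
  | mem k a ha =>
    cases k with
    | zero =>
      rw [S.part_zero, Submodule.mem_bot] at ha
      simp [ha]
    | succ k =>
      have hb := htop b
      induction hb using Submodule.iSup_induction' with
      | mem l b hb =>
        cases l with
        | zero =>
          rw [S.part_zero, Submodule.mem_bot] at hb
          simp [hb]
        | succ l =>
          obtain ⟨y, hy, rfl⟩ := hbij k ha
          obtain ⟨z, hz, rfl⟩ := hbij l hb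
          have hwy := lie_mem_gr_of_zero hw hy
          have hwz := lie_mem_gr_of_zero hw hz
          have hyz := lie_mem_gr hy hz
          rw [show -((k + 1 : ℕ) : ℤ) + -((l + 1 : ℕ) : ℤ) = -((k + 1 + l + 1 : ℕ) : ℤ) by
            push_cast; ring] at hyz
          have h1 : ∀ y ∈ gr E (-(k + 1 : ℕ)), ∀ z ∈ gr E (-(l + 1 : ℕ)),
              ⁅π (k + 1) y, π (l + 1) z⁆ = π (k + 1 + l + 1) ⁅y, z⁆ := fun y hy z hz =>
            (hlie (k + 1) (l + 1) (by omega) (by omega) y (hfilt _ hy) z (hfilt _ hz)).symm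
          rw [h1 y hy z hz, hδ _ _ hyz, hδ k y hy, hδ l z hz, h1 y hy _ hwz,
            ← lie_skew _ (π (k + 1) ⁅w, y⁆), h1 _ hwy z hz, leibniz_lie, map_add]
          abel
      | zero => simp
      | add _ _ _ _ h1 h2 =>
        rw [lie_add, map_add, h1, h2, map_add, lie_add, add_lie]
        abel
  | zero => simp
  | add _ _ _ _ h1 h2 =>
    rw [add_lie, map_add, h1, h2, map_add, lie_add, add_lie]
    abel

/-- The space `𝔨` consists of the actions of the elements of degree `0` that anticommute with `j`.
These act on the whole symbol by derivations, and they are stable under the triple bracket. -/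
theorem isRegular (hS : C.HasSecondOrderLeviTanaka S) : S.IsRegular := by
  obtain ⟨π, hsurj, hker, hlie, -, hk⟩ := hS
  have hk' : ∀ T : Module.End ℝ (S.part 1), T ∈ S.k ↔ ∃ x ∈ anti E j, ∀ y ∈ gr E (-1),
      ∀ v : S.part 1, (v : m) = π 1 y → (T v : m) = π 1 ⁅x, y⁆ := fun T =>
    (hk T).trans (hj.mem_k_iff hC (hker 0))
  have hv := hj.exists_mem_gr_of_mem_part hC hsurj hker
  refine ⟨fun T hT => ?_, fun A hA B hB T hT => ?_⟩
  · obtain ⟨w, hw, hTw⟩ := (hk' T).1 hT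
    obtain ⟨δ, hδ⟩ := hj.exists_lieDerivation hC hsurj hker hlie hw.1
    refine ⟨δ, fun i x hx => ?_, fun v => ?_⟩
    · cases i with
      | zero =>
        rw [S.part_zero, Submodule.mem_bot] at hx ⊢
        rw [hx, map_zero]
      | succ k =>
        obtain ⟨y, hy, rfl⟩ := hv k hx
        rw [hδ k y hy, ← hsurj]
        refine Submodule.mem_map_of_mem ?_
        rw [← fil_neg]
        exact hj.gr_le_fil hC _ (lie_mem_gr_of_zero hw.1 hy)
    · obtain ⟨y, hy, h⟩ := hv 0 v.2
      rw [← h, hTw y hy v h.symm]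
      exact hδ 0 y hy
  · obtain ⟨x, hx, hAx⟩ := (hk' A).1 hA
    obtain ⟨y, hy, hBy⟩ := (hk' B).1 hB
    obtain ⟨z, hz, hTz⟩ := (hk' T).1 hT
    refine (hk' _).2 ⟨⁅⁅x, y⁆, z⁆, hj.lie_lie_mem_anti hx hy hz, fun u hu v huv => ?_⟩
    have h1 : ∀ {A B : Module.End ℝ (S.part 1)} {x y u : g}, x ∈ gr E 0 → y ∈ gr E 0 →
        u ∈ gr E (-1) → (∀ y ∈ gr E (-1), ∀ v : S.part 1, (v : m) = π 1 y →
          (A v : m) = π 1 ⁅x, y⁆) → (∀ u ∈ gr E (-1), ∀ v : S.part 1, (v : m) = π 1 u →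
          (B v : m) = π 1 ⁅y, u⁆) → ∀ v : S.part 1, (v : m) = π 1 u →
          (⁅A, B⁆ v : m) = π 1 ⁅⁅x, y⁆, u⁆ := by
      intro A B x y u hx hy hu hA hB v hv
      have h2 := hA _ (lie_mem_gr_of_zero hy hu) (B v) (hB u hu v hv)
      have h3 := hB _ (lie_mem_gr_of_zero hx hu) (A v) (hA u hu v hv)
      rw [Ring.lie_def, LinearMap.sub_apply, Module.End.mul_apply, Module.End.mul_apply,
        Submodule.coe_sub, h2, h3, ← map_sub, lie_lie]
    exact h1 (lie_mem_gr_of_zero hx.1 hy.1) hz.1 hu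
      (fun u hu v hv => h1 hx.1 hy.1 hu hAx hBy v hv) hTz v huv

end IsBigradingPair

end HomogeneousCR

end Regularity

theorem mainTheorem4 {g : Type u} [LieRing g] [LieAlgebra ℝ g] [FiniteDimensional ℝ g]
    {n : Type v} [LieRing n] [LieAlgebra ℝ n]
    (S : SecondOrderLeviTanaka n) (C : HomogeneousCR g)
    (h_nondeg : C.IsTwoNondegenerate) (h_symbol : C.HasSecondOrderLeviTanaka S)
    (h_semisimple : LieAlgebra.IsSemisimple ℝ g)
    (h_max : ∀ (g' : Type u) [LieRing g'] [LieAlgebra ℝ g'] [FiniteDimensional ℝ g']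
      (C' : HomogeneousCR g'), C'.IsTwoNondegenerate → C'.HasSecondOrderLeviTanaka S →
      Module.finrank ℝ g' ≤ Module.finrank ℝ g) :
    (∃ (p : LieSubalgebra ℝ g) (gr : ℤ → Submodule ℝ g) (g₀ : LieSubalgebra ℝ g)
        (bg : ℤ → ℤ → Submodule ℂ (ℂ ⊗[ℝ] g)),
      -- `𝔥` lies in the parabolic subalgebra `𝔭`
      IsParabolicSubalgebra p ∧ C.h ≤ p ∧
      -- the grading of `𝔤` that corresponds to `𝔭` and to the filtration by the CR geometry,
      -- with `𝔥 = 𝔤_{0,I} ⊕ 𝔭₊`, where `𝔤_{0,I} = 𝔤₀ ∩ 𝔥`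
      IsLieGrading gr ∧ p.toSubmodule = ⨆ i : ℤ, ⨆ _ : 0 ≤ i, gr i ∧
      (∀ k : ℕ, C.filt k = ⨆ i : ℤ, ⨆ _ : -(k : ℤ) ≤ i, gr i) ∧
      g₀.toSubmodule = gr 0 ∧
      C.h.toSubmodule = (gr 0 ⊓ C.h.toSubmodule) ⊔ ⨆ i : ℤ, ⨆ _ : 0 < i, gr i ∧
      -- the bigrading of the complexification
      IsLieGrading (fun ab : ℤ × ℤ => bg ab.1 ab.2) ∧
      -- (1), for the complex structure of the CR geometry
      (∃ P : PseudoHermitianPair (C.h.comap g₀.incl),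
        ∀ x : g₀, P.σ x = -x → (P.J x : g) - C.J x ∈ C.h) ∧
      -- (2)
      (∀ a : ℤ, (gr a).baseChange ℂ = ⨆ b : ℤ, bg a b) ∧
      -- (3)
      (gr 0 ⊓ C.h.toSubmodule).baseChange ℂ = bg 0 0 ∧
      -- (4)
      (gr 0).baseChange ℂ = bg 0 (-1) ⊔ bg 0 0 ⊔ bg 0 1 ∧
      -- (5)
      (gr (-1)).baseChange ℂ = bg (-1) (-1) ⊔ bg (-1) 0 ∧
      -- (6)
      (gr (-2)).baseChange ℂ = bg (-2) (-1)) ∧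
    S.IsRegular := by
  obtain ⟨E, j, hj⟩ := h_nondeg.exists_isBigradingPair h_symbol h_max
  have hE : C.IsGradingElement E := hj.toIsGradingElement
  have he := hj.iSup_eigenspace_cplx h_nondeg
  have hfil := hE.fil_eq_iSup_gr h_nondeg
  refine ⟨⟨HomogeneousCR.leviSubalgebra C, HomogeneousCR.gr E,
    HomogeneousCR.IsBigradingPair.grZero E,
    bigr ((1 : ℂ) ⊗ₜ[ℝ] E) (HomogeneousCR.IsBigradingPair.cplx E j),
    hj.isParabolicSubalgebra h_nondeg, C.h_le_leviKernel, hE.isLieGrading_gr h_nondeg, hfil 0,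
    fun k => by rw [← HomogeneousCR.fil_neg, hfil], rfl, hE.h_eq h_nondeg,
    isLieGrading_bigr hj.lie_cplx (hE.iSup_eigenspace_ad_tmul h_nondeg) he,
    hj.exists_pseudoHermitianPair h_nondeg, fun a => ?_, hj.baseChange_gr_inf_h h_nondeg,
    ?_, ?_, ?_⟩, hj.isRegular h_nondeg h_symbol⟩
  · rw [← HomogeneousCR.IsGradingElement.eigenspace_ad_tmul]
    exact eigenspace_eq_iSup_bigr hj.lie_cplx he a
  · rw [← HomogeneousCR.IsGradingElement.eigenspace_ad_tmul]
    exact eigenspace_eq_sup_of_cube hj.lie_cplx fun z hz => hj.cplx_cube h_nondeg hz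
  · rw [← HomogeneousCR.IsGradingElement.eigenspace_ad_tmul]
    exact eigenspace_eq_sup_of_sq hj.lie_cplx fun z hz => hj.cplx_sq h_nondeg hz
  · rw [← HomogeneousCR.IsGradingElement.eigenspace_ad_tmul]
    refine le_antisymm (fun z hz => ?_) inf_le_left
    have hz' := Module.End.mem_eigenspace_iff.1 hz
    exact mem_bigr.2 ⟨hz', hj.lie_cplx_of_degree_neg_two h_nondeg hz'⟩
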